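/- Let $F=\mathbb{F}_q$ be a finite field with $q$ elements, $\overline{F}$ an algebraic closure of $F$, and $G$ a finite group with $\gcd(q,|G|)=1$. Call $G$ *normally monomial* if every irreducible representation of $G$ over $\overline{F}$ is isomorphic to one induced from a linear character of a normal subgroup of $G$. For each normal subgroup $N$ of $G$ fix a normal subgroup $A_N\supseteq N$ of $G$ such that $A_N/N$ is an abelian normal subgroup of maximal order in $G/N$. Let $\mathcal{D}_N$ be the set of subgroups $D$ with $N\le D\le A_N$ such that $\operatorname{core}_G(D)=N$ and $A_N/D$ is cyclic and a maximal abelian subgroup of $N_G(D)/D$. Fix a set $\mathcal{T}_N$ of representatives of $\mathcal{D}_N$ under conjugacy in $G$, and put $\mathcal{S}(G)=\bigcup_{N\trianglelefteq G}\{(A_N,D): D\in\mathcal{T}_N\}$. For $(A,D)\in\mathcal{S}(G)$ let $n=[A:D]$ and let $o=o_n(q)$ be the multiplicative order of $q$ modulo $n$. Let $\mathcal{C}(A/D)$ be the set of all $C=\{\chi,\chi^q,\dots,\chi^{q^{o-1}}\}$, where $\chi$ is a generator of the cyclic group $\operatorname{Irr}(A/D)$ of linear characters $A/D\to\overline{F}^{\times}$.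 The group $N_G(D)$ acts on $\mathcal{C}(A/D)$ through $\chi^g(a)=\chi(gag^{-1})$. Let $\mathcal{R}(A/D)$ be the set of orbits, and let $E_G(A/D)$ be the stabilizer of any $C\in\mathcal{C}(A/D)$ (it does not depend on $C$). For $C\in\mathcal{C}(A/D)$ and $\chi\in C$ put $$\varepsilon_C(A,D)=\frac{1}{|A|}\sum_{a\in A}\operatorname{tr}_{F(\zeta_n)/F}(\chi(aD))\,a^{-1}\in FG,$$ where $\zeta_n\in\overline{F}$ is a primitive $n$-th root of unity, and let $e_C(G,A,D)$ be the sum of the distinct $G$-conjugates of $\varepsilon_C(A,D)$. It depends only on the orbit of $C$, and we write $C\in\mathcal{R}(A/D)$ when $C$ stands for its orbit. Then, for every choice of the $A_N$ and $\mathcal{T}_N$, the set $$E=\{e_C(G,A,D) : (A,D)\in\mathcal{S}(G),\ C\in\mathcal{R}(A/D)\}$$ is the complete set of primitive central idempotents of $FG$ if and only if $G$ is normally monomial. Consequently, if $G$ is normally monomial, then there is an isomorphism of $F$-algebras $$FG\;\cong\;\bigoplus_{(A,D)\in\mathcal{S}(G)} M_{[G:A]}\bigl(\mathbb{F}_{q^{\,o/[E_G(A/D):A]}}\bigr)^{(|\mathcal{R}(A/D)|)},\qquad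 o=o_{[A:D]}(q).$$ -/

import Mathlib

universe u v

noncomputable section

namespace NormMon

/-! ### Normally monomial groups -/

/-- The one-dimensional representation on `k` afforded by a linear character. -/
def linearRep {k : Type u} [Field k] {H : Type v} [Group H] (ψ : H →* kˣ) :
    Representation k H k :=
  (Module.toModuleEnd k k : k →+* Module.End k k).toMonoidHom.comp ((Units.coeHom k).comp ψ)

/-- Every irreducible `k`-representation of `G` is induced from a linear character of a normal
subgroup. This is a condition on representations and not on their trace functions, because over a
field of positive characteristic the trace function does not determine the degree. -/
def IsNormallyMonomial (k : Type u) [Field k] (G : Type v) [Group G] : Prop :=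
  ∀ (V : Type u) [AddCommGroup V] [Module k V] (ρ : Representation k G V), ρ.IsIrreducible →
    ∃ N : Subgroup G, N.Normal ∧ ∃ ψ : N →* kˣ,
      Nonempty (Representation.Equiv ρ (Representation.ind N.subtype (linearRep ψ)))

/-! ### Primitive central idempotents -/

def IsCentralIdempotent {R : Type u} [Ring R] (e : R) : Prop :=
  e ∈ Subring.center R ∧ IsIdempotentElem e

def IsPrimitiveCentralIdempotent {R : Type u} [Ring R] (e : R) : Prop :=
  IsCentralIdempotent e ∧ e ≠ 0 ∧
    ∀ e₁ e₂ : R, IsCentralIdempotent e₁ → IsCentralIdempotent e₂ → e₁ * e₂ = 0 →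
      e₁ + e₂ = e → e₁ = 0 ∨ e₂ = 0

/-! ### The pairs `(A_N, D)` -/

section Pairs

variable {G : Type v} [Group G]

/-- `B` is an abelian normal subgroup of maximal order. -/
def IsMaxAbelianNormal (B : Subgroup G) : Prop :=
  B.Normal ∧ IsMulCommutative B ∧
    ∀ B' : Subgroup G, B'.Normal → IsMulCommutative B' → Nat.card B' ≤ Nat.card B

/-- The image of `K` in `N_G(D)/D`, that is, `K/D` when `D ≤ K ≤ N_G(D)`. -/
def imageInNormalizerQuotient (K D : Subgroup G) :
    Subgroup (Subgroup.normalizer (D : Set G) ⧸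
      D.subgroupOf (Subgroup.normalizer (D : Set G))) :=
  (K.subgroupOf (Subgroup.normalizer (D : Set G))).map (QuotientGroup.mk' _)

/-- The set `𝒟_N` attached to `N` and `A = A_N`. -/
def kernelSet (N A : Subgroup G) : Set (Subgroup G) :=
  {D | D ≤ A ∧ N ≤ D ∧ D.normalCore = N ∧
    IsCyclic (imageInNormalizerQuotient A D) ∧
    Maximal (fun B : Subgroup (Subgroup.normalizer (D : Set G) ⧸
        D.subgroupOf (Subgroup.normalizer (D : Set G))) => IsMulCommutative B)
      (imageInNormalizerQuotient A D)}

def AreConjugate (D D' : Subgroup G) : Prop :=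
  ∃ g : G, D' = D.map (MulAut.conj g).toMonoidHom

/-- `T` is a set of representatives of `𝒟` under conjugacy in `G`. -/
def IsConjTransversal (T 𝒟 : Set (Subgroup G)) : Prop :=
  T ⊆ 𝒟 ∧ ∀ D ∈ 𝒟, ∃! D', D' ∈ T ∧ AreConjugate D D'

/-- `A N = A_N` and `T N = 𝒯_N` are admissible choices for every normal subgroup `N`;
the values at subgroups that are not normal play no role. -/
def IsAdmissibleChoice (A : Subgroup G → Subgroup G) (T : Subgroup G → Set (Subgroup G)) : Prop :=
  ∀ (N : Subgroup G) [N.Normal],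
    N ≤ A N ∧ IsMaxAbelianNormal ((A N).map (QuotientGroup.mk' N)) ∧
      IsConjTransversal (T N) (kernelSet N (A N))

/-- The set `𝒮(G)` of pairs `(A_N, D)`, `N` normal in `G` and `D ∈ 𝒯_N`. -/
def pairSet (A : Subgroup G → Subgroup G) (T : Subgroup G → Set (Subgroup G)) :
    Set (Subgroup G × Subgroup G) :=
  {P | ∃ N : Subgroup G, N.Normal ∧ P.1 = A N ∧ P.2 ∈ T N}

end Pairs

/-! ### Cyclotomic cosets and idempotents -/

section Cosets

variable (F : Type u) [Field F] {G : Type v} [Group G]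

/-- Linear characters of `K` over the algebraic closure of `F`. -/
abbrev LinChar (K : Subgroup G) : Type (max u v) := K →* (AlgebraicClosure F)ˣ

/-- `Irr(K/H)` for `K/H` abelian, as the group of linear characters of `K` trivial on `H`. -/
def irrQuotient (K H : Subgroup G) : Subgroup (LinChar F K) where
  carrier := {χ | ∀ k : K, (k : G) ∈ H → χ k = 1}
  one_mem' := fun _ _ => rfl
  mul_mem' := fun {a b} ha hb k hk => by simp [ha k hk, hb k hk]
  inv_mem' := fun {a} ha k hk => by simp [ha k hk]

/-- The multiplicative order `o_n(q)` of `q = |F|` modulo `n = [K : H]`. -/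
def ordMod (K H : Subgroup G) : ℕ := orderOf ((Nat.card F : ℕ) : ZMod (H.relIndex K))

/-- `{χ, χ^q, …, χ^(q^(o-1))}`. -/
def cyclotomicCoset (K H : Subgroup G) (χ : LinChar F K) : Set (LinChar F K) :=
  {χ' | ∃ i < ordMod F K H, χ' = χ ^ (Nat.card F ^ i)}

/-- The set `𝒞(K/H)` of the `q`-cyclotomic cosets of the generators of `Irr(K/H)`. -/
def cosetSet (K H : Subgroup G) : Set (Set (LinChar F K)) :=
  {C | ∃ χ : LinChar F K, Subgroup.zpowers χ = irrQuotient F K H ∧ C = cyclotomicCoset F K H χ}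

variable {F} in
/-- `χ^g (k) = χ (g k g⁻¹)`, for `g` normalizing `K`. -/
def conjChar {K : Subgroup G} (g : Subgroup.normalizer (K : Set G)) (χ : LinChar F K) :
    LinChar F K :=
  χ.comp (K.normalizerMonoidHom g).toMonoidHom

lemma conjChar_apply {K : Subgroup G} (g : Subgroup.normalizer (K : Set G)) (χ : LinChar F K)
    (k : K) : conjChar g χ k =
      χ ⟨(g : G) * k * (g : G)⁻¹, (Subgroup.mem_normalizer_iff.1 g.2 k).1 k.2⟩ := rfl

lemma conjChar_one {K : Subgroup G} (χ : LinChar F K) :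
    conjChar (1 : Subgroup.normalizer (K : Set G)) χ = χ := by
  ext k; simp [conjChar]

lemma conjChar_mul {K : Subgroup G} (g h : Subgroup.normalizer (K : Set G)) (χ : LinChar F K) :
    conjChar (g * h) χ = conjChar h (conjChar g χ) := by
  ext k; simp [conjChar]

/-- The orbit of `C` under conjugation by `N_G(H)`, where `K ⊴ N_G(H)`. -/
def cosetOrbit (K H : Subgroup G) (C : Set (LinChar F K)) : Set (Set (LinChar F K)) :=
  {C' | ∃ g : Subgroup.normalizer (K : Set G),
    (g : G) ∈ Subgroup.normalizer (H : Set G) ∧ C' = conjChar g '' C}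

/-- The set `ℛ(K/H)` of orbits of `N_G(H)` on `𝒞(K/H)`. -/
def orbitSet (K H : Subgroup G) : Set (Set (Set (LinChar F K))) :=
  {O | ∃ C ∈ cosetSet F K H, O = cosetOrbit F K H C}

/-- The stabilizer of `C` under conjugation by `N_G(H)`, where `K ⊴ N_G(H)`. -/
def cosetStabilizer (K H : Subgroup G) (C : Set (LinChar F K)) : Subgroup G where
  carrier := {g | g ∈ Subgroup.normalizer (H : Set G) ∧
    ∃ hg : g ∈ Subgroup.normalizer (K : Set G), conjChar ⟨g, hg⟩ '' C = C}
  one_mem' := ⟨one_mem _, one_mem _, by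
    have : (conjChar (1 : Subgroup.normalizer (K : Set G)) : LinChar F K → _) = id :=
      funext (conjChar_one F)
    exact (congrArg (· '' C) this).trans (Set.image_id C)⟩
  mul_mem' := by
    rintro a b ⟨ha, ha', hac⟩ ⟨hb, hb', hbc⟩
    refine ⟨mul_mem ha hb, mul_mem ha' hb', ?_⟩
    have : (conjChar ((⟨a, ha'⟩ : Subgroup.normalizer (K : Set G)) * ⟨b, hb'⟩) :
        LinChar F K → _) = conjChar ⟨b, hb'⟩ ∘ conjChar ⟨a, ha'⟩ :=
      funext (conjChar_mul F _ _)
    refine (congrArg (· '' C) this).trans ?_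
    change (conjChar ⟨b, hb'⟩ ∘ conjChar ⟨a, ha'⟩) '' C = C
    rw [Set.image_comp, hac, hbc]
  inv_mem' := by
    rintro a ⟨ha, ha', hac⟩
    refine ⟨inv_mem ha, inv_mem ha', ?_⟩
    have : (conjChar ((⟨a, ha'⟩ : Subgroup.normalizer (K : Set G))⁻¹) ∘
        conjChar ⟨a, ha'⟩ : LinChar F K → _) = id := funext fun χ => by
      rw [Function.comp_apply, ← conjChar_mul, mul_inv_cancel, conjChar_one]; rfl
    calc conjChar ((⟨a, ha'⟩ : Subgroup.normalizer (K : Set G))⁻¹) '' C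
        = conjChar ((⟨a, ha'⟩ : Subgroup.normalizer (K : Set G))⁻¹) ''
            (conjChar ⟨a, ha'⟩ '' C) := by rw [hac]
      _ = C := by rw [← Set.image_comp, this, Set.image_id]

/-- `F(ζ_n)` inside the algebraic closure of `F`. -/
def cyclotomicExt (n : ℕ) : IntermediateField F (AlgebraicClosure F) :=
  IntermediateField.adjoin F {z | IsPrimitiveRoot z n}

open Classical in
/-- The trace of `F(ζ_n)/F` at an element `z` of `F(ζ_n)` (and `0` at other `z`). -/
def cyclotomicTrace (n : ℕ) (z : AlgebraicClosure F) : F :=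
  if h : z ∈ cyclotomicExt F n then Algebra.trace F (cyclotomicExt F n) ⟨z, h⟩ else 0

variable {F} in
/-- `ε_C(K,H) = |K|⁻¹ ∑_{k ∈ K} tr(χ(k)) k⁻¹`, written with a character `χ ∈ C`. -/
def epsilon [Finite G] (K H : Subgroup G) (χ : LinChar F K) : MonoidAlgebra F G :=
  ∑ᶠ k : K, MonoidAlgebra.single ((k : G)⁻¹)
    ((Nat.card K : F)⁻¹ * cyclotomicTrace F (H.relIndex K) (χ k : AlgebraicClosure F))

variable {F} in
/-- The sum of the distinct `G`-conjugates of `x`. -/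
def conjugateSum (x : MonoidAlgebra F G) : MonoidAlgebra F G :=
  ∑ᶠ y ∈ Set.range (fun g : G => MonoidAlgebra.of F G g⁻¹ * x * MonoidAlgebra.of F G g), y

/-- The set of all `e_C(G,A,D)`, `(A,D) ∈ S`, with `C` in an orbit that belongs to `ℛ(A/D)`. -/
def idempotentSet [Finite G] (S : Set (Subgroup G × Subgroup G)) : Set (MonoidAlgebra F G) :=
  {e | ∃ P ∈ S, ∃ O ∈ orbitSet F P.1 P.2, ∃ C ∈ O, ∃ χ ∈ C,
    e = conjugateSum (epsilon P.1 P.2 χ)}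

/-- The field with `q ^ m` elements, `q = |F|` and `m ≥ 1`, inside the algebraic closure. -/
def fieldOfDegree (m : ℕ) : IntermediateField F (AlgebraicClosure F) :=
  IntermediateField.adjoin F {x | x ^ (Nat.card F ^ m) = x}

end Cosets

end NormMon

end

set_option linter.unusedSectionVars false

noncomputable section

namespace NormMon

open MonoidAlgebra

/-! ### Idempotents of linear characters -/

section CharIdem

variable {F : Type u} [Field F] {G : Type v} [Group G]

local notation "k" => AlgebraicClosure F

/-! Everything is read off over the algebraic closure k of F. A linear character χ of a subgroup K
gives the idempotent e_χ = |K|⁻¹ ∑ χ(a) a⁻¹ of k[G], and distinct characters of K give orthogonal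
idempotents. The central notion is `IsInertial`: χ is a character of a normal subgroup A with kernel
D, and only elements of A fix it. An element of G fixes a character with kernel D exactly when it
normalizes D and centralizes A/D, so the maximality of A/D in N_G(D)/D is the inertia condition in
disguise (`IsInertial.mem_kernelSet`, `isInertial_of_mem_kernelSet`). For inertial χ one has e_χ
k[G] e_χ = k e_χ, and an irreducible representation with a χ-eigenvector has dimension [G:A] and is
induced from χ.

The trace of F(ζ_n)/F is a sum of powers of Frobenius. Hence over k the element e_C(G,A,D) is the
sum of e_ψ over the orbit of χ under G and Frobenius (`toClosure_conjugateSum_epsilon`). A central z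
in F[G] acts on e_χ by a scalar c, and on the member of the orbit reached by g and the i-th power of
Frobenius by c^(q^i). So a central idempotent is 0 or 1 on the whole orbit, and e_C is primitive
whether or not G is normally monomial.

What depends on G is completeness. If E is complete, some e_C acts nontrivially on a given
irreducible V. This yields an eigenvector for an inertial character, so V is induced from a normal
subgroup. Conversely, let V be induced from a normal K and let N be the kernel of V. Then N ≤ K and
K/N is abelian, so [G:A_N] ≤ [G:K] = dim V. As A_N acts through commuting operators it has an
eigenvector, which gives dim V ≤ [G:A_N]. Equality and Schur's lemma make the eigencharacter
inertial. Its kernel has core N, and up to conjugacy it lies in 𝒯_N. The resulting e_C is the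
primitive central idempotent that is nonzero on V.

For the isomorphism, the component of e_C is M_d(E) with E a finite field. Let m = o/[E_G(A/D):A],
the least positive exponent for which χ^(q^m) is conjugate to χ. Three bounds, d ≤ [G:A], [E:F] ≤ m
and m[G:A]² ≤ d²[E:F], must all be equalities (`IsInertial.structure_of_isComponentMap`). No
component is counted twice: N is the set of g with g e_C = e_C, and e_C also determines the orbit of
χ, hence D and the orbit of C (`eq_of_conjugateSum_eq`). -/

/-- The conjugate `a ↦ χ (g a g⁻¹)` of a linear character of a normal subgroup. -/
def conjHom {K : Subgroup G} [K.Normal] (g : G) (χ : LinChar F K) : LinChar F K :=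
  χ.comp (MulAut.conjNormal g).toMonoidHom

variable {K : Subgroup G}

lemma conjHom_apply [K.Normal] (g : G) (χ : LinChar F K) (a : K) :
    conjHom g χ a = χ (MulAut.conjNormal g a) := rfl

@[simp] lemma conjHom_one [K.Normal] (χ : LinChar F K) : conjHom 1 χ = χ := by
  ext a; simp [conjHom]

lemma conjHom_mul [K.Normal] (g h : G) (χ : LinChar F K) :
    conjHom (g * h) χ = conjHom h (conjHom g χ) := by
  ext a; simp [conjHom]

lemma conjHom_pow [K.Normal] (g : G) (χ : LinChar F K) (n : ℕ) :
    conjHom g (χ ^ n) = conjHom g χ ^ n := rfl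

lemma conjHom_injective [K.Normal] (g : G) :
    Function.Injective (conjHom g : (LinChar F K) → (LinChar F K)) := fun χ ψ h => by
  have := congrArg (conjHom g⁻¹) h
  rwa [← conjHom_mul, ← conjHom_mul, mul_inv_cancel, conjHom_one, conjHom_one] at this

lemma conjHom_of_mem [K.Normal] (a : K) (χ : LinChar F K) : conjHom (a : G) χ = χ := by
  ext b
  have : MulAut.conjNormal (a : G) b = a * b * a⁻¹ := by ext; simp
  rw [conjHom_apply, this]
  simp

variable [Finite G]

/-- The idempotent `|K|⁻¹ ∑ χ(a) a⁻¹` of a linear character `χ` of `K`. -/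
def charIdem (χ : LinChar F K) : MonoidAlgebra k G :=
  ∑ᶠ a : K, single ((a : G)⁻¹) ((Nat.card K : k)⁻¹ * (χ a : k))

lemma single_mul_charIdem (χ : LinChar F K) (a : K) :
    single (a : G) (1 : k) * charIdem χ = (χ a : k) • charIdem χ := by
  cases nonempty_fintype K
  simp only [charIdem, finsum_eq_sum_of_fintype, Finset.mul_sum, Finset.smul_sum]
  refine Fintype.sum_equiv (Equiv.mulRight a⁻¹) _ _ fun b => ?_
  simp [mul_left_comm]
  exact Or.inl (by rw [mul_left_comm, mul_inv_cancel₀ (χ a).ne_zero, mul_one])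

lemma charIdem_mul_single (χ : LinChar F K) (a : K) :
    charIdem χ * single (a : G) (1 : k) = (χ a : k) • charIdem χ := by
  cases nonempty_fintype K
  simp only [charIdem, finsum_eq_sum_of_fintype, Finset.sum_mul, Finset.smul_sum]
  refine Fintype.sum_equiv (Equiv.mulLeft a⁻¹) _ _ fun b => ?_
  simp [mul_left_comm]

/-- An element on which the characters differ, inserted between the two factors, acts by two
different scalars. -/
lemma charIdem_mul_charIdem_of_ne {χ ψ : LinChar F K} (h : χ ≠ ψ) :
    charIdem χ * charIdem ψ = 0 := by
  obtain ⟨a, ha⟩ : ∃ a, χ a ≠ ψ a := by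
    by_contra! h'; exact h (MonoidHom.ext h')
  have h1 : (χ a : k) • (charIdem χ * charIdem ψ) = (ψ a : k) • (charIdem χ * charIdem ψ) := by
    rw [← smul_mul_assoc, ← charIdem_mul_single, mul_assoc, single_mul_charIdem, mul_smul_comm]
  have h2 : ((χ a : k) - ψ a) • (charIdem χ * charIdem ψ) = 0 := by
    rw [sub_smul, h1, sub_self]
  exact (smul_eq_zero.1 h2).resolve_left fun h3 => ha (Units.ext (sub_eq_zero.1 h3))

lemma charIdem_mul_self (hK : (Nat.card K : k) ≠ 0) (χ : LinChar F K) :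
    charIdem χ * charIdem χ = charIdem χ := by
  cases nonempty_fintype K
  conv_lhs => enter [1]; rw [charIdem, finsum_eq_sum_of_fintype]
  rw [Finset.sum_mul]
  have : ∀ a : K, single ((a : G)⁻¹) ((Nat.card K : k)⁻¹ * (χ a : k)) * charIdem χ =
      (Nat.card K : k)⁻¹ • charIdem χ := fun a => by
    have h1 : single ((a : G)⁻¹) ((Nat.card K : k)⁻¹ * (χ a : k)) =
        ((Nat.card K : k)⁻¹ * (χ a : k)) • single ((a⁻¹ : K) : G) (1 : k) := by simp
    rw [h1, smul_mul_assoc, single_mul_charIdem, smul_smul]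
    simp
  simp only [this, Finset.sum_const, Finset.card_univ, ← Nat.card_eq_fintype_card]
  rw [← Nat.cast_smul_eq_nsmul k, smul_smul, mul_inv_cancel₀ hK, one_smul]

lemma coeff_charIdem_of_mem (χ : LinChar F K) (a : K) :
    (charIdem χ).coeff (a : G) = (Nat.card K : k)⁻¹ * ((χ a)⁻¹ : kˣ) := by
  cases nonempty_fintype K
  classical
  simp only [charIdem, finsum_eq_sum_of_fintype, coeff_sum, Finsupp.finsetSum_apply, coeff_single]
  rw [Finset.sum_eq_single a⁻¹]
  · simp
  · intro b _ hb
    rw [Finsupp.single_apply, if_neg]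
    intro h
    exact hb (by ext; simp [← h])
  · simp

lemma coeff_charIdem_of_notMem (χ : LinChar F K) {g : G} (hg : g ∉ K) :
    (charIdem χ).coeff g = 0 := by
  cases nonempty_fintype K
  classical
  simp only [charIdem, finsum_eq_sum_of_fintype, coeff_sum, Finsupp.finsetSum_apply, coeff_single]
  refine Finset.sum_eq_zero fun b _ => ?_
  rw [Finsupp.single_apply, if_neg]
  rintro rfl
  exact hg (inv_mem b.2)

lemma charIdem_ne_zero (hK : (Nat.card K : k) ≠ 0) (χ : LinChar F K) : charIdem χ ≠ 0 := fun h => by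
  have := coeff_charIdem_of_mem χ 1
  rw [h] at this
  simp at this
  exact hK this.symm

/-- The support of e_χ is K, so comparing coefficients at g puts g in K; then g acts by the scalar
χ(g). This recovers kernels and cores from idempotents. -/
lemma mem_of_single_mul_charIdem_eq (hK : (Nat.card K : k) ≠ 0) {χ : LinChar F K} {g : G}
    (h : single g (1 : k) * charIdem χ = charIdem χ) : ∃ hg : g ∈ K, χ ⟨g, hg⟩ = 1 := by
  by_cases hg : g ∈ K
  · refine ⟨hg, ?_⟩
    have h1 := single_mul_charIdem χ ⟨g, hg⟩
    rw [h] at h1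
    have h2 : ((χ ⟨g, hg⟩ : k) - 1) • charIdem χ = 0 := by rw [sub_smul, ← h1, one_smul, sub_self]
    exact Units.ext (sub_eq_zero.1 ((smul_eq_zero.1 h2).resolve_right (charIdem_ne_zero hK χ)))
  · have h1 := coeff_charIdem_of_notMem χ hg
    rw [← h, coeff_single_mul_apply, inv_mul_cancel, one_mul] at h1
    have h2 := coeff_charIdem_of_mem χ 1
    rw [OneMemClass.coe_one, h1] at h2
    simp at h2
    exact absurd h2.symm hK

lemma charIdem_conj [K.Normal] (g : G) (χ : LinChar F K) :
    single g⁻¹ (1 : k) * charIdem χ * single g 1 = charIdem (conjHom g χ) := by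
  cases nonempty_fintype K
  simp only [charIdem, finsum_eq_sum_of_fintype, Finset.sum_mul, Finset.mul_sum]
  refine Fintype.sum_equiv (MulAut.conjNormal g⁻¹).toEquiv _ _ fun b => ?_
  simp [conjHom_apply, mul_assoc]

/-- Moving g to the left of e_χ conjugates the character, and orthogonality applies. This vanishing
drives the independence arguments for inertial characters. -/
lemma charIdem_mul_single_mul_charIdem [K.Normal] {χ ψ : LinChar F K} {g : G}
    (h : conjHom g χ ≠ ψ) : charIdem χ * single g (1 : k) * charIdem ψ = 0 := by
  have h1 : charIdem χ * single g (1 : k) = single g 1 * charIdem (conjHom g χ) := by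
    rw [← charIdem_conj, ← mul_assoc, ← mul_assoc, single_mul_single]
    simp [one_def.symm]
  rw [h1, mul_assoc, charIdem_mul_charIdem_of_ne h, mul_zero]

/-- If the inertia group of `χ` is `K` then `e_χ k[G] e_χ = k e_χ`. -/
lemma exists_charIdem_mul_mul_charIdem [K.Normal] (hK : (Nat.card K : k) ≠ 0) {χ : LinChar F K}
    (hχ : ∀ g, conjHom g χ = χ → g ∈ K) (x : MonoidAlgebra k G) :
    ∃ c : k, charIdem χ * x * charIdem χ = c • charIdem χ := by
  induction x using MonoidAlgebra.induction_linear with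
  | zero => exact ⟨0, by simp⟩
  | add x y hx hy =>
    obtain ⟨c, hc⟩ := hx
    obtain ⟨d, hd⟩ := hy
    exact ⟨c + d, by rw [mul_add, add_mul, hc, hd, add_smul]⟩
  | single g r =>
    have h1 : single g r = r • single g (1 : k) := by simp
    by_cases hg : g ∈ K
    · refine ⟨r * χ ⟨g, hg⟩, ?_⟩
      rw [h1, mul_smul_comm, smul_mul_assoc, charIdem_mul_single χ ⟨g, hg⟩, smul_mul_assoc,
        charIdem_mul_self hK, smul_smul]
    · refine ⟨0, ?_⟩
      rw [h1, mul_smul_comm, smul_mul_assoc,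
        charIdem_mul_single_mul_charIdem fun h => hg (hχ g h), smul_zero, zero_smul]

end CharIdem

/-! ### Frobenius and cyclotomic extensions of a finite field -/

section Frobenius

variable (F : Type u) [Field F] [Finite F]

/-- The `F`-algebra endomorphism `x ↦ x ^ q`, `q = |F|`. -/
def frob (R : Type*) [CommRing R] [Algebra F R] : R →ₐ[F] R :=
  let := Fintype.ofFinite F
  FiniteField.frobeniusAlgHom F R

lemma frob_apply (R : Type*) [CommRing R] [Algebra F R] (x : R) :
    frob F R x = x ^ Nat.card F := by
  let := Fintype.ofFinite F
  rw [frob, FiniteField.coe_frobeniusAlgHom, Nat.card_eq_fintype_card]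

lemma frob_pow_apply (R : Type*) [CommRing R] [Algebra F R] (i : ℕ) (x : R) :
    (frob F R ^ i) x = x ^ (Nat.card F ^ i) := by
  induction i with
  | zero => simp
  | succ i ih => rw [pow_succ', AlgHom.mul_apply, ih, frob_apply, ← pow_mul, pow_succ]

lemma eq_one_of_pow_card_pow_eq_one {L : Type*} [Field L] [Algebra F L] {i : ℕ} {x : L}
    (h : x ^ (Nat.card F ^ i) = 1) : x = 1 := by
  rw [← frob_pow_apply F L] at h
  exact (frob F L ^ i).toRingHom.injective (h.trans (map_one _).symm)

lemma natCast_ne_zero_of_coprime {n : ℕ} (h : (Nat.card F).Coprime n) : (n : F) ≠ 0 := by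
  have h1 := Nat.isCoprime_iff_coprime.2 h
  obtain ⟨a, b, hab⟩ := h1
  intro h0
  have h2 := congrArg (Int.cast : ℤ → F) hab
  have h3 : (Nat.card F : F) = 0 := by
    let := Fintype.ofFinite F
    rw [Nat.card_eq_fintype_card, FiniteField.cast_card_eq_zero]
  push_cast at h2
  rw [h0, h3] at h2
  simp at h2

lemma natCast_closure_ne_zero_of_coprime {n : ℕ} (h : (Nat.card F).Coprime n) :
    (n : AlgebraicClosure F) ≠ 0 := by
  intro h0
  refine natCast_ne_zero_of_coprime F h ((algebraMap F (AlgebraicClosure F)).injective ?_)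
  rw [map_natCast, h0, map_zero]

variable {F} in
lemma exists_isPrimitiveRoot {n : ℕ} (hn : (Nat.card F).Coprime n) :
    ∃ ζ : AlgebraicClosure F, IsPrimitiveRoot ζ n := by
  have : NeZero (n : F) := ⟨natCast_ne_zero_of_coprime F hn⟩
  exact HasEnoughRootsOfUnity.exists_primitiveRoot (AlgebraicClosure F) n

variable {F} in
lemma mem_cyclotomicExt {n : ℕ} (hn : (Nat.card F).Coprime n)
    {z : AlgebraicClosure F} (hz : z ^ n = 1) : z ∈ cyclotomicExt F n := by
  obtain ⟨ζ, hζ⟩ := exists_isPrimitiveRoot hn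
  have : NeZero n := ⟨by rintro rfl; exact natCast_ne_zero_of_coprime F hn (by simp)⟩
  obtain ⟨i, -, hi⟩ := hζ.eq_pow_of_pow_eq_one hz
  rw [← hi]
  exact pow_mem (show ζ ∈ cyclotomicExt F n from IntermediateField.subset_adjoin F _ hζ) i

lemma finiteDimensional_cyclotomicExt {n : ℕ} (hn : (Nat.card F).Coprime n) :
    FiniteDimensional F (cyclotomicExt F n) := by
  have hn0 : 0 < n := Nat.pos_of_ne_zero fun h => natCast_ne_zero_of_coprime F hn (by simp [h])
  have : Finite {z : AlgebraicClosure F | IsPrimitiveRoot z n} := by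
    refine Set.Finite.subset (primitiveRoots n (AlgebraicClosure F)).finite_toSet fun z hz => ?_
    simpa [mem_primitiveRoots hn0] using hz
  exact IntermediateField.finiteDimensional_adjoin fun x _ =>
    (AlgebraicClosure.isAlgebraic F).isAlgebraic x |>.isIntegral

variable {F} in
lemma natCast_pow_eq_one_iff_dvd {n i : ℕ} :
    (Nat.card F : ZMod n) ^ i = 1 ↔ n ∣ Nat.card F ^ i - 1 := by
  have h1 : 1 ≤ Nat.card F ^ i := Nat.one_le_pow _ _ Nat.card_pos
  rw [← ZMod.natCast_eq_zero_iff, Nat.cast_sub h1, sub_eq_zero]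
  push_cast
  rfl

/-- The degree is the order of Frobenius on F(ζ_n), and a power of Frobenius is trivial there as
soon as it fixes ζ_n, that is, when n divides q^i - 1. -/
lemma finrank_cyclotomicExt {n : ℕ} (hn : (Nat.card F).Coprime n) :
    Module.finrank F (cyclotomicExt F n) = orderOf (Nat.card F : ZMod n) := by
  have := finiteDimensional_cyclotomicExt F hn
  have : Finite (cyclotomicExt F n) := Module.finite_of_finite F
  let := Fintype.ofFinite F
  obtain ⟨ζ, hζ⟩ := exists_isPrimitiveRoot hn
  have key : ∀ i, frob F (cyclotomicExt F n) ^ i = 1 ↔ (Nat.card F : ZMod n) ^ i = 1 := fun i => by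
    have h1 : 1 ≤ Nat.card F ^ i := Nat.one_le_pow _ _ Nat.card_pos
    have hfix : ∀ z : AlgebraicClosure F, IsPrimitiveRoot z n →
        (z ^ (Nat.card F ^ i) = z ↔ n ∣ Nat.card F ^ i - 1) := fun z hz => by
      have hz0 : z ≠ 0 := by
        rintro rfl
        have hn0 : n ≠ 0 := fun h => natCast_ne_zero_of_coprime F hn (by simp [h])
        have := hz.pow_eq_one
        rw [zero_pow hn0] at this
        exact zero_ne_one this
      rw [← hz.pow_eq_one_iff_dvd]
      conv_lhs => rw [← Nat.sub_add_cancel h1, pow_succ]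
      exact mul_eq_right₀ hz0
    rw [natCast_pow_eq_one_iff_dvd]
    constructor
    · intro h
      rw [← hfix ζ hζ]
      have h2 := DFunLike.congr_fun h ⟨ζ, IntermediateField.subset_adjoin F _ hζ⟩
      rw [frob_pow_apply] at h2
      exact congrArg Subtype.val h2
    · intro h
      have h2 : ∀ x ∈ cyclotomicExt F n, x ^ (Nat.card F ^ i) = x := by
        intro x hx
        rw [← frob_pow_apply F]
        refine IntermediateField.adjoin_induction F
          (p := fun x _ => (frob F (AlgebraicClosure F) ^ i) x = x) ?_ ?_ ?_ ?_ ?_ hx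
        · intro x hx
          rw [frob_pow_apply]
          exact (hfix x hx).2 h
        · intro x
          exact AlgHom.commutes _ x
        · intro x y _ _ hx hy
          rw [map_add, hx, hy]
        · intro x _ hx
          rw [map_inv₀, hx]
        · intro x y _ _ hx hy
          rw [map_mul, hx, hy]
      ext x
      rw [frob_pow_apply]
      exact h2 x x.2
  have h3 : orderOf (frob F (cyclotomicExt F n)) = Module.finrank F (cyclotomicExt F n) :=
    FiniteField.orderOf_frobeniusAlgHom F (cyclotomicExt F n)
  rw [← h3]
  exact Nat.dvd_antisymm (orderOf_dvd_of_pow_eq_one ((key _).2 (pow_orderOf_eq_one _)))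
    (orderOf_dvd_of_pow_eq_one ((key _).1 (pow_orderOf_eq_one _)))

/-- The trace of `F(ζ_n)/F` at an `n`-th root of unity. -/
lemma algebraMap_cyclotomicTrace {n : ℕ} (hn : (Nat.card F).Coprime n)
    {z : AlgebraicClosure F} (hz : z ^ n = 1) :
    algebraMap F (AlgebraicClosure F) (cyclotomicTrace F n z) =
      ∑ i ∈ Finset.range (orderOf (Nat.card F : ZMod n)), z ^ (Nat.card F ^ i) := by
  have := finiteDimensional_cyclotomicExt F hn
  have : Finite (cyclotomicExt F n) := Module.finite_of_finite F
  rw [cyclotomicTrace, dif_pos (mem_cyclotomicExt hn hz),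
    IsScalarTower.algebraMap_apply F (cyclotomicExt F n) (AlgebraicClosure F),
    FiniteField.algebraMap_trace_eq_sum_pow, finrank_cyclotomicExt F hn, map_sum]
  rfl

end Frobenius

/-! ### Faithful characters of `A/D` -/

section Characters

variable {F : Type u} [Field F] [Finite F] {G : Type v} [Group G] [Finite G]

lemma coprime_card_subgroup (hq : (Nat.card F).Coprime (Nat.card G)) (K : Subgroup G) :
    (Nat.card F).Coprime (Nat.card K) :=
  hq.coprime_dvd_right K.card_subgroup_dvd_card

lemma coprime_relIndex (hq : (Nat.card F).Coprime (Nat.card G)) (D A : Subgroup G) :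
    (Nat.card F).Coprime (D.relIndex A) :=
  (coprime_card_subgroup hq A).coprime_dvd_right (Subgroup.index_dvd_card _)

lemma card_subgroup_ne_zero (hq : (Nat.card F).Coprime (Nat.card G)) (K : Subgroup G) :
    (Nat.card K : AlgebraicClosure F) ≠ 0 :=
  natCast_closure_ne_zero_of_coprime F (coprime_card_subgroup hq K)

/-- The characters of the finite abelian group A/D separate its points, since k has enough roots of
unity of order prime to q. If they are all powers of χ, then χ alone separates points. -/
lemma ker_of_zpowers_eq (hq : (Nat.card F).Coprime (Nat.card G)) {A D : Subgroup G}
    (hab : ∀ a ∈ A, ∀ b ∈ A, a * b * a⁻¹ * b⁻¹ ∈ D) {χ : LinChar F A}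
    (hχ : Subgroup.zpowers χ = irrQuotient F A D) (a : A) : χ a = 1 ↔ (a : G) ∈ D := by
  have hmem : χ ∈ irrQuotient F A D := hχ ▸ Subgroup.mem_zpowers χ
  refine ⟨fun h => ?_, fun h => hmem a h⟩
  by_contra hd
  have hcomm : ∀ a b : A, a * b * a⁻¹ * b⁻¹ ∈ D.subgroupOf A := fun a b =>
    Subgroup.mem_subgroupOf.2 (hab a a.2 b b.2)
  have : (D.subgroupOf A).Normal := ⟨fun d hd g => by
    have := mul_mem (hcomm g d) hd
    simpa [mul_assoc] using this⟩
  let : CommGroup (A ⧸ D.subgroupOf A) :=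
    { (inferInstance : Group (A ⧸ D.subgroupOf A)) with
      mul_comm := fun x y => by
        obtain ⟨x, rfl⟩ := QuotientGroup.mk_surjective x
        obtain ⟨y, rfl⟩ := QuotientGroup.mk_surjective y
        rw [← QuotientGroup.mk_mul, ← QuotientGroup.mk_mul]
        refine (QuotientGroup.eq).2 ?_
        have := hcomm y⁻¹ x⁻¹
        simpa [mul_assoc] using this }
  have : NeZero (Monoid.exponent (A ⧸ D.subgroupOf A) : F) := ⟨by
    refine natCast_ne_zero_of_coprime F (Nat.Coprime.coprime_dvd_right ?_ (coprime_relIndex hq D A))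
    exact Group.exponent_dvd_nat_card⟩
  obtain ⟨φ, hφ⟩ := CommGroup.exists_apply_ne_one_of_hasEnoughRootsOfUnity
    (A ⧸ D.subgroupOf A) (AlgebraicClosure F) (a := (a : A ⧸ D.subgroupOf A))
    (fun h => hd ((QuotientGroup.eq_one_iff a).1 h))
  have hψ : φ.comp (QuotientGroup.mk' (D.subgroupOf A)) ∈ irrQuotient F A D := fun k hk => by
    have : (k : A ⧸ D.subgroupOf A) = 1 := (QuotientGroup.eq_one_iff k).2 hk
    simp [this]
  rw [← hχ] at hψ
  obtain ⟨i, hi⟩ := hψ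
  apply hφ
  have := DFunLike.congr_fun hi a
  simpa [h] using this.symm

/-- A character with kernel `D` has a value that generates the group of its values. -/
lemma exists_orderOf_eq_relIndex {A D : Subgroup G} {χ : LinChar F A}
    (hker : ∀ a : A, χ a = 1 ↔ (a : G) ∈ D) :
    ∃ a₀ : A, orderOf (χ a₀) = D.relIndex A ∧ ∀ a, ∃ j : ℕ, χ a = χ a₀ ^ j := by
  have : Finite χ.range := Set.finite_range χ
  have : IsCyclic χ.range := isCyclic_subgroup_units _
  obtain ⟨⟨_, a₀, rfl⟩, h⟩ := IsCyclic.exists_generator (α := χ.range)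
  refine ⟨a₀, ?_, fun a => ?_⟩
  · have h1 : D.subgroupOf A = χ.ker := by
      ext a; rw [Subgroup.mem_subgroupOf, MonoidHom.mem_ker, hker]
    rw [Subgroup.relIndex, h1, Subgroup.index_ker, ← orderOf_eq_card_of_forall_mem_zpowers h,
      ← Subgroup.orderOf_coe]
  · obtain ⟨j, hj⟩ := mem_powers_iff_mem_zpowers.2 (h ⟨χ a, a, rfl⟩)
    exact ⟨j, (congrArg Subtype.val hj).symm⟩

/-- The values of χ form the cyclic group generated by one value χ(a₀), of order [A:D]. Any ψ
trivial on D has ψ(a₀) among these roots of unity, and a₀ generates A modulo D. -/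
lemma zpowers_eq_of_ker {A D : Subgroup G} {χ : LinChar F A}
    (hker : ∀ a : A, χ a = 1 ↔ (a : G) ∈ D) : Subgroup.zpowers χ = irrQuotient F A D := by
  obtain ⟨a₀, ha₀, hgen⟩ := exists_orderOf_eq_relIndex hker
  refine le_antisymm (Subgroup.zpowers_le.2 fun a ha => (hker a).2 ha) fun ψ hψ => ?_
  have hprim : IsPrimitiveRoot ((χ a₀ : (AlgebraicClosure F)ˣ) : AlgebraicClosure F)
      (orderOf (χ a₀)) := by
    rw [← orderOf_units]; exact IsPrimitiveRoot.orderOf _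
  have : NeZero (orderOf (χ a₀)) := ⟨by rw [ha₀]; exact Subgroup.index_ne_zero_of_finite⟩
  have h1 : ψ a₀ ^ orderOf (χ a₀) = 1 := by
    rw [← map_pow]
    refine hψ _ ((hker _).1 ?_)
    rw [map_pow, pow_orderOf_eq_one]
  obtain ⟨i, -, hi⟩ := hprim.eq_pow_of_pow_eq_one (ξ := ((ψ a₀ : (AlgebraicClosure F)ˣ) :
    AlgebraicClosure F)) (by simpa using congrArg Units.val h1)
  have hi' : χ a₀ ^ i = ψ a₀ := Units.ext (by simpa using hi)
  refine ⟨i, MonoidHom.ext fun a => ?_⟩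
  obtain ⟨j, hj⟩ := hgen a
  have h2 : ψ (a * (a₀ ^ j)⁻¹) = 1 := hψ _ ((hker _).1 (by simp [hj]))
  have h3 : ψ a = ψ a₀ ^ j := by
    rw [map_mul, map_inv, map_pow] at h2
    exact mul_inv_eq_one.1 h2
  simp only [zpow_natCast, MonoidHom.pow_apply]
  rw [hj, h3, ← hi', ← pow_mul, ← pow_mul, mul_comm]

lemma pow_eq_pow_iff_of_ker {A D : Subgroup G} {χ : LinChar F A}
    (hker : ∀ a : A, χ a = 1 ↔ (a : G) ∈ D) (i j : ℕ) :
    χ ^ i = χ ^ j ↔ (i : ZMod (D.relIndex A)) = j := by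
  obtain ⟨a₀, ha₀, hgen⟩ := exists_orderOf_eq_relIndex hker
  rw [ZMod.natCast_eq_natCast_iff, ← ha₀, ← pow_eq_pow_iff_modEq]
  refine ⟨fun h => by simpa using DFunLike.congr_fun h a₀, fun h => MonoidHom.ext fun a => ?_⟩
  obtain ⟨l, hl⟩ := hgen a
  simp only [MonoidHom.pow_apply]
  rw [hl, ← pow_mul, ← pow_mul, mul_comm, pow_mul, h, ← pow_mul, mul_comm]

lemma pow_relIndex_of_ker {A D : Subgroup G} {χ : LinChar F A}
    (hker : ∀ a : A, χ a = 1 ↔ (a : G) ∈ D) : χ ^ D.relIndex A = 1 := by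
  rw [← pow_zero χ, pow_eq_pow_iff_of_ker hker]
  simp

lemma pow_card_pow_eq_iff {A D : Subgroup G} {χ : LinChar F A}
    (hker : ∀ a : A, χ a = 1 ↔ (a : G) ∈ D) (i j : ℕ) :
    χ ^ (Nat.card F ^ i) = χ ^ (Nat.card F ^ j) ↔
      (Nat.card F : ZMod (D.relIndex A)) ^ i = (Nat.card F : ZMod (D.relIndex A)) ^ j := by
  rw [pow_eq_pow_iff_of_ker hker]; push_cast; rfl

lemma ordMod_pos (hq : (Nat.card F).Coprime (Nat.card G)) (A D : Subgroup G) :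
    0 < ordMod F A D := by
  have : NeZero (D.relIndex A) := ⟨Subgroup.index_ne_zero_of_finite⟩
  rw [ordMod, ← ZMod.coe_unitOfCoprime _ (coprime_relIndex hq D A), orderOf_units]
  exact orderOf_pos _

lemma mem_cyclotomicCoset_iff (hq : (Nat.card F).Coprime (Nat.card G)) {A D : Subgroup G}
    {χ ψ : LinChar F A} (hker : ∀ a : A, χ a = 1 ↔ (a : G) ∈ D) :
    ψ ∈ cyclotomicCoset F A D χ ↔ ∃ i : ℕ, ψ = χ ^ (Nat.card F ^ i) := by
  refine ⟨fun ⟨i, _, h⟩ => ⟨i, h⟩, fun ⟨i, h⟩ =>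
    ⟨i % ordMod F A D, Nat.mod_lt _ (ordMod_pos hq A D), h.trans ?_⟩⟩
  rw [pow_card_pow_eq_iff hker, ordMod, pow_mod_orderOf]

lemma ker_pow_card_pow {A D : Subgroup G} {χ : LinChar F A}
    (hker : ∀ a : A, χ a = 1 ↔ (a : G) ∈ D) (i : ℕ) (a : A) :
    (χ ^ (Nat.card F ^ i)) a = 1 ↔ (a : G) ∈ D := by
  rw [← hker, MonoidHom.pow_apply]
  refine ⟨fun h => Units.ext ?_, fun h => by rw [h, one_pow]⟩
  refine eq_one_of_pow_card_pow_eq_one F (i := i) ?_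
  simpa using congrArg Units.val h

lemma conjChar_eq_conjHom {A : Subgroup G} [A.Normal] {g : G}
    (hg : g ∈ Subgroup.normalizer (A : Set G)) (χ : LinChar F A) :
    conjChar ⟨g, hg⟩ χ = conjHom g χ := rfl

lemma mem_normalizer_of_normal {A : Subgroup G} [A.Normal] (g : G) :
    g ∈ Subgroup.normalizer (A : Set G) := by
  rw [Subgroup.normalizer_eq_top]; exact Subgroup.mem_top g

end Characters

/-! ### Characters whose inertia group is as small as possible -/

section Inertial

variable {F : Type u} [Field F] [Finite F] {G : Type v} [Group G] [Finite G]

/-- `χ` is a linear character of the normal subgroup `A` with kernel `D` and inertia group `A`. -/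
structure IsInertial (A D : Subgroup G) [A.Normal] (χ : LinChar F A) : Prop where
  le : D ≤ A
  ker : ∀ a : A, χ a = 1 ↔ (a : G) ∈ D
  inertia : ∀ g, conjHom g χ = χ → g ∈ A

variable {A D : Subgroup G} [A.Normal] {χ : LinChar F A}

lemma pow_card_pow_zero (χ : LinChar F A) : χ ^ (Nat.card F ^ 0) = χ := by
  ext a; simp

lemma pow_card_pow_pow (χ : LinChar F A) (i j : ℕ) :
    (χ ^ (Nat.card F ^ i)) ^ (Nat.card F ^ j) = χ ^ (Nat.card F ^ (i + j)) := by
  ext a; simp [← pow_mul, pow_add]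

lemma pow_card_pow_injective (i : ℕ) :
    Function.Injective fun χ : LinChar F A => χ ^ (Nat.card F ^ i) := fun χ ψ h => by
  refine MonoidHom.ext fun a => Units.ext ?_
  have h1 := congrArg Units.val (DFunLike.congr_fun h a)
  simp only [MonoidHom.pow_apply, Units.val_pow_eq_pow_val] at h1
  rw [← frob_pow_apply F, ← frob_pow_apply F] at h1
  exact (frob F (AlgebraicClosure F) ^ i).toRingHom.injective h1

/-- Frobenius is injective, so χ^(q^i) still has kernel D, whereas the conjugate of χ has kernel
g⁻¹Dg. -/
lemma mem_normalizer_of_conjHom_eq (hD : D ≤ A) (hker : ∀ a : A, χ a = 1 ↔ (a : G) ∈ D)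
    {g : G} {i : ℕ} (h : conjHom g χ = χ ^ (Nat.card F ^ i)) :
    g ∈ Subgroup.normalizer (D : Set G) := by
  have hA : A.Normal := inferInstance
  refine Subgroup.mem_normalizer_iff.2 fun x => ?_
  by_cases hx : x ∈ A
  · have h1 := ker_pow_card_pow hker i ⟨x, hx⟩
    rw [← h, conjHom_apply, hker] at h1
    simpa using h1.symm
  · refine ⟨fun h => absurd (hD h) hx, fun h => absurd ?_ hx⟩
    have := hA.conj_mem _ (hD h) g⁻¹
    simpa [mul_assoc] using this

namespace IsInertial

lemma normal_le_normalizer (h : IsInertial A D χ) : A ≤ Subgroup.normalizer (D : Set G) :=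
  fun a ha => mem_normalizer_of_conjHom_eq h.le h.ker (i := 0)
    ((conjHom_of_mem ⟨a, ha⟩ χ).trans (pow_card_pow_zero χ).symm)

lemma pow (h : IsInertial A D χ) (i : ℕ) : IsInertial A D (χ ^ (Nat.card F ^ i)) where
  le := h.le
  ker := ker_pow_card_pow h.ker i
  inertia g hg := h.inertia g (pow_card_pow_injective i hg)

lemma conj (h : IsInertial A D χ) (g : G) :
    IsInertial A (D.map (MulAut.conj g⁻¹).toMonoidHom) (conjHom g χ) where
  le := by
    rintro _ ⟨x, hx, rfl⟩
    exact (inferInstance : A.Normal).conj_mem _ (h.le hx) g⁻¹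
  ker a := by
    rw [conjHom_apply, h.ker, Subgroup.mem_map]
    constructor
    · exact fun hx => ⟨_, hx, by simp [mul_assoc]⟩
    · rintro ⟨x, hx, hxa⟩
      have : x = (MulAut.conjNormal g a : A) := by simp [← hxa, mul_assoc]
      rwa [← this]
  inertia x hx := by
    have h1 : conjHom (g * x * g⁻¹) χ = χ := by
      rw [conjHom_mul, conjHom_mul, hx, ← conjHom_mul, mul_inv_cancel, conjHom_one]
    have := (inferInstance : A.Normal).conj_mem _ (h.inertia _ h1) g⁻¹
    simpa [mul_assoc] using this

lemma mk_mem_image_iff (h : IsInertial A D χ) (g : Subgroup.normalizer (D : Set G)) :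
    (QuotientGroup.mk' (D.subgroupOf (Subgroup.normalizer (D : Set G)))) g ∈
      imageInNormalizerQuotient A D ↔ (g : G) ∈ A := by
  refine ⟨?_, fun hg => ⟨g, hg, rfl⟩⟩
  rintro ⟨a, ha, hag⟩
  have h1 := Subgroup.mem_subgroupOf.1 ((QuotientGroup.eq).1 hag)
  have h2 : (a : G) ∈ A := ha
  simpa using mul_mem h2 (h.le h1)

/-- The kernel of a character with inertia group `A` belongs to `𝒟_N`, where `N` is its core. -/
lemma mem_kernelSet (h : IsInertial A D χ) : D ∈ kernelSet D.normalCore A := by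
  refine ⟨h.le, D.normalCore_le, rfl, ?_, ?_, ?_⟩
  · obtain ⟨a₀, -, hgen⟩ := exists_orderOf_eq_relIndex h.ker
    refine ⟨⟨⟨QuotientGroup.mk' _ ⟨a₀, h.normal_le_normalizer a₀.2⟩, (h.mk_mem_image_iff _).2 a₀.2⟩,
      ?_⟩⟩
    rintro ⟨_, a, ha, rfl⟩
    obtain ⟨j, hj⟩ := hgen ⟨a, ha⟩
    refine ⟨j, Subtype.ext ?_⟩
    simp only [zpow_natCast, SubmonoidClass.mk_pow, ← map_pow]
    refine (QuotientGroup.eq).2 (Subgroup.mem_subgroupOf.2 ?_)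
    have : χ ((a₀ ^ j)⁻¹ * ⟨a, ha⟩) = 1 := by simp [hj]
    simpa using (h.ker _).1 this
  · refine ⟨⟨?_⟩⟩
    rintro ⟨_, a, ha, rfl⟩ ⟨_, b, hb, rfl⟩
    refine Subtype.ext ((QuotientGroup.eq).2 (Subgroup.mem_subgroupOf.2 ?_))
    have : χ ((⟨a, ha⟩ * ⟨b, hb⟩)⁻¹ * (⟨b, hb⟩ * ⟨a, ha⟩)) = 1 := by
      rw [map_mul, map_inv, map_mul, map_mul, mul_comm (χ ⟨a, ha⟩), inv_mul_cancel]
    simpa using (h.ker _).1 this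
  -- An element of N_G(D) that commutes with A modulo D fixes χ, so the inertia condition places it
  -- in A.
  · rintro B hB hle x hx
    obtain ⟨g, rfl⟩ := QuotientGroup.mk'_surjective _ x
    refine (h.mk_mem_image_iff g).2 (h.inertia g (MonoidHom.ext fun a => ?_))
    have ha := hle ((h.mk_mem_image_iff ⟨a, h.normal_le_normalizer a.2⟩).2 a.2)
    have h1 := congrArg Subtype.val (hB.is_comm.comm (⟨_, ha⟩ : B) ⟨_, hx⟩)
    simp only [MulMemClass.mk_mul_mk, ← map_mul] at h1
    have h2 := Subgroup.mem_subgroupOf.1 ((QuotientGroup.eq).1 h1)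
    have h3 : a⁻¹ * MulAut.conjNormal (g : G) a ∈ χ.ker := by
      have h5 := Subgroup.mem_normalizer_iff.1 g.2 _ |>.1 h2
      refine (h.ker _).2 ?_
      simpa [mul_assoc] using h5
    rw [MonoidHom.mem_ker, map_mul, map_inv, inv_mul_eq_one] at h3
    exact h3.symm

end IsInertial

/-- The members of `𝒟_N` are the kernels of characters with inertia group `A`. -/
lemma isInertial_of_mem_kernelSet (hq : (Nat.card F).Coprime (Nat.card G)) {N : Subgroup G}
    (hD : D ∈ kernelSet N A) (hab : ∀ a ∈ A, ∀ b ∈ A, a * b * a⁻¹ * b⁻¹ ∈ N)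
    (hχ : Subgroup.zpowers χ = irrQuotient F A D) : IsInertial A D χ := by
  obtain ⟨hDA, hND, -, -, hmax⟩ := hD
  have hker := ker_of_zpowers_eq hq (fun a ha b hb => hND (hab a ha b hb)) hχ
  refine ⟨hDA, hker, fun g hg => ?_⟩
  have hgN : g ∈ Subgroup.normalizer (D : Set G) :=
    mem_normalizer_of_conjHom_eq hDA hker (i := 0) (hg.trans (pow_card_pow_zero χ).symm)
  set π := QuotientGroup.mk' (D.subgroupOf (Subgroup.normalizer (D : Set G))) with hπ
  have hcomm : ∀ a : Subgroup.normalizer (D : Set G), (a : G) ∈ A →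
      π a * π ⟨g, hgN⟩ = π ⟨g, hgN⟩ * π a := fun a ha => by
    rw [← map_mul, ← map_mul]
    refine (QuotientGroup.eq).2 (Subgroup.mem_subgroupOf.2 ?_)
    have h1 : χ (MulAut.conjNormal g⁻¹ ⟨a, ha⟩⁻¹ * ⟨a, ha⟩) = 1 := by
      have h2 := DFunLike.congr_fun hg (MulAut.conjNormal g⁻¹ ⟨a, ha⟩)
      rw [conjHom_apply, ← MulAut.mul_apply, ← map_mul] at h2
      simp only [mul_inv_cancel, map_one, MulAut.one_apply] at h2
      rw [map_mul, map_inv, map_inv, ← h2, inv_mul_cancel]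
    simpa [mul_assoc] using (hker _).1 h1
  -- Adjoining the image of g to A/D leaves it abelian, so by maximality g was already in A.
  have hcl : IsMulCommutative (Subgroup.closure
      ((imageInNormalizerQuotient A D : Set _) ∪ {π ⟨g, hgN⟩})) := by
    apply Subgroup.isMulCommutative_closure
    rintro x (hx | rfl) y (hy | rfl)
    · exact congrArg Subtype.val (hmax.1.is_comm.comm (⟨x, hx⟩ : imageInNormalizerQuotient A D)
        ⟨y, hy⟩)
    · obtain ⟨a, ha, rfl⟩ := hx
      exact hcomm a ha
    · obtain ⟨a, ha, rfl⟩ := hy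
      exact (hcomm a ha).symm
    · rfl
  have hle := hmax.2 hcl fun x hx => Subgroup.subset_closure (Or.inl hx)
  have hmem : π ⟨g, hgN⟩ ∈ imageInNormalizerQuotient A D :=
    hle (Subgroup.subset_closure (Or.inr rfl))
  obtain ⟨a, ha, hag⟩ := hmem
  have h1 := Subgroup.mem_subgroupOf.1 ((QuotientGroup.eq).1 hag)
  have h2 : (a : G) ∈ A := ha
  simpa using mul_mem h2 (hDA h1)

end Inertial

/-! ### The stabilizer of a cyclotomic coset -/

section Stabilizer

variable {F : Type u} [Field F] [Finite F] {G : Type v} [Group G] [Finite G]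
variable {A D : Subgroup G} [A.Normal] {χ : LinChar F A}

lemma mem_cosetStabilizer_cyclotomicCoset (hq : (Nat.card F).Coprime (Nat.card G)) (hD : D ≤ A)
    (hker : ∀ a : A, χ a = 1 ↔ (a : G) ∈ D) {g : G} :
    g ∈ cosetStabilizer F A D (cyclotomicCoset F A D χ) ↔
      ∃ i : ℕ, conjHom g χ = χ ^ (Nat.card F ^ i) := by
  constructor
  · rintro ⟨-, hg, h⟩
    have h1 : χ ∈ cyclotomicCoset F A D χ :=
      (mem_cyclotomicCoset_iff hq hker).2 ⟨0, (pow_card_pow_zero χ).symm⟩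
    have h2 : conjChar ⟨g, hg⟩ χ ∈ cyclotomicCoset F A D χ := h ▸ Set.mem_image_of_mem _ h1
    exact (mem_cyclotomicCoset_iff hq hker).1 h2
  · rintro ⟨i, hi⟩
    refine ⟨mem_normalizer_of_conjHom_eq hD hker hi, mem_normalizer_of_normal g, ?_⟩
    have hfin : (cyclotomicCoset F A D χ).Finite := by
      refine ((Set.finite_lt_nat (ordMod F A D)).image fun i => χ ^ (Nat.card F ^ i)).subset ?_
      rintro _ ⟨i, hi, rfl⟩
      exact ⟨i, hi, rfl⟩
    -- The coset is finite and conjugation is injective, so mapping the coset into itself is enough.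
    refine Set.eq_of_subset_of_ncard_le ?_ (Set.ncard_image_of_injective _
      (conjHom_injective g)).ge hfin
    rintro _ ⟨ψ, hψ, rfl⟩
    obtain ⟨j, rfl⟩ := (mem_cyclotomicCoset_iff hq hker).1 hψ
    refine (mem_cyclotomicCoset_iff hq hker).2 ⟨i + j, ?_⟩
    rw [conjChar_eq_conjHom, conjHom_pow, hi, pow_card_pow_pow]

/-- This is the independence of the stabilizer from C: two generators of Irr(A/D) are powers of each
other, and conjugation commutes with powers. -/
lemma mem_cosetStabilizer_iff (hq : (Nat.card F).Coprime (Nat.card G)) (hD : D ≤ A)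
    (hker : ∀ a : A, χ a = 1 ↔ (a : G) ∈ D) {C : Set (LinChar F A)} (hC : C ∈ cosetSet F A D)
    {g : G} : g ∈ cosetStabilizer F A D C ↔ ∃ i : ℕ, conjHom g χ = χ ^ (Nat.card F ^ i) := by
  obtain ⟨χ₀, h₀, rfl⟩ := hC
  have hz : Subgroup.zpowers χ₀ = Subgroup.zpowers χ := h₀.trans (zpowers_eq_of_ker hker).symm
  obtain ⟨y, hy⟩ : χ ∈ Subgroup.zpowers χ₀ := hz ▸ Subgroup.mem_zpowers χ
  obtain ⟨z, hz⟩ : χ₀ ∈ Subgroup.zpowers χ := hz ▸ Subgroup.mem_zpowers χ₀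
  have hy' : ∀ a, χ a = χ₀ a ^ y := fun a => by rw [← hy]; rfl
  have hz' : ∀ a, χ₀ a = χ a ^ z := fun a => by rw [← hz]; rfl
  have hker₀ : ∀ a : A, χ₀ a = 1 ↔ (a : G) ∈ D := fun a => by
    rw [← hker]
    exact ⟨fun h => by rw [hy', h, one_zpow], fun h => by rw [hz', h, one_zpow]⟩
  rw [mem_cosetStabilizer_cyclotomicCoset hq hD hker₀]
  refine exists_congr fun i => ⟨fun h => ?_, fun h => ?_⟩ <;> refine MonoidHom.ext fun a => ?_
  · have := DFunLike.congr_fun h a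
    rw [conjHom_apply] at this ⊢
    rw [hy', this, MonoidHom.pow_apply, MonoidHom.pow_apply, hy', ← zpow_natCast, ← zpow_natCast,
      zpow_comm]
  · have := DFunLike.congr_fun h a
    rw [conjHom_apply] at this ⊢
    rw [hz', this, MonoidHom.pow_apply, MonoidHom.pow_apply, hz', ← zpow_natCast, ← zpow_natCast,
      zpow_comm]

/-- A subgroup of order `s` of the cyclic group generated by `u` is generated by
`u ^ (orderOf u / s)`. -/
lemma pow_mem_iff_of_le_zpowers {U : Type*} [Group U] [Finite U] {u : U} {R : Subgroup U}
    (hR : R ≤ Subgroup.zpowers u) : 0 < orderOf u / Nat.card R ∧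
      ∀ i : ℕ, u ^ i ∈ R ↔ orderOf u / Nat.card R ∣ i := by
  classical
  have hs : Nat.card R ∣ orderOf u := by
    rw [← Nat.card_zpowers]; exact Subgroup.card_dvd_of_le hR
  obtain ⟨m, hm⟩ := hs
  have hspos : 0 < Nat.card R := Nat.card_pos
  have hm' : orderOf u / Nat.card R = m := by rw [hm, Nat.mul_div_cancel_left _ hspos]
  have hmpos : 0 < m := by
    rcases Nat.eq_zero_or_pos m with h | h
    · rw [h, mul_zero] at hm
      exact absurd hm (orderOf_pos u).ne'
    · exact h
  have hmem : u ^ m ∈ R := by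
    let := Fintype.ofFinite (Subgroup.zpowers u)
    have hcard := IsCyclic.card_pow_eq_one_le (α := Subgroup.zpowers u) hspos
    let S : Finset (Subgroup.zpowers u) := Finset.univ.filter fun x => (x : U) ∈ R
    have hScard : S.card = Nat.card R := by
      have h1 : Nat.card (R.subgroupOf (Subgroup.zpowers u)) = Nat.card R :=
        Nat.card_congr (Subgroup.subgroupOfEquivOfLe hR).toEquiv
      rw [← h1, Nat.card_eq_fintype_card, Fintype.card_subtype]
      rfl
    have hsub : S ⊆ Finset.univ.filter fun a : Subgroup.zpowers u => a ^ Nat.card R = 1 := by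
      intro x hx
      simp only [S, Finset.mem_filter, Finset.mem_univ, true_and] at hx ⊢
      have h2 : (⟨x, hx⟩ : R) ^ Nat.card R = 1 := pow_card_eq_one'
      have h4 : (x : U) ^ Nat.card R = 1 := congrArg Subtype.val h2
      exact Subtype.ext h4
    -- A cyclic group has at most |R| solutions of x^|R| = 1, and the elements of R already supply
    -- that many.
    have heq := Finset.eq_of_subset_of_card_le hsub (by rw [hScard]; exact hcard)
    have h3 : (⟨u ^ m, Subgroup.npow_mem_zpowers u m⟩ : Subgroup.zpowers u) ∈ S := by
      rw [heq]
      simp only [Finset.mem_filter, Finset.mem_univ, true_and]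
      refine Subtype.ext ?_
      change (u ^ m) ^ Nat.card R = 1
      rw [← pow_mul, mul_comm, ← hm, pow_orderOf_eq_one]
    simpa [S] using h3
  rw [hm']
  refine ⟨hmpos, fun i => ⟨fun h => ?_, ?_⟩⟩
  · have h1 : (⟨u ^ i, h⟩ : R) ^ Nat.card R = 1 := pow_card_eq_one'
    have h2 : u ^ (i * Nat.card R) = 1 := by
      rw [pow_mul]; exact congrArg Subtype.val h1
    have h3 := orderOf_dvd_of_pow_eq_one h2
    rw [hm, mul_comm i] at h3
    exact Nat.dvd_of_mul_dvd_mul_left hspos h3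
  · rintro ⟨j, rfl⟩
    rw [pow_mul]
    exact pow_mem hmem j

/-- The powers of Frobenius that act on `χ` as an element of `G` are those whose exponent is a
multiple of `o / [E : A]`. -/
lemma IsInertial.exists_conjHom_eq_iff_dvd (hq : (Nat.card F).Coprime (Nat.card G))
    (h : IsInertial A D χ) {C : Set (LinChar F A)} (hC : C ∈ cosetSet F A D) :
    0 < ordMod F A D / A.relIndex (cosetStabilizer F A D C) ∧
      ∀ i : ℕ, (∃ g, conjHom g χ = χ ^ (Nat.card F ^ i)) ↔
        ordMod F A D / A.relIndex (cosetStabilizer F A D C) ∣ i := by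
  have : NeZero (D.relIndex A) := ⟨Subgroup.index_ne_zero_of_finite⟩
  set E := cosetStabilizer F A D C with hE
  set u := ZMod.unitOfCoprime _ (coprime_relIndex hq D A) with hu
  have hpow : ∀ i j : ℕ, χ ^ (Nat.card F ^ i) = χ ^ (Nat.card F ^ j) ↔ u ^ i = u ^ j := fun i j => by
    rw [pow_card_pow_eq_iff h.ker, Units.ext_iff]
    simp [hu]
  have hmem : ∀ g, g ∈ E ↔ ∃ i : ℕ, conjHom g χ = χ ^ (Nat.card F ^ i) := fun g =>
    mem_cosetStabilizer_iff hq h.le h.ker hC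
  choose f hf using fun g : E => (hmem g).1 g.2
  -- The map sends g to the power of q by which it acts on χ. Its kernel is A by inertia, so its
  -- image is a subgroup of order [E:A] in the cyclic group of order o generated by q.
  let θ : E →* (ZMod (D.relIndex A))ˣ := MonoidHom.mk' (fun g => u ^ f g) fun g g' => by
    rw [← pow_add, ← hpow, ← hf, Subgroup.coe_mul, conjHom_mul, hf g, conjHom_pow, hf g',
      pow_card_pow_pow, add_comm]
  have hθ : ∀ g, θ g = u ^ f g := fun g => rfl
  have hker : θ.ker = A.subgroupOf E := by
    ext g
    rw [MonoidHom.mem_ker, hθ, Subgroup.mem_subgroupOf, ← pow_zero u, ← hpow, ← hf,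
      pow_card_pow_zero]
    exact ⟨h.inertia g, fun hg => conjHom_of_mem (⟨(g : G), hg⟩ : A) χ⟩
  have hcard : Nat.card θ.range = A.relIndex E := by
    rw [← Subgroup.index_ker, hker, Subgroup.relIndex]
  have hle : θ.range ≤ Subgroup.zpowers u := by
    rintro _ ⟨g, rfl⟩
    exact Subgroup.npow_mem_zpowers u _
  have hord : orderOf u = ordMod F A D := by
    rw [ordMod, ← orderOf_units, hu, ZMod.coe_unitOfCoprime]
  have key := pow_mem_iff_of_le_zpowers hle
  rw [hcard, hord] at key
  refine ⟨key.1, fun i => ?_⟩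
  rw [← key.2]
  constructor
  · rintro ⟨g, hg⟩
    refine ⟨⟨g, (hmem g).2 ⟨i, hg⟩⟩, ?_⟩
    rw [hθ, ← hpow, ← hf, hg]
  · rintro ⟨g, hg⟩
    exact ⟨g, by rw [hf, hpow, ← hθ, hg]⟩

end Stabilizer

/-! ### Sums of character idempotents -/

section CharSum

variable {F : Type u} [Field F] [Finite F] {G : Type v} [Group G] [Finite G]

/-- The inclusion of the group algebra over `F` into the one over the algebraic closure. -/
def toClosure (F : Type u) [Field F] (G : Type v) [Group G] :
    MonoidAlgebra F G →ₐ[F] MonoidAlgebra (AlgebraicClosure F) G :=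
  mapAlgHom G (Algebra.ofId F (AlgebraicClosure F))

lemma toClosure_single (g : G) (c : F) :
    toClosure F G (single g c) = single g (algebraMap F (AlgebraicClosure F) c) :=
  mapAlgHom_single ..

lemma toClosure_injective : Function.Injective (toClosure F G) := fun x y h => by
  ext g
  have := congrArg (fun z => z.coeff g) h
  simp only [toClosure, coeff_mapAlgHom] at this
  exact (algebraMap F (AlgebraicClosure F)).injective this

/-- The `i`-th power of Frobenius on coefficients. -/
def coeffFrob (F : Type u) [Field F] [Finite F] (G : Type v) [Group G] (i : ℕ) :
    MonoidAlgebra (AlgebraicClosure F) G →ₐ[F] MonoidAlgebra (AlgebraicClosure F) G :=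
  mapAlgHom G (frob F (AlgebraicClosure F) ^ i)

lemma coeffFrob_smul (i : ℕ) (c : AlgebraicClosure F)
    (x : MonoidAlgebra (AlgebraicClosure F) G) :
    coeffFrob F G i (c • x) = c ^ (Nat.card F ^ i) • coeffFrob F G i x := by
  ext g
  simp [coeffFrob, coeff_mapAlgHom, frob_pow_apply, mul_pow]

lemma coeffFrob_toClosure (i : ℕ) (x : MonoidAlgebra F G) :
    coeffFrob F G i (toClosure F G x) = toClosure F G x := by
  ext g
  simp only [coeffFrob, toClosure, coeff_mapAlgHom, Algebra.ofId_apply, AlgHom.commutes]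

lemma coeffFrob_charIdem {A : Subgroup G} (i : ℕ) (χ : LinChar F A) :
    coeffFrob F G i (charIdem χ) = charIdem (χ ^ (Nat.card F ^ i)) := by
  cases nonempty_fintype A
  simp only [charIdem, finsum_eq_sum_of_fintype, map_sum, coeffFrob, mapAlgHom_single]
  refine Finset.sum_congr rfl fun a _ => ?_
  congr 1
  rw [map_mul, map_inv₀, map_natCast, frob_pow_apply, MonoidHom.pow_apply,
    Units.val_pow_eq_pow_val]

variable {A D : Subgroup G}

/-- The sum of the idempotents of the characters in `X`. -/
def charSum (X : Set (LinChar F A)) : MonoidAlgebra (AlgebraicClosure F) G :=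
  ∑ᶠ ψ ∈ X, charIdem ψ

lemma charSum_mul_charIdem (hq : (Nat.card F).Coprime (Nat.card G)) {X : Set (LinChar F A)}
    (hX : X.Finite) {ψ : LinChar F A} (hψ : ψ ∈ X) : charSum X * charIdem ψ = charIdem ψ := by
  classical
  rw [charSum, finsum_mem_eq_finite_toFinset_sum _ hX, Finset.sum_mul,
    Finset.sum_eq_single_of_mem ψ (by simpa using hψ)
      fun φ _ h => charIdem_mul_charIdem_of_ne h,
    charIdem_mul_self (card_subgroup_ne_zero hq A)]

lemma charSum_mul_charIdem_of_notMem {X : Set (LinChar F A)}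
    (hX : X.Finite) {ψ : LinChar F A} (hψ : ψ ∉ X) : charSum X * charIdem ψ = 0 := by
  classical
  rw [charSum, finsum_mem_eq_finite_toFinset_sum _ hX, Finset.sum_mul]
  refine Finset.sum_eq_zero fun φ hφ => charIdem_mul_charIdem_of_ne ?_
  rintro rfl
  exact hψ (by simpa using hφ)

/-- By orthogonality the sum of idempotents remembers its set of characters. -/
lemma mem_iff_charSum_mul_ne_zero (hq : (Nat.card F).Coprime (Nat.card G))
    {X : Set (LinChar F A)} (hX : X.Finite) {ψ : LinChar F A} :
    ψ ∈ X ↔ charSum X * charIdem ψ ≠ 0 := by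
  refine ⟨fun h => ?_, fun h => ?_⟩
  · rw [charSum_mul_charIdem hq hX h]
    exact charIdem_ne_zero (card_subgroup_ne_zero hq A) ψ
  · by_contra h'
    exact h (charSum_mul_charIdem_of_notMem hX h')

lemma charSum_inj (hq : (Nat.card F).Coprime (Nat.card G)) {X Y : Set (LinChar F A)}
    (hX : X.Finite) (hY : Y.Finite) (h : charSum X = charSum Y) : X = Y := by
  ext ψ
  rw [mem_iff_charSum_mul_ne_zero hq hX, h, ← mem_iff_charSum_mul_ne_zero hq hY]

lemma mul_charSum_eq_zero {X : Set (LinChar F A)} (hX : X.Finite)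
    {x : MonoidAlgebra (AlgebraicClosure F) G}
    (h : ∀ ψ ∈ X, x * charIdem ψ = 0) : x * charSum X = 0 := by
  rw [charSum, finsum_mem_eq_finite_toFinset_sum _ hX, Finset.mul_sum]
  exact Finset.sum_eq_zero fun ψ hψ => h ψ (by simpa using hψ)

lemma mul_charSum_eq_self {X : Set (LinChar F A)} (hX : X.Finite)
    {x : MonoidAlgebra (AlgebraicClosure F) G}
    (h : ∀ ψ ∈ X, x * charIdem ψ = charIdem ψ) : x * charSum X = charSum X := by
  rw [charSum, finsum_mem_eq_finite_toFinset_sum _ hX, Finset.mul_sum]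
  exact Finset.sum_congr rfl fun ψ hψ => h ψ (by simpa using hψ)

lemma charSum_conj [A.Normal] (g : G) {X : Set (LinChar F A)} (hX : X.Finite) :
    single g⁻¹ 1 * charSum X * single g 1 = charSum (conjHom g '' X) := by
  rw [charSum, charSum, finsum_mem_image (conjHom_injective g).injOn,
    finsum_mem_eq_finite_toFinset_sum _ hX, finsum_mem_eq_finite_toFinset_sum _ hX,
    Finset.mul_sum, Finset.sum_mul]
  exact Finset.sum_congr rfl fun ψ _ => charIdem_conj g ψ

lemma finite_cyclotomicCoset (χ : LinChar F A) : (cyclotomicCoset F A D χ).Finite := by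
  refine ((Set.finite_lt_nat (ordMod F A D)).image fun i => χ ^ (Nat.card F ^ i)).subset ?_
  rintro _ ⟨i, hi, rfl⟩
  exact ⟨i, hi, rfl⟩

/-- The trace of χ(a) is the sum of the χ(a)^(q^i) for i < o, because o is the degree of F(ζ_n) over
F; exchanging the two sums gives the idempotents of the powers of χ. -/
lemma toClosure_epsilon (hq : (Nat.card F).Coprime (Nat.card G)) {χ : LinChar F A}
    (hker : ∀ a : A, χ a = 1 ↔ (a : G) ∈ D) :
    toClosure F G (epsilon A D χ) = charSum (cyclotomicCoset F A D χ) := by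
  classical
  have h1 : cyclotomicCoset F A D χ =
      (fun i => χ ^ (Nat.card F ^ i)) '' (Finset.range (ordMod F A D) : Set ℕ) := by
    ext ψ
    simp only [cyclotomicCoset, Set.mem_ofPred_eq, Set.mem_image, Finset.coe_range, Set.mem_Iio]
    exact exists_congr fun i => and_congr_right fun _ => eq_comm
  -- The exponents below o give distinct powers of χ, so the coset is not summed with repetitions.
  have hinj : Set.InjOn (fun i => χ ^ (Nat.card F ^ i)) (Finset.range (ordMod F A D) : Set ℕ) := by
    intro i hi j hj hij
    have h2 := (pow_card_pow_eq_iff hker i j).1 hij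
    rw [← ZMod.coe_unitOfCoprime _ (coprime_relIndex hq D A), ← Units.val_pow_eq_pow_val,
      ← Units.val_pow_eq_pow_val] at h2
    have h3 : ordMod F A D = orderOf (ZMod.unitOfCoprime _ (coprime_relIndex hq D A)) := by
      rw [ordMod, ← orderOf_units, ZMod.coe_unitOfCoprime]
    simp only [Finset.coe_range, Set.mem_Iio, h3] at hi hj
    exact pow_injOn_Iio_orderOf hi hj (Units.ext h2)
  rw [charSum, h1, finsum_mem_image hinj, finsum_mem_coe_finset]
  cases nonempty_fintype A
  simp only [charIdem, epsilon, finsum_eq_sum_of_fintype, map_sum, toClosure_single]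
  rw [Finset.sum_comm]
  refine Finset.sum_congr rfl fun a _ => ?_
  have h4 : ((χ a : (AlgebraicClosure F)ˣ) : AlgebraicClosure F) ^ D.relIndex A = 1 := by
    have := congrArg Units.val (DFunLike.congr_fun (pow_relIndex_of_ker hker) a)
    simpa using this
  rw [map_mul, map_inv₀, map_natCast, algebraMap_cyclotomicTrace F (coprime_relIndex hq D A) h4,
    Finset.mul_sum]
  have h5 : ∀ (s : Finset ℕ) (f : ℕ → AlgebraicClosure F),
      (single (a : G)⁻¹ (∑ i ∈ s, f i) : MonoidAlgebra (AlgebraicClosure F) G) =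
        ∑ i ∈ s, single (a : G)⁻¹ (f i) := fun s f =>
    map_sum (singleAddHom (R := AlgebraicClosure F) (a : G)⁻¹) f s
  rw [h5]
  rfl

end CharSum

/-! ### Orbits of characters under conjugation and Frobenius -/

section Orbit

variable {F : Type u} [Field F] [Finite F] {G : Type v} [Group G] [Finite G]
variable {A D : Subgroup G} [A.Normal] {χ : LinChar F A}

/-- The orbit of `χ` under `G` and Frobenius. -/
def charOrbit (χ : LinChar F A) : Set (LinChar F A) :=
  {ψ | ∃ (g : G) (i : ℕ), ψ = conjHom g χ ^ (Nat.card F ^ i)}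

lemma self_mem_charOrbit (χ : LinChar F A) : χ ∈ charOrbit χ :=
  ⟨1, 0, by rw [conjHom_one, pow_card_pow_zero]⟩

lemma conjHom_pow_mem_charOrbit {ψ : LinChar F A} (h : ψ ∈ charOrbit χ) (g : G) (i : ℕ) :
    conjHom g ψ ^ (Nat.card F ^ i) ∈ charOrbit χ := by
  obtain ⟨g', j, rfl⟩ := h
  exact ⟨g' * g, j + i, by rw [conjHom_pow, pow_card_pow_pow, conjHom_mul]⟩

lemma charOrbit_subset {ψ : LinChar F A} (h : ψ ∈ charOrbit χ) : charOrbit ψ ⊆ charOrbit χ := by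
  rintro _ ⟨g, i, rfl⟩
  exact conjHom_pow_mem_charOrbit h g i

lemma pow_card_pow_ordMod_mul (hker : ∀ a : A, χ a = 1 ↔ (a : G) ∈ D) (i : ℕ) :
    χ ^ (Nat.card F ^ (ordMod F A D * i)) = χ := by
  conv_rhs => rw [← pow_card_pow_zero χ]
  rw [pow_card_pow_eq_iff hker, ordMod, pow_mul, pow_orderOf_eq_one, one_pow, pow_zero]

lemma charOrbit_eq (hq : (Nat.card F).Coprime (Nat.card G))
    (hker : ∀ a : A, χ a = 1 ↔ (a : G) ∈ D) {ψ : LinChar F A}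
    (h : ψ ∈ charOrbit χ) : charOrbit ψ = charOrbit χ := by
  refine (charOrbit_subset h).antisymm (charOrbit_subset ?_)
  obtain ⟨g, i, rfl⟩ := h
  -- The o-th power of Frobenius fixes χ, so the exponent (o - 1)i undoes i without subtraction.
  refine ⟨g⁻¹, (ordMod F A D - 1) * i, ?_⟩
  rw [conjHom_pow, ← conjHom_mul, mul_inv_cancel, conjHom_one, pow_card_pow_pow]
  have : i + (ordMod F A D - 1) * i = ordMod F A D * i := by
    obtain ⟨m, hm⟩ := Nat.exists_eq_succ_of_ne_zero (ordMod_pos hq A D).ne'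
    rw [hm]; simp; ring
  rw [this, pow_card_pow_ordMod_mul hker]

lemma charOrbit_eq_iUnion (hq : (Nat.card F).Coprime (Nat.card G))
    (hker : ∀ a : A, χ a = 1 ↔ (a : G) ∈ D) :
    charOrbit χ = ⋃₀ (Set.range fun g : G => conjHom g '' cyclotomicCoset F A D χ) := by
  ext ψ
  simp only [Set.sUnion_range, Set.mem_iUnion, Set.mem_image, mem_cyclotomicCoset_iff hq hker]
  constructor
  · rintro ⟨g, i, rfl⟩
    exact ⟨g, _, ⟨i, rfl⟩, rfl⟩
  · rintro ⟨g, _, ⟨i, rfl⟩, rfl⟩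
    exact ⟨g, i, rfl⟩

lemma finite_charOrbit (hq : (Nat.card F).Coprime (Nat.card G))
    (hker : ∀ a : A, χ a = 1 ↔ (a : G) ∈ D) : (charOrbit χ).Finite := by
  rw [charOrbit_eq_iUnion hq hker]
  refine Set.Finite.sUnion (Set.finite_range _) ?_
  rintro _ ⟨g, rfl⟩
  exact (finite_cyclotomicCoset χ).image _

/-- Each translate is a full orbit of Frobenius, since conjugation commutes with it. Hence distinct
translates do not overlap and the sum over them is a sum over the orbit of χ. -/
lemma pairwiseDisjoint_conj_cyclotomicCoset (hq : (Nat.card F).Coprime (Nat.card G))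
    (hker : ∀ a : A, χ a = 1 ↔ (a : G) ∈ D) :
    (Set.range fun g : G => conjHom g '' cyclotomicCoset F A D χ).PairwiseDisjoint id := by
  have key : ∀ (g h : G), ∀ ψ ∈ conjHom g '' cyclotomicCoset F A D χ,
      ψ ∈ conjHom h '' cyclotomicCoset F A D χ →
      conjHom g '' cyclotomicCoset F A D χ ⊆ conjHom h '' cyclotomicCoset F A D χ := by
    rintro g h ψ ⟨φ, hφ, rfl⟩ ⟨φ', hφ', hh⟩ _ ⟨θ, hθ, rfl⟩
    rw [mem_cyclotomicCoset_iff hq hker] at hφ hφ' hθ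
    obtain ⟨i, rfl⟩ := hφ
    obtain ⟨j, rfl⟩ := hφ'
    obtain ⟨l, rfl⟩ := hθ
    refine ⟨χ ^ (Nat.card F ^ (j + ((ordMod F A D - 1) * i + l))),
      (mem_cyclotomicCoset_iff hq hker).2 ⟨_, rfl⟩, ?_⟩
    rw [← pow_card_pow_pow, conjHom_pow, hh, ← conjHom_pow, pow_card_pow_pow]
    have : i + ((ordMod F A D - 1) * i + l) = ordMod F A D * i + l := by
      obtain ⟨m, hm⟩ := Nat.exists_eq_succ_of_ne_zero (ordMod_pos hq A D).ne'
      rw [hm]; simp; ring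
    rw [this, ← pow_card_pow_pow, pow_card_pow_ordMod_mul hker]
  rintro _ ⟨g, rfl⟩ _ ⟨h, rfl⟩ hne
  refine Set.disjoint_left.2 fun ψ hg hh => hne ?_
  exact (key g h ψ hg hh).antisymm (key h g ψ hh hg)

/-- Over the algebraic closure, `e_C(G,A,D)` is the sum of the idempotents of the characters in
the orbit. -/
lemma toClosure_conjugateSum_epsilon (hq : (Nat.card F).Coprime (Nat.card G))
    (hker : ∀ a : A, χ a = 1 ↔ (a : G) ∈ D) :
    toClosure F G (conjugateSum (epsilon A D χ)) = charSum (charOrbit χ) := by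
  have hfin := finite_cyclotomicCoset (D := D) χ
  have hfin' : ∀ X ∈ Set.range fun g : G => conjHom g '' cyclotomicCoset F A D χ, X.Finite := by
    rintro _ ⟨g, rfl⟩
    exact hfin.image _
  have h1 : ∀ g : G, toClosure F G (of F G g⁻¹ * epsilon A D χ * of F G g) =
      charSum (conjHom g '' cyclotomicCoset F A D χ) := fun g => by
    rw [map_mul, map_mul, toClosure_epsilon hq hker, of_apply, of_apply, toClosure_single,
      toClosure_single, map_one, charSum_conj g hfin]
  have h0 : ∀ s : Set (MonoidAlgebra F G), s.Finite → toClosure F G (∑ᶠ y ∈ s, y) =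
      ∑ᶠ z ∈ toClosure F G '' s, z := fun s hs => by
    rw [finsum_mem_image toClosure_injective.injOn, finsum_mem_eq_finite_toFinset_sum _ hs,
      finsum_mem_eq_finite_toFinset_sum _ hs, map_sum]
  rw [conjugateSum, h0 _ (Set.finite_range _), charSum, charOrbit_eq_iUnion hq hker,
    finsum_mem_sUnion (pairwiseDisjoint_conj_cyclotomicCoset hq hker) (Set.finite_range _) hfin']
  -- Distinct conjugates of ε_C correspond to distinct translates of the coset, because a set of
  -- characters is determined by its sum of idempotents.
  have h2 : Set.InjOn (charSum (F := F) (A := A))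
      (Set.range fun g : G => conjHom g '' cyclotomicCoset F A D χ) := fun X hX Y hY h =>
    charSum_inj hq (hfin' X hX) (hfin' Y hY) h
  change _ = ∑ᶠ X ∈ _, charSum X
  refine Eq.trans ?_ (finsum_mem_image (f := fun z => z) h2)
  rw [← Set.range_comp, ← Set.range_comp]
  congr! 4
  ext z
  simp only [Set.mem_range, Function.comp_apply, h1]

end Orbit

/-! ### The elements `e_C(G,A,D)` are primitive central idempotents -/

section Primitive

variable {F : Type u} [Field F] [Finite F] {G : Type v} [Group G] [Finite G]

lemma mem_center_of_commute_single {R : Type*} [CommRing R] {x : MonoidAlgebra R G}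
    (h : ∀ g : G, single g 1 * x = x * single g 1) : x ∈ Subring.center (MonoidAlgebra R G) := by
  refine Subring.mem_center_iff.2 fun y => ?_
  induction y using MonoidAlgebra.induction_linear with
  | zero => simp
  | add y z hy hz => rw [add_mul, mul_add, hy, hz]
  | single g r =>
    have h1 : (single g r : MonoidAlgebra R G) = r • single g 1 := by simp
    rw [h1, smul_mul_assoc, mul_smul_comm, h]

lemma toClosure_mem_center {z : MonoidAlgebra F G} (hz : z ∈ Subring.center (MonoidAlgebra F G)) :
    toClosure F G z ∈ Subring.center (MonoidAlgebra (AlgebraicClosure F) G) := by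
  refine mem_center_of_commute_single fun g => ?_
  have h1 := congrArg (toClosure F G) (Subring.mem_center_iff.1 hz (single g 1))
  rwa [map_mul, map_mul, toClosure_single, map_one] at h1

variable {A D : Subgroup G} [A.Normal] {χ : LinChar F A}

/-- A central element of `F[G]` acts on `e_χ` by a scalar. -/
lemma IsInertial.exists_toClosure_mul_charIdem (hq : (Nat.card F).Coprime (Nat.card G))
    (h : IsInertial A D χ) {z : MonoidAlgebra F G} (hz : z ∈ Subring.center (MonoidAlgebra F G)) :
    ∃ c : AlgebraicClosure F, toClosure F G z * charIdem χ = c • charIdem χ := by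
  obtain ⟨c, hc⟩ := exists_charIdem_mul_mul_charIdem (card_subgroup_ne_zero hq A) h.inertia
    (toClosure F G z)
  refine ⟨c, ?_⟩
  rw [← hc, Subring.mem_center_iff.1 (toClosure_mem_center hz), mul_assoc,
    charIdem_mul_self (card_subgroup_ne_zero hq A)]

/-- The action of a central element of `F[G]` on the idempotents of an orbit. -/
lemma toClosure_mul_charIdem_conj_pow {z : MonoidAlgebra F G}
    (hz : z ∈ Subring.center (MonoidAlgebra F G)) {c : AlgebraicClosure F}
    (hc : toClosure F G z * charIdem χ = c • charIdem χ) (g : G) (i : ℕ) :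
    toClosure F G z * charIdem (conjHom g χ ^ (Nat.card F ^ i)) =
      c ^ (Nat.card F ^ i) • charIdem (conjHom g χ ^ (Nat.card F ^ i)) := by
  have h1 : toClosure F G z * charIdem (conjHom g χ) = c • charIdem (conjHom g χ) := by
    rw [← charIdem_conj, ← mul_assoc, ← mul_assoc,
      ← Subring.mem_center_iff.1 (toClosure_mem_center hz), mul_assoc (single g⁻¹ 1), hc,
      mul_smul_comm, smul_mul_assoc]
  have h2 := congrArg (coeffFrob F G i) h1
  rwa [map_mul, coeffFrob_toClosure, coeffFrob_smul, coeffFrob_charIdem] at h2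

namespace IsInertial

lemma toClosure_mul_charIdem (hq : (Nat.card F).Coprime (Nat.card G)) (h : IsInertial A D χ)
    {ψ : LinChar F A} (hψ : ψ ∈ charOrbit χ) :
    toClosure F G (conjugateSum (epsilon A D χ)) * charIdem ψ = charIdem ψ := by
  rw [toClosure_conjugateSum_epsilon hq h.ker,
    charSum_mul_charIdem hq (finite_charOrbit hq h.ker) hψ]

lemma mem_center (hq : (Nat.card F).Coprime (Nat.card G)) (h : IsInertial A D χ) :
    conjugateSum (epsilon A D χ) ∈ Subring.center (MonoidAlgebra F G) := by
  refine mem_center_of_commute_single fun g => toClosure_injective ?_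
  have hfin := finite_charOrbit hq h.ker
  have h1 : conjHom g '' charOrbit χ = charOrbit χ := by
    refine Set.Subset.antisymm ?_ fun ψ hψ => ⟨conjHom g⁻¹ ψ, ?_, ?_⟩
    · rintro _ ⟨ψ, hψ, rfl⟩
      rw [← pow_card_pow_zero (conjHom g ψ)]
      exact conjHom_pow_mem_charOrbit hψ g 0
    · rw [← pow_card_pow_zero (conjHom g⁻¹ ψ)]
      exact conjHom_pow_mem_charOrbit hψ _ 0
    · rw [← conjHom_mul, inv_mul_cancel, conjHom_one]
  have h2 := charSum_conj g hfin
  rw [map_mul, map_mul, toClosure_single, map_one, toClosure_conjugateSum_epsilon hq h.ker]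
  conv_lhs => rw [← h1, ← h2]
  rw [← mul_assoc, ← mul_assoc, single_mul_single, mul_inv_cancel, mul_one, ← one_def, one_mul]

lemma isCentralIdempotent (hq : (Nat.card F).Coprime (Nat.card G)) (h : IsInertial A D χ) :
    IsCentralIdempotent (conjugateSum (epsilon A D χ)) := by
  refine ⟨h.mem_center hq, toClosure_injective ?_⟩
  rw [map_mul]
  conv_lhs => rw [toClosure_conjugateSum_epsilon hq h.ker]
  conv_rhs => rw [toClosure_conjugateSum_epsilon hq h.ker]
  exact mul_charSum_eq_self (finite_charOrbit hq h.ker) fun ψ hψ =>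
    charSum_mul_charIdem hq (finite_charOrbit hq h.ker) hψ

lemma conjugateSum_ne_zero (hq : (Nat.card F).Coprime (Nat.card G)) (h : IsInertial A D χ) :
    conjugateSum (epsilon A D χ) ≠ 0 := fun h0 => by
  have := h.toClosure_mul_charIdem hq (self_mem_charOrbit χ)
  rw [h0, map_zero, zero_mul] at this
  exact charIdem_ne_zero (card_subgroup_ne_zero hq A) χ this.symm

/-- A central element that kills `e_χ` is orthogonal to `e_C(G,A,D)`. -/
lemma mul_conjugateSum_eq_zero (hq : (Nat.card F).Coprime (Nat.card G)) (h : IsInertial A D χ)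
    {z : MonoidAlgebra F G} (hz : z ∈ Subring.center (MonoidAlgebra F G))
    (h0 : toClosure F G z * charIdem χ = 0) : z * conjugateSum (epsilon A D χ) = 0 := by
  refine toClosure_injective ?_
  rw [map_mul, map_zero, toClosure_conjugateSum_epsilon hq h.ker]
  refine mul_charSum_eq_zero (finite_charOrbit hq h.ker) ?_
  rintro _ ⟨g, i, rfl⟩
  have hne : Nat.card F ^ i ≠ 0 := pow_ne_zero _ Nat.card_pos.ne'
  rw [toClosure_mul_charIdem_conj_pow hz (c := 0) (by rw [h0, zero_smul]), zero_pow hne, zero_smul]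

/-- The scalar by which e₁ acts on e_χ is an idempotent of a field. If it is 0 then e₁ kills the
whole orbit, and if it is 1 then e₂ does. -/
lemma isPrimitiveCentralIdempotent (hq : (Nat.card F).Coprime (Nat.card G))
    (h : IsInertial A D χ) :
    IsPrimitiveCentralIdempotent (conjugateSum (epsilon A D χ)) := by
  refine ⟨h.isCentralIdempotent hq, h.conjugateSum_ne_zero hq, fun e₁ e₂ h₁ h₂ h₁₂ hsum => ?_⟩
  have hkill : ∀ e, IsCentralIdempotent e → e * conjugateSum (epsilon A D χ) = e →
      toClosure F G e * charIdem χ = 0 → e = 0 := fun e he hes h0 => by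
    rw [← hes, h.mul_conjugateSum_eq_zero hq he.1 h0]
  have h₂₁ : e₂ * e₁ = 0 := by rw [Subring.mem_center_iff.1 h₁.1, h₁₂]
  obtain ⟨c, hc⟩ := h.exists_toClosure_mul_charIdem hq h₁.1
  have hcc : (c * c - c) • charIdem χ = 0 := by
    have h3 : toClosure F G e₁ * (toClosure F G e₁ * charIdem χ) =
        toClosure F G e₁ * charIdem χ := by
      rw [← mul_assoc, ← map_mul, h₁.2.eq]
    rw [hc, mul_smul_comm, hc, smul_smul] at h3
    rw [sub_smul, h3, sub_self]
  have hc01 := (smul_eq_zero.1 hcc).resolve_right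
    (charIdem_ne_zero (card_subgroup_ne_zero hq A) χ)
  have hc01 : c * (c - 1) = 0 := by linear_combination hc01
  rcases mul_eq_zero.1 hc01 with h4 | h4
  · left
    refine hkill e₁ h₁ ?_ (by rw [hc, h4, zero_smul])
    rw [← hsum, mul_add, h₁.2.eq, h₁₂, add_zero]
  · right
    refine hkill e₂ h₂ ?_ ?_
    · rw [← hsum, mul_add, h₂.2.eq, h₂₁, zero_add]
    · have h5 : toClosure F G e₂ * charIdem χ = charIdem χ - toClosure F G e₁ * charIdem χ := by
        conv_rhs => rw [← h.toClosure_mul_charIdem hq (self_mem_charOrbit χ)]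
        rw [← hsum, map_add, add_mul, mul_add, ← mul_assoc, ← mul_assoc, ← map_mul, ← map_mul,
          h₁.2.eq, h₁₂, map_zero, zero_mul, add_zero]
        abel
      rw [h5, hc, sub_eq_zero.1 h4, one_smul, sub_self]

/-- The core of `D` is the set of the `g` with `g e = e`, `e = e_C(G,A,D)`. -/
lemma mem_normalCore_iff (hq : (Nat.card F).Coprime (Nat.card G)) (h : IsInertial A D χ) (g : G) :
    g ∈ D.normalCore ↔
      single g 1 * conjugateSum (epsilon A D χ) = conjugateSum (epsilon A D χ) := by
  constructor
  · intro hg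
    refine toClosure_injective ?_
    rw [map_mul, toClosure_single, map_one, toClosure_conjugateSum_epsilon hq h.ker]
    refine mul_charSum_eq_self (finite_charOrbit hq h.ker) ?_
    rintro _ ⟨x, i, rfl⟩
    have hgA : g ∈ A := h.le (D.normalCore_le hg)
    rw [single_mul_charIdem _ ⟨g, hgA⟩]
    have h1 : conjHom x χ ⟨g, hgA⟩ = 1 := by
      rw [conjHom_apply, h.ker]
      simpa using hg x
    rw [MonoidHom.pow_apply, h1, one_pow, Units.val_one, one_smul]
  · intro hg x
    have h1 := congrArg (toClosure F G) hg
    have hx : conjHom x χ ∈ charOrbit χ := ⟨x, 0, (pow_card_pow_zero _).symm⟩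
    have h2 := congrArg (· * charIdem (conjHom x χ)) h1
    simp only [map_mul, toClosure_single, map_one, mul_assoc] at h2
    rw [h.toClosure_mul_charIdem hq hx] at h2
    obtain ⟨hgA, h3⟩ := mem_of_single_mul_charIdem_eq (card_subgroup_ne_zero hq A) h2
    rw [conjHom_apply, h.ker] at h3
    simpa using h3

lemma mem_charOrbit_of_eq (hq : (Nat.card F).Coprime (Nat.card G)) {D' : Subgroup G}
    {χ' : LinChar F A} (h : IsInertial A D χ) (h' : IsInertial A D' χ')
    (heq : conjugateSum (epsilon A D χ) = conjugateSum (epsilon A D' χ')) : χ' ∈ charOrbit χ := by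
  have h1 := congrArg (toClosure F G) heq
  rw [toClosure_conjugateSum_epsilon hq h.ker, toClosure_conjugateSum_epsilon hq h'.ker] at h1
  rw [charSum_inj hq (finite_charOrbit hq h.ker) (finite_charOrbit hq h'.ker) h1]
  exact self_mem_charOrbit χ'

lemma conjugateSum_eq_of_mem (hq : (Nat.card F).Coprime (Nat.card G)) {D' : Subgroup G}
    {χ' : LinChar F A} (h : IsInertial A D χ) (h' : IsInertial A D' χ')
    (hmem : χ' ∈ charOrbit χ) :
    conjugateSum (epsilon A D χ) = conjugateSum (epsilon A D' χ') := by
  refine toClosure_injective ?_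
  rw [toClosure_conjugateSum_epsilon hq h.ker, toClosure_conjugateSum_epsilon hq h'.ker,
    charOrbit_eq hq h.ker hmem]

end IsInertial

end Primitive

/-! ### Linear independence from a dual family -/

/-- The dual maps may take values in any space, so multiplications by idempotents can serve as well
as coefficient functionals. -/
lemma linearIndependent_of_dual {k ι V W : Type*} [Field k] [AddCommGroup V] [Module k V]
    [AddCommGroup W] [Module k W] {v : ι → V} (T : ι → V →ₗ[k] W)
    (hT : ∀ i j, i ≠ j → T i (v j) = 0) (hT' : ∀ i, T i (v i) ≠ 0) : LinearIndependent k v := by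
  classical
  refine linearIndependent_iff'.2 fun s c h i hi => ?_
  have h1 := congrArg (T i) h
  rw [map_sum, map_zero, Finset.sum_eq_single_of_mem i hi
    fun j _ hj => by rw [map_smul, hT i j hj.symm, smul_zero], map_smul] at h1
  exact (smul_eq_zero.1 h1).resolve_right (hT' i)

/-! ### Induced representations of linear characters -/

section Induced

variable {k : Type u} [Field k] {G : Type v} [Group G] {K : Subgroup G} (ψ : K →* kˣ)
  {W : Type*} [AddCommGroup W] [Module k W] (σ : Representation k G W)

lemma linearRep_apply (a : K) (c : k) : linearRep ψ a c = (ψ a : k) * c := rfl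

variable {ψ σ} in
/-- Frobenius reciprocity: an eigenvector of `K` gives a map from the induced representation. -/
lemma exists_intertwiningMap_ind {w : W} (hw : ∀ a : K, σ a w = (ψ a : k) • w) :
    ∃ f : Representation.IntertwiningMap (Representation.ind K.subtype (linearRep ψ)) σ,
      ∀ h c, f (Representation.IndV.mk K.subtype (linearRep ψ) h c) = c • σ h⁻¹ w := by
  refine ⟨⟨Representation.Coinvariants.lift _
    (TensorProduct.lift <| (Finsupp.lift _ _ _ fun h => σ h⁻¹ ∘ₗ LinearMap.toSpanSingleton k W w) ∘ₗ
      (MonoidAlgebra.coeffLinearEquiv k).toLinearMap) fun g => ?_, fun g => ?_⟩, fun h c => ?_⟩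
  · ext h
    have : σ (g : G)⁻¹ w = ((ψ g)⁻¹ : kˣ) • w := by
      have := hw g⁻¹
      simpa [Units.smul_def] using this
    simp [linearRep_apply, mul_inv_rev, this, Units.smul_def]
  · ext; simp
  · simp

lemma indV_mk_mul (a : K) (h : G) (c : k) :
    Representation.IndV.mk K.subtype (linearRep ψ) (a * h) ((ψ a : k) * c) =
      Representation.IndV.mk K.subtype (linearRep ψ) h c := by
  have := Representation.Coinvariants.mk_self_apply
    (Representation.tprod ((Representation.leftRegular k G).comp K.subtype) (linearRep ψ)) a
    (TensorProduct.tmul k (single h 1) c)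
  simpa [linearRep_apply] using this

lemma indV_mk_eq_smul (h : G) (c : k) :
    Representation.IndV.mk K.subtype (linearRep ψ) h c =
      c • Representation.IndV.mk K.subtype (linearRep ψ) h 1 := by
  rw [← map_smul, smul_eq_mul, mul_one]

/-- The induced representation is spanned by one vector for each coset. -/
lemma span_indV_mk_out_eq_top :
    Submodule.span k (Set.range fun x : G ⧸ K =>
      Representation.IndV.mk K.subtype (linearRep ψ) (Quotient.out x)⁻¹ 1) = ⊤ := by
  set S := Submodule.span k (Set.range fun x : G ⧸ K =>
      Representation.IndV.mk K.subtype (linearRep ψ) (Quotient.out x)⁻¹ 1)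
  have h1 : S.mkQ = 0 := by
    refine Representation.IndV.hom_ext _ _ fun h => LinearMap.ext fun c => ?_
    simp only [LinearMap.comp_apply, LinearMap.zero_apply, Submodule.mkQ_apply,
      Submodule.Quotient.mk_eq_zero]
    change Representation.IndV.mk K.subtype (linearRep ψ) h c ∈ S
    -- Up to a scalar the generator at h depends only on Kh, and the inverses of representatives of
    -- the cosets gK represent the cosets Kh.
    have h2 : h * Quotient.out (QuotientGroup.mk h⁻¹ : G ⧸ K) ∈ K := by
      have := (QuotientGroup.eq (s := K)).1 (QuotientGroup.out_eq' (QuotientGroup.mk h⁻¹ : G ⧸ K))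
      have := inv_mem this
      simpa using this
    have h3 := indV_mk_mul ψ ⟨_, h2⟩ (Quotient.out (QuotientGroup.mk h⁻¹ : G ⧸ K))⁻¹
      (((ψ ⟨_, h2⟩)⁻¹ : kˣ) * c)
    rw [mul_inv_cancel_right, Units.mul_inv_cancel_left] at h3
    rw [h3, indV_mk_eq_smul]
    exact S.smul_mem _ (Submodule.subset_span ⟨_, rfl⟩)
  rw [← S.ker_mkQ, h1, LinearMap.ker_zero]

lemma finiteDimensional_indV [Finite G] :
    FiniteDimensional k (Representation.IndV K.subtype (linearRep ψ)) :=
  ⟨⟨(Set.finite_range _).toFinset, by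
    rw [Set.Finite.coe_toFinset]; exact span_indV_mk_out_eq_top ψ⟩⟩

lemma finrank_indV_le [Finite G] :
    Module.finrank k (Representation.IndV K.subtype (linearRep ψ)) ≤ K.index := by
  have : Fintype (G ⧸ K) := Fintype.ofFinite _
  have h1 := finrank_range_le_card (R := k) (fun x : G ⧸ K =>
      Representation.IndV.mk K.subtype (linearRep ψ) (Quotient.out x)⁻¹ 1)
  rw [Set.finrank, span_indV_mk_out_eq_top, finrank_top] at h1
  rwa [Subgroup.index_eq_card, Nat.card_eq_fintype_card]

end Induced

/-! ### Eigenvectors in irreducible representations -/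

section Eigenvector

variable {k : Type u} [Field k] {G : Type v} [Group G]
  {V : Type*} [AddCommGroup V] [Module k V] {ρ : Representation k G V}

lemma eq_top_of_irreducible (hρ : ρ.IsIrreducible) {S : Submodule k V}
    (hS : ∀ g, ∀ v ∈ S, ρ g v ∈ S) (hne : S ≠ ⊥) : S = ⊤ := by
  rcases hρ.eq_bot_or_eq_top (⟨S, fun g v hv => hS g v hv⟩ : Subrepresentation ρ) with h | h
  · exact absurd (congrArg Subrepresentation.toSubmodule h) hne
  · exact congrArg Subrepresentation.toSubmodule h

lemma span_orbit_eq_top (hρ : ρ.IsIrreducible) {v : V} (hv : v ≠ 0) :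
    Submodule.span k (Set.range fun g => ρ g v) = ⊤ := by
  refine eq_top_of_irreducible hρ (fun g w hw => ?_) fun h => hv ?_
  · refine Submodule.span_induction (p := fun w _ => ρ g w ∈
      Submodule.span k (Set.range fun g => ρ g v)) ?_ ?_ ?_ ?_ hw
    · rintro _ ⟨h, rfl⟩
      exact Submodule.subset_span ⟨g * h, by simp⟩
    · simp
    · intro x y _ _ hx hy
      rw [map_add]; exact add_mem hx hy
    · intro c x _ hx
      rw [map_smul]; exact Submodule.smul_mem _ c hx
  · have : v ∈ Submodule.span k (Set.range fun g => ρ g v) :=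
      Submodule.subset_span ⟨1, by simp⟩
    rwa [h, Submodule.mem_bot] at this

lemma nontrivial_of_irreducible (hρ : ρ.IsIrreducible) : Nontrivial V := by
  by_contra h
  rw [not_nontrivial_iff_subsingleton] at h
  obtain ⟨a, b, hab⟩ := hρ.exists_pair_ne
  exact hab (Subrepresentation.toSubmodule_injective (Subsingleton.elim _ _))

lemma finiteDimensional_of_irreducible [Finite G] (hρ : ρ.IsIrreducible) :
    FiniteDimensional k V := by
  have := nontrivial_of_irreducible hρ
  obtain ⟨v, hv⟩ := exists_ne (0 : V)
  exact ⟨⟨(Set.finite_range _).toFinset, by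
    rw [Set.Finite.coe_toFinset]; exact span_orbit_eq_top hρ hv⟩⟩

variable {K : Subgroup G}

lemma span_out_eq_top (hρ : ρ.IsIrreducible) {ψ : K →* kˣ} {v : V} (hv : v ≠ 0)
    (h : ∀ a : K, ρ a v = (ψ a : k) • v) :
    Submodule.span k (Set.range fun x : G ⧸ K => ρ (Quotient.out x) v) = ⊤ := by
  rw [eq_top_iff, ← span_orbit_eq_top hρ hv, Submodule.span_le]
  rintro _ ⟨g, rfl⟩
  have h1 : (Quotient.out (QuotientGroup.mk g : G ⧸ K))⁻¹ * g ∈ K :=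
    (QuotientGroup.eq (s := K)).1 (QuotientGroup.out_eq' (QuotientGroup.mk g : G ⧸ K))
  have h2 : ρ g v = (ψ ⟨_, h1⟩ : k) • ρ (Quotient.out (QuotientGroup.mk g : G ⧸ K)) v := by
    rw [← map_smul, ← h ⟨_, h1⟩, ← Module.End.mul_apply, ← map_mul, mul_inv_cancel_left]
  change ρ g v ∈ _
  rw [h2]
  exact Submodule.smul_mem _ _ (Submodule.subset_span ⟨_, rfl⟩)

variable [Finite G]

lemma finrank_le_index (hρ : ρ.IsIrreducible) {ψ : K →* kˣ} {v : V} (hv : v ≠ 0)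
    (h : ∀ a : K, ρ a v = (ψ a : k) • v) : Module.finrank k V ≤ K.index := by
  have : Fintype (G ⧸ K) := Fintype.ofFinite _
  have h1 := finrank_range_le_card (R := k) (fun x : G ⧸ K => ρ (Quotient.out x) v)
  rw [Set.finrank, span_out_eq_top hρ hv h, finrank_top] at h1
  rwa [Subgroup.index_eq_card, Nat.card_eq_fintype_card]

/-- If the dimension is `[G : K]` then the map from the induced representation is bijective. -/
lemma exists_bijective_intertwiningMap_ind (hρ : ρ.IsIrreducible) {ψ : K →* kˣ} {v : V}
    (hv : v ≠ 0) (h : ∀ a : K, ρ a v = (ψ a : k) • v) (hdim : Module.finrank k V = K.index) :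
    ∃ f : Representation.IntertwiningMap (Representation.ind K.subtype (linearRep ψ)) ρ,
      Function.Bijective f ∧ f (Representation.IndV.mk K.subtype (linearRep ψ) 1 1) = v := by
  obtain ⟨f, hf⟩ := exists_intertwiningMap_ind h
  have hfd := finiteDimensional_of_irreducible hρ
  have hfd' := finiteDimensional_indV ψ
  have hsurj : Function.Surjective f.toLinearMap := by
    rw [← LinearMap.range_eq_top, eq_top_iff, ← span_orbit_eq_top hρ hv, Submodule.span_le]
    rintro _ ⟨g, rfl⟩
    exact ⟨Representation.IndV.mk K.subtype (linearRep ψ) g⁻¹ 1, by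
      rw [Representation.IntertwiningMap.toLinearMap_apply, hf]; simp⟩
  have hle : Module.finrank k (Representation.IndV K.subtype (linearRep ψ)) =
      Module.finrank k V :=
    le_antisymm (hdim ▸ finrank_indV_le ψ) (LinearMap.finrank_le_finrank_of_surjective hsurj)
  have hinj := (LinearMap.injective_iff_surjective_of_finrank_eq_finrank hle).2 hsurj
  exact ⟨f, ⟨hinj, hsurj⟩, by rw [hf]; simp⟩

lemma nonempty_equiv_ind (hρ : ρ.IsIrreducible) {ψ : K →* kˣ} {v : V}
    (hv : v ≠ 0) (h : ∀ a : K, ρ a v = (ψ a : k) • v) (hdim : Module.finrank k V = K.index) :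
    Nonempty (Representation.Equiv ρ (Representation.ind K.subtype (linearRep ψ))) := by
  obtain ⟨f, hf, -⟩ := exists_bijective_intertwiningMap_ind hρ hv h hdim
  exact ⟨(f.ofBijective hf).symm⟩

/-- If the dimension is `[G : K]` then a second eigenvector for the same character is a multiple
of the first, by Schur's lemma. -/
lemma exists_eq_smul_of_finrank_eq [IsAlgClosed k] (hρ : ρ.IsIrreducible) {ψ : K →* kˣ} {v w : V}
    (hv : v ≠ 0) (h : ∀ a : K, ρ a v = (ψ a : k) • v) (hw : ∀ a : K, ρ a w = (ψ a : k) • w)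
    (hdim : Module.finrank k V = K.index) : ∃ c : k, w = c • v := by
  have hfd := finiteDimensional_of_irreducible hρ
  obtain ⟨f, hf, hfv⟩ := exists_bijective_intertwiningMap_ind hρ hv h hdim
  obtain ⟨f', hf'⟩ := exists_intertwiningMap_ind hw
  have := hρ
  let T := f'.comp (f.ofBijective hf).symm.toIntertwiningMap
  obtain ⟨c, hc⟩ := (Representation.IsIrreducible.algebraMap_intertwiningMap_bijective_of_isAlgClosed
    (ρ := ρ)).2 T
  refine ⟨c, ?_⟩
  have h1 : T v = w := by
    have h2 : (f.ofBijective hf).symm v = Representation.IndV.mk K.subtype (linearRep ψ) 1 1 := by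
      rw [← hfv]
      exact (f.ofBijective hf).symm_apply_apply _
    change f' ((f.ofBijective hf).symm v) = w
    rw [h2, hf']; simp
  rw [← h1, ← hc]
  rfl

/-- By Schur's lemma `ρ g v` is a multiple of `v`. The translates of `v` by coset representatives
span and number dim V, so they are a basis, and proportional translates come from the same coset. -/
lemma mem_of_finrank_eq [IsAlgClosed k] (hρ : ρ.IsIrreducible) {ψ : K →* kˣ} {v : V}
    (hv : v ≠ 0) (h : ∀ a : K, ρ a v = (ψ a : k) • v) (hdim : Module.finrank k V = K.index)
    {g : G} (hg : ∀ a : K, ρ a (ρ g v) = (ψ a : k) • ρ g v) : g ∈ K := by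
  have : Fintype (G ⧸ K) := Fintype.ofFinite _
  obtain ⟨c, hc⟩ := exists_eq_smul_of_finrank_eq hρ hv h hg hdim
  have hli : LinearIndependent k fun x : G ⧸ K => ρ (Quotient.out x) v :=
    linearIndependent_of_top_le_span_of_card_eq_finrank (span_out_eq_top hρ hv h).ge
      (by rw [hdim, Subgroup.index_eq_card, Nat.card_eq_fintype_card])
  have hout : ∀ g : G, ∃ c : k, c ≠ 0 ∧
      ρ g v = c • ρ (Quotient.out (QuotientGroup.mk g : G ⧸ K)) v := fun g => by
    have h1 : (Quotient.out (QuotientGroup.mk g : G ⧸ K))⁻¹ * g ∈ K :=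
      (QuotientGroup.eq (s := K)).1 (QuotientGroup.out_eq' (QuotientGroup.mk g : G ⧸ K))
    refine ⟨ψ ⟨_, h1⟩, Units.ne_zero _, ?_⟩
    rw [← map_smul, ← h ⟨_, h1⟩, ← Module.End.mul_apply, ← map_mul, mul_inv_cancel_left]
  obtain ⟨c₁, hc₁, h1⟩ := hout g
  obtain ⟨c₂, hc₂, h2⟩ := hout 1
  by_contra hgK
  have hne : (QuotientGroup.mk g : G ⧸ K) ≠ QuotientGroup.mk 1 := fun heq => hgK (by
    simpa using (QuotientGroup.eq (s := K)).1 heq.symm)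
  rw [map_one, Module.End.one_apply] at h2
  have h3 : c₁ • ρ (Quotient.out (QuotientGroup.mk g : G ⧸ K)) v =
      (c * c₂) • ρ (Quotient.out (QuotientGroup.mk 1 : G ⧸ K)) v := by
    rw [← h1, hc, mul_smul, ← h2]
  exact hne (hli.eq_of_smul_apply_eq_smul_apply _ _ _ _ hc₁ h3)

end Eigenvector

/-! ### Character idempotents acting on representations -/

section CharIdemRep

variable {F : Type u} [Field F] [Finite F] {G : Type v} [Group G] [Finite G]
variable {A : Subgroup G} {χ : LinChar F A}
  {V : Type*} [AddCommGroup V] [Module (AlgebraicClosure F) V]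
  {ρ : Representation (AlgebraicClosure F) G V}

lemma apply_asAlgebraHom_charIdem (a : A) (v : V) :
    ρ a (ρ.asAlgebraHom (charIdem χ) v) =
      (χ a : AlgebraicClosure F) • ρ.asAlgebraHom (charIdem χ) v := by
  rw [← ρ.asAlgebraHom_of, ← Module.End.mul_apply, ← map_mul, of_apply, single_mul_charIdem,
    map_smul, LinearMap.smul_apply]

lemma asAlgebraHom_charIdem_of_eigenvector (hq : (Nat.card F).Coprime (Nat.card G)) {v : V}
    (h : ∀ a : A, ρ a v = (χ a : AlgebraicClosure F) • v) :
    ρ.asAlgebraHom (charIdem χ) v = v := by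
  cases nonempty_fintype A
  have h1 : ∀ a : A, ρ.asAlgebraHom (single ((a : G)⁻¹)
      ((Nat.card A : AlgebraicClosure F)⁻¹ * (χ a : AlgebraicClosure F))) v =
        (Nat.card A : AlgebraicClosure F)⁻¹ • v := fun a => by
    have h2 := h a⁻¹
    rw [Subgroup.coe_inv] at h2
    rw [ρ.asAlgebraHom_single, LinearMap.smul_apply, h2, smul_smul]
    simp
  simp only [charIdem, finsum_eq_sum_of_fintype, map_sum, LinearMap.sum_apply, h1]
  rw [Finset.sum_const, Finset.card_univ, ← Nat.card_eq_fintype_card,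
    ← Nat.cast_smul_eq_nsmul (AlgebraicClosure F), smul_smul,
    mul_inv_cancel₀ (card_subgroup_ne_zero hq A), one_smul]

/-- If the inertia group of `χ` is `A` then an irreducible representation with a `χ`-eigenvector
has dimension `[G : A]`. -/
lemma finrank_eq_index_of_inertia [A.Normal] (hq : (Nat.card F).Coprime (Nat.card G))
    (hχ : ∀ g, conjHom g χ = χ → g ∈ A) (hρ : ρ.IsIrreducible) {v : V} (hv : v ≠ 0)
    (h : ∀ a : A, ρ a v = (χ a : AlgebraicClosure F) • v) :
    Module.finrank (AlgebraicClosure F) V = A.index := by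
  refine le_antisymm (finrank_le_index hρ hv h) ?_
  have : Fintype (G ⧸ A) := Fintype.ofFinite _
  have hfd := finiteDimensional_of_irreducible hρ
  have hli : LinearIndependent (AlgebraicClosure F) fun x : G ⧸ A => ρ (Quotient.out x) v := by
    -- The operator of e_χ x⁻¹ sends x v to v and, by the inertia condition, kills y v when y lies
    -- in another coset.
    refine linearIndependent_of_dual
      (fun x => ρ.asAlgebraHom (charIdem χ * single (Quotient.out x)⁻¹ 1)) ?_ fun x => ?_
    · intro x y hxy
      have hne : conjHom ((Quotient.out x)⁻¹ * Quotient.out y) χ ≠ χ := fun h' => hxy (by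
        have := (QuotientGroup.eq (s := A)).2 (hχ _ h')
        rwa [QuotientGroup.out_eq', QuotientGroup.out_eq'] at this)
      conv_lhs => rw [← asAlgebraHom_charIdem_of_eigenvector hq h]
      rw [← ρ.asAlgebraHom_of, ← Module.End.mul_apply, ← Module.End.mul_apply, ← map_mul,
        ← map_mul, of_apply, mul_assoc, mul_assoc, ← mul_assoc (single _ _), single_mul_single,
        ← mul_assoc, mul_one, charIdem_mul_single_mul_charIdem hne, map_zero, LinearMap.zero_apply]
    · rw [← ρ.asAlgebraHom_of, ← Module.End.mul_apply, ← map_mul, of_apply, mul_assoc,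
        single_mul_single, inv_mul_cancel, mul_one, ← one_def, mul_one,
        asAlgebraHom_charIdem_of_eigenvector hq h]
      exact hv
  rw [Subgroup.index_eq_card, Nat.card_eq_fintype_card]
  exact hli.fintype_card_le_finrank

/-- The left regular representation. -/
def mulLeftRep (F : Type u) [Field F] (G : Type v) [Group G] :
    Representation (AlgebraicClosure F) G (MonoidAlgebra (AlgebraicClosure F) G) :=
  (Algebra.lmul (AlgebraicClosure F) (MonoidAlgebra (AlgebraicClosure F) G)).toMonoidHom.comp
    (of (AlgebraicClosure F) G)

/-- The generating eigenvector of an induced representation, and the map to the group algebra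
that sends it to `e_χ`. -/
lemma exists_of_equiv_ind
    (e : Representation.Equiv ρ (Representation.ind A.subtype (linearRep χ))) :
    ∃ v : V, (∀ a : A, ρ a v = (χ a : AlgebraicClosure F) • v) ∧
      ∃ f : V →ₗ[AlgebraicClosure F] MonoidAlgebra (AlgebraicClosure F) G,
        f v = charIdem χ ∧ ∀ g w, f (ρ g w) = single g 1 * f w := by
  obtain ⟨f, hf⟩ := exists_intertwiningMap_ind (σ := mulLeftRep F G) (ψ := χ) (w := charIdem χ)
    fun a => single_mul_charIdem χ a
  refine ⟨e.symm (Representation.IndV.mk A.subtype (linearRep χ) 1 1), fun a => ?_,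
    (f.comp e.toIntertwiningMap).toLinearMap, ?_, fun g w => ?_⟩
  · have h1 : Representation.ind A.subtype (linearRep χ) a
        (Representation.IndV.mk A.subtype (linearRep χ) 1 1) =
        (χ a : AlgebraicClosure F) • Representation.IndV.mk A.subtype (linearRep χ) 1 1 := by
      rw [Representation.ind_mk, one_mul]
      have := indV_mk_mul χ a⁻¹ 1 (χ a : AlgebraicClosure F)
      rw [mul_one, map_inv, Units.inv_mul, Subgroup.coe_inv] at this
      rw [this, indV_mk_eq_smul]
    rw [← map_smul, ← h1]
    exact (Representation.IntertwiningMap.isIntertwining _ _ e.symm.toIntertwiningMap (a : G) _).symm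
  · change f (e (e.symm _)) = _
    rw [e.apply_symm_apply, hf]
    simp
  · exact Representation.IntertwiningMap.isIntertwining _ _ (f.comp e.toIntertwiningMap) g w

/-- On a minimal nonzero subspace stable under all the operators, an eigenspace of any one of them
is again stable by commutativity, so it is everything. Each nonzero vector of that subspace then
works. -/
lemma exists_common_eigenvector {k V ι : Type*} [Field k] [IsAlgClosed k] [AddCommGroup V]
    [Module k V] [FiniteDimensional k V] [Nontrivial V] (T : ι → Module.End k V)
    (hT : ∀ i j, T i * T j = T j * T i) : ∃ v : V, v ≠ 0 ∧ ∀ i, ∃ c : k, T i v = c • v := by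
  obtain ⟨W, hW⟩ := exists_minimal_of_wellFoundedLT
    (fun W : Submodule k V => W ≠ ⊥ ∧ ∀ i, ∀ w ∈ W, T i w ∈ W) ⟨⊤, top_ne_bot, by simp⟩
  obtain ⟨⟨hne, hinv⟩, hmin⟩ := hW
  obtain ⟨w, hw, hw0⟩ := W.ne_bot_iff.1 hne
  refine ⟨w, hw0, fun i => ?_⟩
  have : Nontrivial W := Submodule.nontrivial_iff_ne_bot.2 hne
  obtain ⟨c, hc⟩ := Module.End.exists_eigenvalue ((T i).restrict (hinv i))
  obtain ⟨x, hx⟩ := hc.exists_hasEigenvector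
  refine ⟨c, ?_⟩
  have hle := hmin (y := W ⊓ Module.End.eigenspace (T i) c) ⟨?_, ?_⟩ inf_le_left
  · exact Module.End.mem_eigenspace_iff.1 (hle hw).2
  · refine (Submodule.ne_bot_iff _).2 ⟨x, ⟨x.2, ?_⟩, fun h => hx.2 (Subtype.ext h)⟩
    have := congrArg Subtype.val hx.apply_eq_smul
    exact Module.End.mem_eigenspace_iff.2 this
  · rintro j y ⟨hy, hy'⟩
    refine ⟨hinv j y hy, Module.End.mem_eigenspace_iff.2 ?_⟩
    rw [← Module.End.mul_apply, hT, Module.End.mul_apply, Module.End.mem_eigenspace_iff.1 hy',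
      map_smul]

/-- A subgroup that acts through commuting operators has an eigenvector. -/
lemma exists_eigenvector_of_commute (hρ : ρ.IsIrreducible)
    (hcomm : ∀ a b : A, ρ a * ρ b = ρ b * ρ a) :
    ∃ (χ : LinChar F A) (v : V), v ≠ 0 ∧ ∀ a : A, ρ a v = (χ a : AlgebraicClosure F) • v := by
  have := nontrivial_of_irreducible hρ
  have := finiteDimensional_of_irreducible hρ
  obtain ⟨v, hv, h⟩ := exists_common_eigenvector (fun a : A => ρ a) hcomm
  choose c hc using h
  let μ : A →* AlgebraicClosure F :=
    { toFun := c
      map_one' := by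
        have h1 := hc 1
        rw [OneMemClass.coe_one, map_one, Module.End.one_apply] at h1
        exact (smul_left_injective _ hv (by simpa using h1)).symm
      map_mul' := fun a b => by
        refine smul_left_injective _ hv ?_
        change c (a * b) • v = (c a * c b) • v
        rw [← hc, Subgroup.coe_mul, map_mul, Module.End.mul_apply, hc, map_smul, hc, smul_smul,
          mul_comm] }
  exact ⟨μ.toHomUnits, v, hv, hc⟩

end CharIdemRep

/-! ### Primitive central idempotents of products -/

section Product

lemma IsCentralIdempotent.map {R : Type*} {S : Type*} [Ring R] [Ring S] (φ : R ≃+* S) {e : R}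
    (h : IsCentralIdempotent e) : IsCentralIdempotent (φ e) := by
  refine ⟨Subring.mem_center_iff.2 fun y => ?_, h.2.map φ⟩
  obtain ⟨x, rfl⟩ := φ.surjective y
  rw [← map_mul, ← map_mul, Subring.mem_center_iff.1 h.1]

lemma IsPrimitiveCentralIdempotent.map {R : Type*} {S : Type*} [Ring R] [Ring S] (φ : R ≃+* S)
    {e : R} (h : IsPrimitiveCentralIdempotent e) : IsPrimitiveCentralIdempotent (φ e) := by
  refine ⟨h.1.map φ, fun h0 => h.2.1 (φ.injective (by rw [h0, map_zero])),
    fun e₁ e₂ h₁ h₂ h₁₂ hs => ?_⟩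
  have := h.2.2 _ _ (h₁.map φ.symm) (h₂.map φ.symm) (by rw [← map_mul, h₁₂, map_zero])
    (by rw [← map_add, hs, φ.symm_apply_apply])
  simpa using this

lemma isCentralIdempotent_eq_zero_or_one {S : Type*} [Ring S] [IsSimpleRing S] {z : S}
    (hz : IsCentralIdempotent z) : z = 0 ∨ z = 1 := by
  let w : Subring.center S := ⟨z, hz.1⟩
  have hw : w * w = w := Subtype.ext hz.2
  by_cases h0 : w = 0
  · exact Or.inl (congrArg Subtype.val h0)
  · right
    obtain ⟨y, hy⟩ := (IsSimpleRing.isField_center S).mul_inv_cancel h0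
    have : w = 1 := by
      calc w = w * (w * y) := by rw [hy, mul_one]
        _ = 1 := by rw [← mul_assoc, hw, hy]
    exact congrArg Subtype.val this

variable {ι : Type*} [DecidableEq ι] {S : ι → Type*} [∀ i, Ring (S i)] [∀ i, IsSimpleRing (S i)]

lemma isCentralIdempotent_pi_iff {e : ∀ i, S i} :
    IsCentralIdempotent e ↔ ∀ i, IsCentralIdempotent (e i) := by
  constructor
  · intro h i
    refine ⟨Subring.mem_center_iff.2 fun y => ?_, congrFun h.2 i⟩
    simpa using congrFun (Subring.mem_center_iff.1 h.1 (Pi.single i y)) i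
  · intro h
    exact ⟨Subring.mem_center_iff.2 fun y => funext fun i => Subring.mem_center_iff.1 (h i).1 (y i),
      funext fun i => (h i).2⟩

lemma isCentralIdempotent_zero {R : Type*} [Ring R] : IsCentralIdempotent (0 : R) :=
  ⟨zero_mem _, mul_zero 0⟩

lemma isCentralIdempotent_one {R : Type*} [Ring R] : IsCentralIdempotent (1 : R) :=
  ⟨one_mem _, mul_one 1⟩

lemma isCentralIdempotent_pi_single (i : ι) :
    IsCentralIdempotent (Pi.single i 1 : ∀ i, S i) := by
  refine isCentralIdempotent_pi_iff.2 fun j => ?_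
  by_cases h : j = i
  · subst h; rw [Pi.single_eq_same]; exact isCentralIdempotent_one
  · rw [Pi.single_eq_of_ne h]; exact isCentralIdempotent_zero

/-- The primitive central idempotents of a product of simple rings. -/
lemma isPrimitiveCentralIdempotent_pi_iff {e : ∀ i, S i} :
    IsPrimitiveCentralIdempotent e ↔ ∃ i, e = Pi.single i 1 := by
  constructor
  · rintro ⟨he, hne, hprim⟩
    obtain ⟨i, hi⟩ : ∃ i, e i ≠ 0 := by
      by_contra! h; exact hne (funext h)
    have hi1 : e i = 1 :=
      (isCentralIdempotent_eq_zero_or_one (isCentralIdempotent_pi_iff.1 he i)).resolve_left hi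
    refine ⟨i, ?_⟩
    have h2 : IsCentralIdempotent (Function.update e i 0) := by
      refine isCentralIdempotent_pi_iff.2 fun j => ?_
      by_cases h : j = i
      · subst h; rw [Function.update_self]; exact isCentralIdempotent_zero
      · rw [Function.update_of_ne h]; exact isCentralIdempotent_pi_iff.1 he j
    have hsum : (Pi.single i 1 : ∀ i, S i) + Function.update e i 0 = e := by
      funext j
      by_cases h : j = i
      · subst h; simp [hi1]
      · simp [Pi.single_eq_of_ne h, Function.update_of_ne h]
    have hmul : (Pi.single i 1 : ∀ i, S i) * Function.update e i 0 = 0 := by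
      funext j
      by_cases h : j = i
      · subst h; simp
      · simp [Pi.single_eq_of_ne h]
    rcases hprim _ _ (isCentralIdempotent_pi_single i) h2 hmul hsum with h | h
    · exact absurd (congrFun h i) (by simp)
    · rw [h, add_zero] at hsum
      exact hsum.symm
  · rintro ⟨i, rfl⟩
    refine ⟨isCentralIdempotent_pi_single i, fun h => by simpa using congrFun h i, ?_⟩
    intro e₁ e₂ h₁ h₂ h₁₂ hs
    have hz : ∀ j ≠ i, e₁ j = 0 ∧ e₂ j = 0 := fun j hj => by
      have hsj : e₁ j + e₂ j = 0 := by
        rw [← Pi.add_apply, hs, Pi.single_eq_of_ne hj]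
      have h1 : e₁ j * e₁ j = e₁ j := congrFun h₁.2 j
      have h3 : e₁ j * e₂ j = 0 := congrFun h₁₂ j
      have h4 : e₁ j = 0 := by
        have h5 : e₁ j * (e₁ j + e₂ j) = 0 := by rw [hsj, mul_zero]
        rwa [mul_add, h1, h3, add_zero] at h5
      exact ⟨h4, by rwa [h4, zero_add] at hsj⟩
    rcases isCentralIdempotent_eq_zero_or_one (isCentralIdempotent_pi_iff.1 h₁ i) with h | h
    · left
      funext j
      by_cases hj : j = i
      · subst hj; exact h
      · exact (hz j hj).1
    · right
      funext j
      by_cases hj : j = i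
      · subst hj
        have h3 : e₁ j * e₂ j = 0 := congrFun h₁₂ j
        rwa [h, one_mul] at h3
      · exact (hz j hj).2

end Product

/-! ### Irreducible representations and normally monomial groups -/

section Irreducible

lemma isIrreducible_of_forall {k : Type*} [Field k] {G : Type*} [Group G] {V : Type*}
    [AddCommGroup V] [Module k V] [Nontrivial V] {ρ : Representation k G V}
    (h : ∀ S : Submodule k V, (∀ g, ∀ v ∈ S, ρ g v ∈ S) → S = ⊥ ∨ S = ⊤) : ρ.IsIrreducible where
  exists_pair_ne := ⟨⊥, ⊤, fun h' =>
    bot_ne_top (congrArg Subrepresentation.toSubmodule h' : (⊥ : Submodule k V) = ⊤)⟩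
  eq_bot_or_eq_top S := (h S.toSubmodule fun g _ hv => S.apply_mem_toSubmodule g hv).imp
    (fun h => Subrepresentation.toSubmodule_injective h)
    (fun h => Subrepresentation.toSubmodule_injective h)

variable {F : Type u} [Field F] [Finite F] {G : Type v} [Group G] [Finite G]

/-- A nonzero central idempotent acts as the identity on some irreducible representation. -/
lemma exists_irreducible_of_isCentralIdempotent {f : MonoidAlgebra (AlgebraicClosure F) G}
    (hf : IsCentralIdempotent f) (hne : f ≠ 0) :
    ∃ (V : Type u) (_ : AddCommGroup V) (_ : Module (AlgebraicClosure F) V)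
      (ρ : Representation (AlgebraicClosure F) G V), ρ.IsIrreducible ∧ ρ.asAlgebraHom f = 1 := by
  set k := AlgebraicClosure F
  have hfd : FiniteDimensional k (MonoidAlgebra k G) :=
    Module.Finite.equiv (coeffLinearEquiv (S := k) (M := G) k).symm
  -- A minimal nonzero left ideal inside f k[G] is an irreducible representation on which f is the
  -- identity.
  obtain ⟨W, ⟨hWne, hinv, hfW⟩, hmin⟩ := exists_minimal_of_wellFoundedLT
    (fun W : Submodule k (MonoidAlgebra k G) => W ≠ ⊥ ∧ (∀ g : G, ∀ w ∈ W, single g 1 * w ∈ W) ∧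
      ∀ w ∈ W, f * w = w)
    ⟨LinearMap.range (LinearMap.mulLeft k f), fun h => hne (by
        have := LinearMap.range_eq_bot.1 h
        simpa using DFunLike.congr_fun this 1), by
      rintro g _ ⟨w, rfl⟩
      refine ⟨single g 1 * w, ?_⟩
      simp only [LinearMap.mulLeft_apply]
      rw [← mul_assoc, ← mul_assoc, Subring.mem_center_iff.1 hf.1], by
      rintro _ ⟨w, rfl⟩
      simp only [LinearMap.mulLeft_apply]
      rw [← mul_assoc, hf.2.eq]⟩
  have hWnt : Nontrivial W := Submodule.nontrivial_iff_ne_bot.2 hWne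
  let σ : Representation k G W :=
    { toFun := fun g => (mulLeftRep F G g).restrict (hinv g)
      map_one' := by ext w : 2; exact congrArg (fun T => T w.1) (map_one (mulLeftRep F G))
      map_mul' := fun g h => by
        ext w : 2; exact congrArg (fun T => T w.1) (map_mul (mulLeftRep F G) g h) }
  -- The ideal lives in the universe of k[G], whereas `IsNormallyMonomial` speaks of spaces in the
  -- universe of k. Coordinates move the representation there.
  let e := Module.finBasis k W |>.equivFun
  let ρ : Representation k G (Fin (Module.finrank k W) → k) :=
    (e.conjAlgEquiv k).toMulEquiv.toMonoidHom.comp σ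
  have hρ : ∀ g w, ρ g (e w) = e (σ g w) := fun g w => by
    change e (σ g (e.symm (e w))) = _
    rw [e.symm_apply_apply]
  have hσ : ∀ (x : MonoidAlgebra k G) (w : W), (ρ.asAlgebraHom x (e w)) =
      e (σ.asAlgebraHom x w) := fun x w => by
    induction x using MonoidAlgebra.induction_linear with
    | zero => simp
    | add x y hx hy => simp only [map_add, LinearMap.add_apply, hx, hy]
    | single g r => simp only [Representation.asAlgebraHom_single, LinearMap.smul_apply, hρ, map_smul]
  have hσ' : ∀ (x : MonoidAlgebra k G) (w : W),
      ((σ.asAlgebraHom x w : W) : MonoidAlgebra k G) = x * w := fun x w => by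
    induction x using MonoidAlgebra.induction_linear with
    | zero => simp
    | add x y hx hy => simp only [map_add, LinearMap.add_apply, add_mul, Submodule.coe_add, hx, hy]
    | single g r =>
      have h1 : (single g r : MonoidAlgebra k G) = r • single g 1 := by simp
      rw [h1, map_smul, LinearMap.smul_apply, Submodule.coe_smul, smul_mul_assoc,
        Representation.asAlgebraHom_single, one_smul]
      rfl
  have hnt : Nontrivial (Fin (Module.finrank k W) → k) := e.symm.toEquiv.nontrivial
  refine ⟨_, _, _, ρ, isIrreducible_of_forall fun S hS => ?_, ?_⟩
  · by_cases hS0 : S = ⊥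
    · exact Or.inl hS0
    · right
      have hle := hmin (y := (S.comap e.toLinearMap).map W.subtype) ⟨?_, ?_, ?_⟩ ?_
      · refine eq_top_iff.2 fun y _ => ?_
        obtain ⟨w, rfl⟩ := e.surjective y
        obtain ⟨w', hw', h'⟩ := hle w.2
        have : w' = w := Subtype.ext h'
        exact this ▸ hw'
      · obtain ⟨y, hy, hy0⟩ := S.ne_bot_iff.1 hS0
        refine (Submodule.ne_bot_iff _).2 ⟨e.symm y, ⟨e.symm y, ?_, rfl⟩, fun h => hy0 ?_⟩
        · simpa using hy
        · have : e.symm y = 0 := Subtype.ext h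
          simpa using this
      · rintro g _ ⟨w, hw, rfl⟩
        refine ⟨σ g w, ?_, rfl⟩
        have := hS g _ hw
        change ρ g (e w) ∈ S at this
        rw [hρ] at this
        exact this
      · rintro _ ⟨w, hw, rfl⟩
        exact hfW _ w.2
      · rintro _ ⟨w, hw, rfl⟩
        exact w.2
  · refine LinearMap.ext fun y => ?_
    obtain ⟨w, rfl⟩ := e.surjective y
    rw [hσ, Module.End.one_apply]
    congr 1
    exact Subtype.ext ((hσ' f w).trans (hfW w w.2))

end Irreducible

/-! ### Admissible choices -/

section Admissible

variable {G : Type v} [Group G] [Finite G]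
  {A : Subgroup G → Subgroup G} {T : Subgroup G → Set (Subgroup G)}

namespace IsAdmissibleChoice

lemma comap_map_eq (h : IsAdmissibleChoice A T) (N : Subgroup G) [N.Normal] :
    ((A N).map (QuotientGroup.mk' N)).comap (QuotientGroup.mk' N) = A N :=
  Subgroup.comap_map_eq_self (by rw [QuotientGroup.ker_mk']; exact (h N).1)

lemma normal (h : IsAdmissibleChoice A T) (N : Subgroup G) [N.Normal] : (A N).Normal := by
  rw [← h.comap_map_eq N]
  exact (h N).2.1.1.comap _

lemma commutator_mem (h : IsAdmissibleChoice A T) (N : Subgroup G) [N.Normal] :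
    ∀ a ∈ A N, ∀ b ∈ A N, a * b * a⁻¹ * b⁻¹ ∈ N := fun a ha b hb => by
  have hc := (h N).2.1.2.1.is_comm.comm
    (⟨_, Subgroup.mem_map_of_mem (QuotientGroup.mk' N) ha⟩ :
      (A N).map (QuotientGroup.mk' N)) ⟨_, Subgroup.mem_map_of_mem (QuotientGroup.mk' N) hb⟩
  have hc' : QuotientGroup.mk' N a * QuotientGroup.mk' N b =
      QuotientGroup.mk' N b * QuotientGroup.mk' N a := congrArg Subtype.val hc
  rw [← QuotientGroup.ker_mk' N, MonoidHom.mem_ker, map_mul, map_mul, map_mul, hc', map_inv,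
    map_inv, mul_inv_cancel_right, mul_inv_cancel]

lemma index_le (h : IsAdmissibleChoice A T) (N : Subgroup G) [N.Normal] {K : Subgroup G}
    (hK : K.Normal) (hNK : N ≤ K) (hc : ∀ a ∈ K, ∀ b ∈ K, a * b * a⁻¹ * b⁻¹ ∈ N) :
    (A N).index ≤ K.index := by
  have hsurj := QuotientGroup.mk'_surjective N
  have h1 := (h N).2.1.2.2 (K.map (QuotientGroup.mk' N)) (hK.map _ hsurj) ⟨⟨by
    rintro ⟨_, a, ha, rfl⟩ ⟨_, b, hb, rfl⟩
    refine Subtype.ext ?_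
    have h2 := hc a ha b hb
    rw [← QuotientGroup.ker_mk' N, MonoidHom.mem_ker, map_mul, map_mul, map_mul, map_inv,
      map_inv, mul_inv_eq_one, mul_inv_eq_iff_eq_mul] at h2
    exact h2⟩⟩
  have h3 := Subgroup.card_mul_index ((A N).map (QuotientGroup.mk' N))
  have h4 := Subgroup.card_mul_index (K.map (QuotientGroup.mk' N))
  rw [Subgroup.index_map_eq _ hsurj (by rw [QuotientGroup.ker_mk']; exact (h N).1)] at h3
  rw [Subgroup.index_map_eq _ hsurj (by rw [QuotientGroup.ker_mk']; exact hNK)] at h4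
  by_contra! hlt
  have h5 : Nat.card (K.map (QuotientGroup.mk' N)) * K.index <
      Nat.card ((A N).map (QuotientGroup.mk' N)) * (A N).index :=
    Nat.mul_lt_mul_of_le_of_lt h1 hlt Nat.card_pos
  omega

end IsAdmissibleChoice

end Admissible

/-! ### The characters attached to the pairs -/

section Pairs

variable {F : Type u} [Field F] [Finite F] {G : Type v} [Group G] [Finite G]
  {A : Subgroup G → Subgroup G} {T : Subgroup G → Set (Subgroup G)}

lemma map_conj_inv_eq {D : Subgroup G} {g : G} (hg : g ∈ Subgroup.normalizer (D : Set G)) :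
    D.map (MulAut.conj g⁻¹).toMonoidHom = D := by
  have hg' := inv_mem hg
  ext x
  rw [Subgroup.mem_map]
  constructor
  · rintro ⟨y, hy, rfl⟩
    exact (Subgroup.mem_normalizer_iff.1 hg' y).1 hy
  · intro hx
    exact ⟨g * x * g⁻¹, (Subgroup.mem_normalizer_iff.1 hg x).1 hx, by simp [mul_assoc]⟩

/-- The members of `𝒞(A/D)` are the cyclotomic cosets of the characters with kernel `D`. -/
lemma mem_of_mem_coset_of_mem_orbit (hq : (Nat.card F).Coprime (Nat.card G)) {B D : Subgroup G}
    [B.Normal] {χ ψ : LinChar F B} (h : IsInertial B D χ) {C : Set (LinChar F B)}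
    (hC : C ∈ cosetOrbit F B D (cyclotomicCoset F B D χ)) (hψ : ψ ∈ C) :
    IsInertial B D ψ ∧ ψ ∈ charOrbit χ := by
  obtain ⟨⟨g, hg⟩, hgD, rfl⟩ := hC
  obtain ⟨_, hφ, rfl⟩ := hψ
  obtain ⟨i, rfl⟩ := (mem_cyclotomicCoset_iff hq h.ker).1 hφ
  refine ⟨?_, g, i, rfl⟩
  have h1 := (h.pow i).conj g
  rwa [map_conj_inv_eq hgD] at h1

lemma self_mem_cyclotomicCoset (hq : (Nat.card F).Coprime (Nat.card G)) {B D : Subgroup G}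
    {χ : LinChar F B} (hker : ∀ a : B, χ a = 1 ↔ (a : G) ∈ D) : χ ∈ cyclotomicCoset F B D χ := by
  refine (mem_cyclotomicCoset_iff hq hker).2 ⟨0, ?_⟩
  ext a; simp

lemma self_mem_cosetOrbit {B D : Subgroup G} (C : Set (LinChar F B)) : C ∈ cosetOrbit F B D C := by
  refine ⟨1, one_mem _, ?_⟩
  have : (conjChar (1 : Subgroup.normalizer (B : Set G)) : LinChar F B → _) = id :=
    funext (conjChar_one F)
  exact (Set.image_id C).symm.trans (congrArg (· '' C) this).symm

lemma isInertial_of_zpowers_eq (hq : (Nat.card F).Coprime (Nat.card G))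
    (hAT : IsAdmissibleChoice A T) {N D : Subgroup G} [N.Normal] [(A N).Normal] (hD : D ∈ T N)
    {χ : LinChar F (A N)} (hχ : Subgroup.zpowers χ = irrQuotient F (A N) D) :
    IsInertial (A N) D χ :=
  isInertial_of_mem_kernelSet hq ((hAT N).2.2.1 hD) (hAT.commutator_mem N) hχ

/-- Cosets and orbits can be forgotten when describing E: conjugation by N_G(D) and Frobenius both
preserve being inertial with kernel D. -/
lemma mem_idempotentSet_iff (hq : (Nat.card F).Coprime (Nat.card G))
    (hAT : IsAdmissibleChoice A T) {e : MonoidAlgebra F G} :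
    e ∈ idempotentSet F (pairSet A T) ↔ ∃ (N : Subgroup G) (_ : N.Normal) (_ : (A N).Normal)
      (D : Subgroup G) (χ : LinChar F (A N)), D ∈ T N ∧ IsInertial (A N) D χ ∧
        e = conjugateSum (epsilon (A N) D χ) := by
  constructor
  · rintro ⟨⟨B, D⟩, ⟨N, hN, rfl, hD⟩, O, ⟨C₀, ⟨χ₀, hχ₀, rfl⟩, rfl⟩, C, hC, χ, hχ, rfl⟩
    have hA := hAT.normal N
    refine ⟨N, hN, hA, D, χ, hD, ?_, rfl⟩
    exact (mem_of_mem_coset_of_mem_orbit hq (isInertial_of_zpowers_eq hq hAT hD hχ₀) hC hχ).1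
  · rintro ⟨N, hN, hA, D, χ, hD, h, rfl⟩
    exact ⟨(A N, D), ⟨N, hN, rfl, hD⟩, _, ⟨_, ⟨χ, zpowers_eq_of_ker h.ker, rfl⟩, rfl⟩, _,
      self_mem_cosetOrbit _, χ, self_mem_cyclotomicCoset hq h.ker, rfl⟩

/-- Every irreducible representation of a normally monomial group has an eigenvector for a
character attached to one of the pairs. -/
lemma exists_eigenvector_of_isNormallyMonomial (hq : (Nat.card F).Coprime (Nat.card G))
    (hAT : IsAdmissibleChoice A T) (hNM : IsNormallyMonomial (AlgebraicClosure F) G)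
    {V : Type u} [AddCommGroup V] [Module (AlgebraicClosure F) V]
    {ρ : Representation (AlgebraicClosure F) G V} (hρ : ρ.IsIrreducible) :
    ∃ (N : Subgroup G) (_ : N.Normal) (_ : (A N).Normal)
      (D : Subgroup G) (χ : LinChar F (A N)), D ∈ T N ∧ IsInertial (A N) D χ ∧
        ∃ v : V, v ≠ 0 ∧ ∀ a : A N, ρ a v = (χ a : AlgebraicClosure F) • v := by
  obtain ⟨K, hK, ψ, ⟨e⟩⟩ := hNM V ρ hρ
  obtain ⟨w, hw, f, hfw, hf⟩ := exists_of_equiv_ind e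
  have hfd := finiteDimensional_of_irreducible hρ
  have hKcard := card_subgroup_ne_zero hq K
  have hw0 : w ≠ 0 := by
    rintro rfl
    rw [map_zero] at hfw
    exact charIdem_ne_zero hKcard ψ hfw.symm
  have hker : ∀ g, ρ g = 1 ↔ g ∈ MonoidHom.ker ρ := fun g => Iff.rfl
  set N := MonoidHom.ker ρ with hNdef
  have hA := hAT.normal N
  -- If g acts trivially on V it fixes e_ψ, the image of w in the group algebra, so it lies in K.
  have hNK : N ≤ K := fun g hg => by
    have h1 := hf g w
    rw [(hker g).2 hg, Module.End.one_apply, hfw] at h1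
    exact (mem_of_single_mul_charIdem_eq hKcard h1.symm).1
  -- K acts on the translates of w through conjugates of ψ, which are trivial on commutators, and
  -- these translates span V.
  have hKc : ∀ a ∈ K, ∀ b ∈ K, a * b * a⁻¹ * b⁻¹ ∈ N := fun a ha b hb => by
    rw [← hker]
    have hab : a * b * a⁻¹ * b⁻¹ ∈ K := mul_mem (mul_mem (mul_mem ha hb) (inv_mem ha)) (inv_mem hb)
    refine LinearMap.ext_on_range (span_orbit_eq_top hρ hw0) fun g => ?_
    have h1 : g⁻¹ * (a * b * a⁻¹ * b⁻¹) * g ∈ K := by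
      simpa using hK.conj_mem _ hab g⁻¹
    have h2 : ψ ⟨_, h1⟩ = 1 := by
      have : (⟨_, h1⟩ : K) = MulAut.conjNormal g⁻¹ (⟨a, ha⟩ * ⟨b, hb⟩ * ⟨a, ha⟩⁻¹ * ⟨b, hb⟩⁻¹) := by
        ext; simp; group
      rw [this]
      simp only [map_mul, map_inv]
      rw [mul_right_comm (ψ _), mul_inv_cancel, one_mul, mul_inv_cancel]
    rw [Module.End.one_apply, ← Module.End.mul_apply, ← map_mul]
    have h3 : a * b * a⁻¹ * b⁻¹ * g = g * (g⁻¹ * (a * b * a⁻¹ * b⁻¹) * g) := by group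
    rw [h3, map_mul, Module.End.mul_apply, hw ⟨_, h1⟩, h2, Units.val_one, one_smul]
  -- The translates of w map to translates of e_ψ, whose supports are distinct cosets of K.
  have hdimK : K.index ≤ Module.finrank (AlgebraicClosure F) V := by
    have : Fintype (G ⧸ K) := Fintype.ofFinite _
    have hli : LinearIndependent (AlgebraicClosure F) fun x : G ⧸ K => ρ (Quotient.out x) w := by
      refine linearIndependent_of_dual (fun x => (Finsupp.lapply (Quotient.out x)) ∘ₗ
        (coeffLinearEquiv (AlgebraicClosure F)).toLinearMap ∘ₗ f) ?_ fun x => ?_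
      · intro x y hxy
        change (f (ρ (Quotient.out y) w)).coeff (Quotient.out x) = 0
        rw [hf, hfw, coeff_single_mul_apply, one_mul]
        refine coeff_charIdem_of_notMem ψ fun h => hxy ?_
        have := (QuotientGroup.eq (s := K)).2 h
        rwa [QuotientGroup.out_eq', QuotientGroup.out_eq', eq_comm] at this
      · change (f (ρ (Quotient.out x) w)).coeff (Quotient.out x) ≠ 0
        rw [hf, hfw, coeff_single_mul_apply, one_mul, inv_mul_cancel]
        have := coeff_charIdem_of_mem ψ 1
        rw [OneMemClass.coe_one] at this
        rw [this]
        simpa using hKcard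
    rw [Subgroup.index_eq_card, Nat.card_eq_fintype_card]
    exact hli.fintype_card_le_finrank
  have hcomm : ∀ a b : A N, ρ a * ρ b = ρ b * ρ a := fun a b => by
    have h1 := (hker _).2 (hAT.commutator_mem N a a.2 b b.2)
    have h2 : (a : G) * b = a * b * (a : G)⁻¹ * (b : G)⁻¹ * (b * a) := by group
    rw [← map_mul, ← map_mul, h2, map_mul, h1, one_mul]
  obtain ⟨χ, v, hv, hχv⟩ := exists_eigenvector_of_commute hρ hcomm
  -- The eigenvector of A_N bounds the dimension above by [G:A_N]; the maximal order of A_N/N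
  -- compares this with [G:K], which bounds it below.
  have hdim : Module.finrank (AlgebraicClosure F) V = (A N).index :=
    le_antisymm (finrank_le_index hρ hv hχv) ((hAT.index_le N hK hNK hKc).trans hdimK)
  have hconj : ∀ (g : G) (a : A N), ρ a (ρ g v) =
      (conjHom g⁻¹ χ a : AlgebraicClosure F) • ρ g v := fun g a => by
    have h1 : (a : G) * g = g * (MulAut.conjNormal g⁻¹ a : A N) := by
      simp [mul_assoc]
    rw [← Module.End.mul_apply, ← map_mul, h1, map_mul, Module.End.mul_apply, hχv, map_smul,
      conjHom_apply]
  have hin : IsInertial (A N) (χ.ker.map (A N).subtype) χ := by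
    refine ⟨Subgroup.map_subtype_le _, fun a => ?_, fun g hg => ?_⟩
    · simp [Subgroup.mem_map, MonoidHom.mem_ker]
    · refine mem_of_finrank_eq hρ hv hχv hdim fun a => ?_
      have h1 : conjHom g⁻¹ χ = χ := by
        conv_lhs => rw [← hg]
        rw [← conjHom_mul, mul_inv_cancel, conjHom_one]
      rw [hconj, h1]
  set D := χ.ker.map (A N).subtype with hDdef
  -- The kernel of ρ consists of the g on which every conjugate of χ is trivial, since the
  -- translates of v are eigenvectors for these conjugates and span V.
  have hcore : D.normalCore = N := by
    refine le_antisymm (fun g hg => ?_) (Subgroup.normal_le_normalCore.2 fun g hg => ?_)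
    · rw [← hker]
      refine LinearMap.ext_on_range (span_orbit_eq_top hρ hv) fun x => ?_
      have hgA : g ∈ A N := hin.le (D.normalCore_le hg)
      have h1 : conjHom x⁻¹ χ ⟨g, hgA⟩ = 1 := by
        rw [conjHom_apply, hin.ker]
        exact hg x⁻¹
      rw [hconj x ⟨g, hgA⟩, h1, Units.val_one, one_smul, Module.End.one_apply]
    · have hgA : g ∈ A N := (hAT N).1 hg
      rw [← hin.ker ⟨g, hgA⟩]
      have h1 := hχv ⟨g, hgA⟩
      change ρ g v = _ at h1
      rw [(hker g).2 hg, Module.End.one_apply] at h1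
      have h2 : (1 : AlgebraicClosure F) • v = (χ ⟨g, hgA⟩ : AlgebraicClosure F) • v := by
        rw [← h1, one_smul]
      exact Units.ext (smul_left_injective _ hv h2).symm
  have hDmem : D ∈ kernelSet N (A N) := by
    have := hin.mem_kernelSet
    rwa [hcore] at this
  -- Only a conjugate of D need lie in 𝒯_N, so χ and v are moved by the same g.
  obtain ⟨D', ⟨hD', g, rfl⟩, -⟩ := (hAT N).2.2.2 D hDmem
  refine ⟨N, inferInstance, hA, _, conjHom g⁻¹ χ, hD', ?_, ρ g v, fun h0 => hv ?_, hconj g⟩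
  · have := hin.conj g⁻¹
    rwa [inv_inv] at this
  · have h1 := congrArg (ρ g⁻¹) h0
    rwa [← Module.End.mul_apply, ← map_mul, inv_mul_cancel, map_one, Module.End.one_apply,
      map_zero] at h1

end Pairs

/-! ### The idempotents are complete exactly for normally monomial groups -/

section Complete

variable {F : Type u} [Field F] [Finite F] {G : Type v} [Group G] [Finite G]
  {A : Subgroup G → Subgroup G} {T : Subgroup G → Set (Subgroup G)}

lemma isCentralIdempotent_toClosure {e : MonoidAlgebra F G} (he : IsCentralIdempotent e) :
    IsCentralIdempotent (toClosure F G e) :=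
  ⟨toClosure_mem_center he.1, by
    have := congrArg (toClosure F G) he.2.eq
    rwa [map_mul] at this⟩

/-- The splitting e = ef + (e - ef) forces ef to be 0 or e. By symmetry it is 0 or f, so a nonzero
product would give e = f. -/
lemma IsPrimitiveCentralIdempotent.mul_eq_zero {R : Type*} [Ring R] {e f : R}
    (he : IsPrimitiveCentralIdempotent e) (hf : IsPrimitiveCentralIdempotent f) (hne : e ≠ f) :
    e * f = 0 := by
  have hcf : ∀ x, x * f = f * x := Subring.mem_center_iff.1 hf.1.1
  have key : ∀ a b : R, IsPrimitiveCentralIdempotent a → IsCentralIdempotent b →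
      a * b = 0 ∨ a * b = a := fun a b ha hb => by
    have haa : a * a = a := ha.1.2
    have hbb : b * b = b := hb.2
    have hc : ∀ x, x * a = a * x := Subring.mem_center_iff.1 ha.1.1
    have h1 : a * b * (a * b) = a * b := by
      rw [mul_assoc, ← mul_assoc b, hc b, mul_assoc a b b, hbb, ← mul_assoc, haa]
    have h2 : IsCentralIdempotent (a * b) := ⟨mul_mem ha.1.1 hb.1, h1⟩
    have h3 : IsCentralIdempotent (a - a * b) := by
      refine ⟨sub_mem ha.1.1 h2.1, ?_⟩
      change (a - a * b) * (a - a * b) = a - a * b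
      rw [sub_mul, mul_sub, mul_sub, haa, h1, ← mul_assoc, haa, hc (a * b), ← mul_assoc, haa]
      simp
    rcases ha.2.2 _ _ h2 h3 (by rw [mul_sub, h1, hc (a * b), ← mul_assoc, haa, sub_self])
      (by simp) with h | h
    · exact Or.inl h
    · exact Or.inr (sub_eq_zero.1 h).symm
  rcases key e f he hf.1 with h | h
  · exact h
  · rcases key f e hf he.1 with h' | h'
    · rw [hcf, h']
    · exact absurd (by rw [← h, hcf, h']) hne

/-- Over k the element is a sum of idempotents e_ψ, so one of them is nonzero on V, and every vector
in its image is a ψ-eigenvector. -/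
lemma exists_mem_charOrbit_eigenvector (hq : (Nat.card F).Coprime (Nat.card G))
    {B D : Subgroup G} [B.Normal] {χ : LinChar F B} (h : IsInertial B D χ)
    {V : Type*} [AddCommGroup V] [Module (AlgebraicClosure F) V]
    {ρ : Representation (AlgebraicClosure F) G V}
    (hne : ρ.asAlgebraHom (toClosure F G (conjugateSum (epsilon B D χ))) ≠ 0) :
    ∃ ψ ∈ charOrbit χ, ∃ v : V, v ≠ 0 ∧ ∀ a : B, ρ a v = (ψ a : AlgebraicClosure F) • v := by
  by_contra! hcon
  apply hne
  rw [toClosure_conjugateSum_epsilon hq h.ker, charSum,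
    finsum_mem_eq_finite_toFinset_sum _ (finite_charOrbit hq h.ker), map_sum]
  refine Finset.sum_eq_zero fun ψ hψ => LinearMap.ext fun v => ?_
  by_contra h0
  obtain ⟨a, ha⟩ := hcon ψ (by simpa using hψ) _ h0
  exact ha (apply_asAlgebraHom_charIdem a v)

lemma finite_monoidAlgebra : Module.Finite F (MonoidAlgebra F G) :=
  Module.Finite.equiv (coeffLinearEquiv (S := F) (M := G) F).symm

/-- The Wedderburn decomposition of `F[G]`. -/
lemma exists_algEquiv_pi_matrix (hq : (Nat.card F).Coprime (Nat.card G)) :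
    ∃ (n : ℕ) (D : Fin n → Type (max u v)) (d : Fin n → ℕ) (_ : ∀ i, DivisionRing (D i))
      (_ : ∀ i, Algebra F (D i)) (_ : ∀ i, Module.Finite F (D i)), (∀ i, NeZero (d i)) ∧
      Nonempty (MonoidAlgebra F G ≃ₐ[F] Π i, Matrix (Fin (d i)) (Fin (d i)) (D i)) := by
  have : NeZero (Nat.card G : F) := ⟨natCast_ne_zero_of_coprime F hq⟩
  have := finite_monoidAlgebra (F := F) (G := G)
  exact IsSemisimpleRing.exists_algEquiv_pi_matrix_divisionRing_finite F (MonoidAlgebra F G)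

lemma isPrimitiveCentralIdempotent_iff_exists {R : Type*} [Ring R] {ι : Type*} [DecidableEq ι]
    {S : ι → Type*} [∀ i, Ring (S i)] [∀ i, IsSimpleRing (S i)] (φ : R ≃+* ∀ i, S i) {e : R} :
    IsPrimitiveCentralIdempotent e ↔ ∃ i, e = φ.symm (Pi.single i 1) := by
  constructor
  · intro h
    obtain ⟨i, hi⟩ := isPrimitiveCentralIdempotent_pi_iff.1 (h.map φ)
    exact ⟨i, by rw [← hi, φ.symm_apply_apply]⟩
  · rintro ⟨i, rfl⟩
    exact (isPrimitiveCentralIdempotent_pi_iff.2 ⟨i, rfl⟩).map φ.symm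

/-- Some primitive central idempotent acts nontrivially on a given irreducible representation. -/
lemma exists_primitive_asAlgebraHom_ne_zero (hq : (Nat.card F).Coprime (Nat.card G))
    {V : Type*} [AddCommGroup V] [Module (AlgebraicClosure F) V]
    {ρ : Representation (AlgebraicClosure F) G V} (hρ : ρ.IsIrreducible) :
    ∃ e : MonoidAlgebra F G, IsPrimitiveCentralIdempotent e ∧
      ρ.asAlgebraHom (toClosure F G e) ≠ 0 := by
  obtain ⟨n, D, d, _, _, _, hd, ⟨φ⟩⟩ := exists_algEquiv_pi_matrix (F := F) (G := G) hq
  by_contra! hcon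
  have h1 : ∑ i, φ.symm (Pi.single i 1) = 1 := by
    rw [← map_sum, Finset.univ_sum_single (fun i => (1 : Matrix (Fin (d i)) (Fin (d i)) (D i)))]
    exact map_one φ.symm
  have h2 := congrArg (fun x => ρ.asAlgebraHom (toClosure F G x)) h1
  simp only [map_sum, map_one] at h2
  have h3 : ∀ i, ρ.asAlgebraHom (toClosure F G (φ.symm (Pi.single i 1))) = 0 := fun i =>
    hcon _ ((isPrimitiveCentralIdempotent_iff_exists φ.toRingEquiv).2 ⟨i, rfl⟩)
  rw [Finset.sum_eq_zero fun i _ => h3 i] at h2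
  have := nontrivial_of_irreducible hρ
  exact zero_ne_one h2

theorem idempotentSet_eq_iff (hq : (Nat.card F).Coprime (Nat.card G))
    (hAT : IsAdmissibleChoice A T) :
    idempotentSet F (pairSet A T) = {e : MonoidAlgebra F G | IsPrimitiveCentralIdempotent e} ↔
      IsNormallyMonomial (AlgebraicClosure F) G := by
  constructor
  · intro hE V _ _ ρ hρ
    obtain ⟨e, he, hne⟩ := exists_primitive_asAlgebraHom_ne_zero hq hρ
    have he' : e ∈ idempotentSet F (pairSet A T) := hE ▸ he
    obtain ⟨N, hN, hA, D, χ, hD, h, rfl⟩ := (mem_idempotentSet_iff hq hAT).1 he'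
    obtain ⟨_, ⟨g, i, rfl⟩, v, hv, hψv⟩ := exists_mem_charOrbit_eigenvector hq h hne
    -- The inertia condition passes to every member of the orbit, so V has dimension [G:A] and is
    -- induced from A.
    have h1 := ((h.conj g).pow i).inertia
    exact ⟨A N, hA, _, nonempty_equiv_ind hρ hv hψv (finrank_eq_index_of_inertia hq h1 hρ hv hψv)⟩
  · intro hNM
    ext e
    constructor
    · intro he
      obtain ⟨N, hN, hA, D, χ, hD, h, rfl⟩ := (mem_idempotentSet_iff hq hAT).1 he
      exact h.isPrimitiveCentralIdempotent hq
    · intro he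
      have hcl := isCentralIdempotent_toClosure he.1
      obtain ⟨V, _, _, ρ, hρ, h1⟩ := exists_irreducible_of_isCentralIdempotent hcl
        fun h0 => he.2.1 (toClosure_injective (h0.trans (map_zero _).symm))
      obtain ⟨N, hN, hA, D, χ, hD, h, v, hv, hχv⟩ :=
        exists_eigenvector_of_isNormallyMonomial hq hAT hNM hρ
      refine (mem_idempotentSet_iff hq hAT).2 ⟨N, hN, hA, D, χ, hD, h, ?_⟩
      -- Otherwise the two primitive idempotents are orthogonal. But e is the identity on V, and e_C
      -- fixes e_χ, which fixes v, so their product sends v to itself.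
      by_contra hne
      have h2 := he.mul_eq_zero (h.isPrimitiveCentralIdempotent hq) hne
      have h3 := congrArg (fun x => ρ.asAlgebraHom (toClosure F G x * charIdem χ) v) h2
      simp only [map_mul, map_zero, zero_mul, mul_assoc, LinearMap.zero_apply] at h3
      rw [← map_mul ρ.asAlgebraHom (toClosure F G (conjugateSum _)),
        h.toClosure_mul_charIdem hq (self_mem_charOrbit χ), h1, one_mul,
        asAlgebraHom_charIdem_of_eigenvector hq hχv] at h3
      exact hv h3

end Complete

/-! ### The fields `F_{q^m}` -/

section FieldOfDegree

variable {F : Type u} [Field F] [Finite F]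

lemma finite_ncard_pow_eq_self {L : Type*} [Field L] {N : ℕ} (hN : 1 < N) :
    {x : L | x ^ N = x}.Finite ∧ {x : L | x ^ N = x}.ncard ≤ N := by
  classical
  have hne := FiniteField.X_pow_card_sub_X_ne_zero L hN
  have heq : {x : L | x ^ N = x} =
      ((Polynomial.X ^ N - Polynomial.X : Polynomial L).roots.toFinset : Set L) := by
    ext x
    simp [Polynomial.mem_roots hne, sub_eq_zero]
  rw [heq, Set.ncard_coe_finset]
  refine ⟨Finset.finite_toSet _, ?_⟩
  calc _ ≤ (Polynomial.X ^ N - Polynomial.X : Polynomial L).roots.card := Multiset.toFinset_card_le _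
    _ ≤ _ := Polynomial.card_roots' _
    _ = N := FiniteField.X_pow_card_sub_X_natDegree_eq L hN

variable {E : Type*} [DivisionRing E] [Algebra F E] [Module.Finite F E]

/-- The embedded copy of E consists of roots of X^(q^m) - X, so it has at most q^m elements. -/
lemma finrank_le_of_pow_eq_self (ω : E →ₐ[F] AlgebraicClosure F) {m : ℕ} (hm : 0 < m)
    (hω : ∀ z, ω z ^ (Nat.card F ^ m) = ω z) : Module.finrank F E ≤ m := by
  have hq : 1 < Nat.card F := Finite.one_lt_card
  obtain ⟨hfin, hcard⟩ := finite_ncard_pow_eq_self (L := AlgebraicClosure F)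
    (Nat.one_lt_pow hm.ne' hq)
  have h1 : (Set.range ω).ncard ≤ Nat.card F ^ m :=
    (Set.ncard_le_ncard (by rintro _ ⟨z, rfl⟩; exact hω z) hfin).trans hcard
  have hinj : Function.Injective ω := ω.toRingHom.injective
  rw [← Set.image_univ, Set.ncard_image_of_injective _ hinj, Set.ncard_univ,
    Module.natCard_eq_pow_finrank (K := F) (V := E)] at h1
  exact (Nat.pow_le_pow_iff_right hq).1 h1

lemma nonempty_algEquiv_fieldOfDegree (ω : E →ₐ[F] AlgebraicClosure F) {m : ℕ} (hm : 0 < m)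
    (hω : ∀ z, ω z ^ (Nat.card F ^ m) = ω z) (hdim : Module.finrank F E = m) :
    Nonempty (E ≃ₐ[F] fieldOfDegree F m) := by
  have hq : 1 < Nat.card F := Finite.one_lt_card
  obtain ⟨hfin, hcard⟩ := finite_ncard_pow_eq_self (L := AlgebraicClosure F)
    (Nat.one_lt_pow hm.ne' hq)
  have hinj : Function.Injective ω := ω.toRingHom.injective
  have hrange : Set.range ω = {x | x ^ (Nat.card F ^ m) = x} := by
    refine Set.eq_of_subset_of_ncard_le (by rintro _ ⟨z, rfl⟩; exact hω z) ?_ hfin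
    rw [← Set.image_univ, Set.ncard_image_of_injective _ hinj, Set.ncard_univ,
      Module.natCard_eq_pow_finrank (K := F) (V := E), hdim]
    exact hcard
  have hmem : ∀ z, ω z ∈ fieldOfDegree F m := fun z =>
    IntermediateField.subset_adjoin F _ (hω z)
  have hsurj : ∀ x ∈ fieldOfDegree F m, ∃ z, ω z = x := fun x hx => by
    refine IntermediateField.adjoin_induction F (p := fun x _ => ∃ z, ω z = x) ?_ ?_ ?_ ?_ ?_ hx
    · intro x hx
      rw [← hrange] at hx
      exact hx
    · exact fun x => ⟨algebraMap F E x, ω.commutes x⟩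
    · rintro _ _ _ _ ⟨z, rfl⟩ ⟨z', rfl⟩
      exact ⟨z + z', map_add ..⟩
    · rintro _ _ ⟨z, rfl⟩
      exact ⟨z⁻¹, map_inv₀ ω z⟩
    · rintro _ _ _ _ ⟨z, rfl⟩ ⟨z', rfl⟩
      exact ⟨z * z', map_mul ..⟩
  let ω' : E →ₐ[F] fieldOfDegree F m := ω.codRestrict (fieldOfDegree F m).toSubalgebra hmem
  refine ⟨AlgEquiv.ofBijective ω' ⟨fun z z' h => hinj (congrArg Subtype.val h), fun x => ?_⟩⟩
  obtain ⟨z, hz⟩ := hsurj x x.2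
  exact ⟨z, Subtype.ext hz⟩

end FieldOfDegree

/-! ### The simple component of `e_C(G,A,D)` -/

section Component

variable {F : Type u} [Field F] [Finite F] {G : Type v} [Group G] [Finite G]
variable {A D : Subgroup G} [A.Normal] {χ : LinChar F A}

/-- The left ideal generated by `e_χ` has dimension at most `[G : A]`. -/
lemma finrank_range_mulRight_charIdem_le (χ : LinChar F A) :
    Module.finrank (AlgebraicClosure F)
      (LinearMap.range (LinearMap.mulRight (AlgebraicClosure F) (charIdem χ))) ≤ A.index := by
  have : Fintype (G ⧸ A) := Fintype.ofFinite _
  have hfd : FiniteDimensional (AlgebraicClosure F) (MonoidAlgebra (AlgebraicClosure F) G) :=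
    Module.Finite.equiv (coeffLinearEquiv (S := AlgebraicClosure F) (M := G)
      (AlgebraicClosure F)).symm
  let b := fun x : G ⧸ A => (single (Quotient.out x) 1 * charIdem χ :
    MonoidAlgebra (AlgebraicClosure F) G)
  have hle : LinearMap.range (LinearMap.mulRight (AlgebraicClosure F) (charIdem χ)) ≤
      Submodule.span (AlgebraicClosure F) (Set.range b) := by
    rintro _ ⟨x, rfl⟩
    rw [LinearMap.mulRight_apply]
    induction x using MonoidAlgebra.induction_linear with
    | zero => simp
    | add x y hx hy => rw [add_mul]; exact add_mem hx hy
    | single g r =>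
      have h1 : (Quotient.out (QuotientGroup.mk g : G ⧸ A))⁻¹ * g ∈ A :=
        (QuotientGroup.eq (s := A)).1 (QuotientGroup.out_eq' (QuotientGroup.mk g : G ⧸ A))
      have h2 : (single g r : MonoidAlgebra (AlgebraicClosure F) G) =
          r • (single (Quotient.out (QuotientGroup.mk g : G ⧸ A)) 1 *
            single ((⟨_, h1⟩ : A) : G) 1) := by
        rw [single_mul_single]; simp
      rw [h2, smul_mul_assoc, mul_assoc, single_mul_charIdem, mul_smul_comm]
      exact Submodule.smul_mem _ _ (Submodule.smul_mem _ _ (Submodule.subset_span ⟨_, rfl⟩))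
  refine (Submodule.finrank_mono hle).trans ((finrank_range_le_card b).trans_eq ?_)
  rw [Subgroup.index_eq_card, Nat.card_eq_fintype_card]

/-- Distinct characters `χ ^ (q ^ i)`, `i < m`, are not conjugate. -/
lemma IsInertial.eq_of_conjHom_pow_eq (h : IsInertial A D χ) {m : ℕ}
    (hm : ∀ i : ℕ, (∃ g, conjHom g χ = χ ^ (Nat.card F ^ i)) → m ∣ i) {i j : ℕ}
    (hi : i < m) (hj : j < m) {g : G}
    (hg : conjHom g (χ ^ (Nat.card F ^ i)) = χ ^ (Nat.card F ^ j)) : i = j ∧ g ∈ A := by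
  have key : ∀ {i j : ℕ} {g : G}, i ≤ j → j < m →
      conjHom g (χ ^ (Nat.card F ^ i)) = χ ^ (Nat.card F ^ j) → i = j := by
    intro i j g hij hj hg
    -- The i-th power of Frobenius is injective on characters and commutes with conjugation, so it
    -- cancels from both sides.
    have h1 : conjHom g χ = χ ^ (Nat.card F ^ (j - i)) := by
      refine pow_card_pow_injective i ?_
      change conjHom g χ ^ _ = (χ ^ (Nat.card F ^ (j - i))) ^ (Nat.card F ^ i)
      rw [pow_card_pow_pow, Nat.sub_add_cancel hij, ← hg, conjHom_pow]
    have := Nat.eq_zero_of_dvd_of_lt (hm _ ⟨g, h1⟩) (by omega)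
    omega
  have hij : i = j := by
    rcases le_total i j with hle | hle
    · exact key hle hj hg
    · have h1 : conjHom g⁻¹ (χ ^ (Nat.card F ^ j)) = χ ^ (Nat.card F ^ i) := by
        rw [← hg, ← conjHom_mul, mul_inv_cancel, conjHom_one]
      exact (key hle hi h1).symm
  subst hij
  exact ⟨rfl, (h.pow i).inertia g hg⟩

/-- These elements behave like matrix units of m blocks of size [G:A]. Multiplying by e x⁻¹ on the
left and by y e on the right isolates one of them, since the characters χ^(q^i) with i < m are
inertial and pairwise nonconjugate. -/
lemma IsInertial.linearIndependent_charIdem (hq : (Nat.card F).Coprime (Nat.card G))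
    (h : IsInertial A D χ) {m : ℕ}
    (hm : ∀ i : ℕ, (∃ g, conjHom g χ = χ ^ (Nat.card F ^ i)) → m ∣ i) :
    LinearIndependent (AlgebraicClosure F) fun p : (G ⧸ A) × Fin m × (G ⧸ A) =>
      (single (Quotient.out p.1) 1 * charIdem (χ ^ (Nat.card F ^ (p.2.1 : ℕ))) *
        single (Quotient.out p.2.2)⁻¹ 1 : MonoidAlgebra (AlgebraicClosure F) G) := by
  have hA := card_subgroup_ne_zero hq A
  have hid : ∀ g : G, (single g⁻¹ 1 * single g 1 : MonoidAlgebra (AlgebraicClosure F) G) = 1 :=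
    fun g => by rw [single_mul_single, inv_mul_cancel, mul_one, ← one_def]
  have hL : ∀ (x y : G ⧸ A) (i j : Fin m), (x, i) ≠ (y, j) →
      charIdem (χ ^ (Nat.card F ^ (i : ℕ))) * single (Quotient.out x)⁻¹ 1 *
        (single (Quotient.out y) 1 * charIdem (χ ^ (Nat.card F ^ (j : ℕ)))) = 0 := by
    intro x y i j hne
    rw [← mul_assoc, mul_assoc (charIdem _), single_mul_single, mul_one]
    refine charIdem_mul_single_mul_charIdem fun hc => hne ?_
    obtain ⟨h1, h2⟩ := h.eq_of_conjHom_pow_eq hm i.2 j.2 hc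
    have h3 := (QuotientGroup.eq (s := A)).2 h2
    rw [QuotientGroup.out_eq', QuotientGroup.out_eq'] at h3
    rw [h3, Fin.ext h1]
  refine linearIndependent_of_dual (fun p =>
    LinearMap.mulRight _ (single (Quotient.out p.2.2) 1 *
      charIdem (χ ^ (Nat.card F ^ (p.2.1 : ℕ)))) ∘ₗ
    LinearMap.mulLeft _ (charIdem (χ ^ (Nat.card F ^ (p.2.1 : ℕ))) *
      single (Quotient.out p.1)⁻¹ 1)) ?_ ?_
  · rintro ⟨x, i, y⟩ ⟨x', i', y'⟩ hne
    simp only [LinearMap.comp_apply, LinearMap.mulLeft_apply, LinearMap.mulRight_apply]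
    by_cases h1 : (x, i) = (x', i')
    · have h2 : (y', i') ≠ (y, i) := fun h2 => hne (by
        simp only [Prod.mk.injEq] at h1 h2 ⊢
        exact ⟨h1.1, h1.2, h2.1.symm⟩)
      have h3 := hL y' y i' i h2
      have h4 : charIdem (χ ^ (Nat.card F ^ (i : ℕ))) * single (Quotient.out x)⁻¹ 1 *
          (single (Quotient.out x') 1 * charIdem (χ ^ (Nat.card F ^ (i' : ℕ))) *
            single (Quotient.out y')⁻¹ 1) *
          (single (Quotient.out y) 1 * charIdem (χ ^ (Nat.card F ^ (i : ℕ)))) =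
          charIdem (χ ^ (Nat.card F ^ (i : ℕ))) * single (Quotient.out x)⁻¹ 1 *
            single (Quotient.out x') 1 * (charIdem (χ ^ (Nat.card F ^ (i' : ℕ))) *
            single (Quotient.out y')⁻¹ 1 *
            (single (Quotient.out y) 1 * charIdem (χ ^ (Nat.card F ^ (i : ℕ))))) := by
        simp only [mul_assoc]
      rw [h4, h3, mul_zero]
    · rw [← mul_assoc _ (_ * _) (single _ _), hL x x' i i' h1, zero_mul, zero_mul]
  · rintro ⟨x, i, y⟩
    simp only [LinearMap.comp_apply, LinearMap.mulLeft_apply, LinearMap.mulRight_apply]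
    have h1 : charIdem (χ ^ (Nat.card F ^ (i : ℕ))) * single (Quotient.out x)⁻¹ 1 *
        (single (Quotient.out x) 1 * charIdem (χ ^ (Nat.card F ^ (i : ℕ))) *
          single (Quotient.out y)⁻¹ 1) *
        (single (Quotient.out y) 1 * charIdem (χ ^ (Nat.card F ^ (i : ℕ)))) =
        charIdem (χ ^ (Nat.card F ^ (i : ℕ))) * (single (Quotient.out x)⁻¹ 1 *
          single (Quotient.out x) 1) * charIdem (χ ^ (Nat.card F ^ (i : ℕ))) *
          (single (Quotient.out y)⁻¹ 1 *
        single (Quotient.out y) 1) * charIdem (χ ^ (Nat.card F ^ (i : ℕ))) := by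
      simp only [mul_assoc]
    rw [h1, hid, hid, mul_one, mul_one, charIdem_mul_self hA, charIdem_mul_self hA]
    exact charIdem_ne_zero hA _

end Component

/-! ### The structure of the simple component of `e_C(G,A,D)` -/

section Structure

variable {F : Type u} [Field F] [Finite F] {G : Type v} [Group G] [Finite G]

/-- `j` is an isomorphism of a matrix algebra onto the two-sided ideal generated by the central
idempotent `s`. -/
structure IsComponentMap {E : Type*} [DivisionRing E] [Algebra F E] {d : ℕ}
    (j : Matrix (Fin d) (Fin d) E →ₗ[F] MonoidAlgebra F G) (s : MonoidAlgebra F G) : Prop where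
  map_mul : ∀ M N, j (M * N) = j M * j N
  map_one : j 1 = s
  exists_eq : ∀ x, ∃ M, j M = s * x

variable {E : Type*} [DivisionRing E] [Algebra F E] {d : ℕ}
  {j : Matrix (Fin d) (Fin d) E →ₗ[F] MonoidAlgebra F G} {s : MonoidAlgebra F G}

/-- E is finite, so it is commutative by Wedderburn's little theorem and its scalar matrices are
central; multiplication by s reduces any x to the image of a matrix. -/
lemma IsComponentMap.scalar_mem_center [Module.Finite F E] (hj : IsComponentMap j s)
    (hs : s ∈ Subring.center (MonoidAlgebra F G)) (z : E) :
    j (Matrix.scalar (Fin d) z) ∈ Subring.center (MonoidAlgebra F G) := by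
  have : Finite E := Module.finite_of_finite F
  have hc : ∀ a b : E, a * b = b * a := (littleWedderburn E).mul_comm
  refine Subring.mem_center_iff.2 fun x => ?_
  obtain ⟨M, hM⟩ := hj.exists_eq x
  have h1 : j (Matrix.scalar (Fin d) z) * s = j (Matrix.scalar (Fin d) z) := by
    rw [← hj.map_one, ← hj.map_mul, mul_one]
  have h2 : s * j (Matrix.scalar (Fin d) z) = j (Matrix.scalar (Fin d) z) := by
    rw [← hj.map_one, ← hj.map_mul, one_mul]
  have h3 : M * Matrix.scalar (Fin d) z = Matrix.scalar (Fin d) z * M :=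
    (Matrix.scalar_commute z (fun a => hc z a) M).eq.symm
  calc x * j (Matrix.scalar (Fin d) z) = s * x * j (Matrix.scalar (Fin d) z) := by
        rw [← Subring.mem_center_iff.1 hs, mul_assoc, h2]
    _ = j (Matrix.scalar (Fin d) z) * (s * x) := by rw [← hM, ← hj.map_mul, h3, hj.map_mul]
    _ = j (Matrix.scalar (Fin d) z) * x := by rw [← mul_assoc, h1]

variable {A D : Subgroup G} [A.Normal] {χ : LinChar F A}

namespace IsInertial

/-- The center of the component acts on `e_χ` through a field embedding. -/
lemma exists_algHom_of_isComponentMap [Module.Finite F E]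
    (hq : (Nat.card F).Coprime (Nat.card G)) (h : IsInertial A D χ)
    (hj : IsComponentMap j (conjugateSum (epsilon A D χ))) {m : ℕ} {g : G}
    (hg : conjHom g χ = χ ^ (Nat.card F ^ m)) :
    ∃ ω : E →ₐ[F] AlgebraicClosure F, ∀ z, ω z ^ (Nat.card F ^ m) = ω z := by
  have hcen := hj.scalar_mem_center (h.mem_center hq)
  have he := charIdem_ne_zero (card_subgroup_ne_zero hq A) χ
  have hinj := smul_left_injective (AlgebraicClosure F) he
  choose w hw using fun z => h.exists_toClosure_mul_charIdem hq (hcen z)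
  have hs := h.toClosure_mul_charIdem hq (self_mem_charOrbit χ)
  refine ⟨{ toFun := w, map_one' := hinj ?_, map_mul' := fun a b => hinj ?_,
            map_zero' := hinj ?_, map_add' := fun a b => hinj ?_,
            commutes' := fun r => hinj ?_ }, fun z => ?_⟩
  · change w 1 • charIdem χ = (1 : AlgebraicClosure F) • charIdem χ
    rw [← hw, map_one, hj.map_one, hs, one_smul]
  · change w (a * b) • charIdem χ = (w a * w b) • charIdem χ
    rw [← hw, map_mul, hj.map_mul, map_mul, mul_assoc, hw, mul_smul_comm, hw, smul_smul,
      mul_comm (w b)]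
  · change w 0 • charIdem χ = (0 : AlgebraicClosure F) • charIdem χ
    rw [← hw, map_zero, map_zero, map_zero, zero_mul, zero_smul]
  · change w (a + b) • charIdem χ = (w a + w b) • charIdem χ
    rw [← hw, map_add, map_add, map_add, add_mul, hw, hw, add_smul]
  · change w (algebraMap F E r) • charIdem χ =
      algebraMap F (AlgebraicClosure F) r • charIdem χ
    have h1 : Matrix.scalar (Fin d) (algebraMap F E r) = r • (1 : Matrix (Fin d) (Fin d) E) := by
      rw [Algebra.smul_def, mul_one]; rfl
    rw [← hw, h1, map_smul, hj.map_one, map_smul, smul_mul_assoc, hs, algebraMap_smul]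
  -- The idempotent of χ^(q^m) is reached from e_χ both by Frobenius, with scalar ω(z)^(q^m), and by
  -- conjugation with g, with scalar ω(z).
  · change w z ^ _ = w z
    have h1 := toClosure_mul_charIdem_conj_pow (hcen z) (hw z) 1 m
    have h2 := toClosure_mul_charIdem_conj_pow (hcen z) (hw z) g 0
    rw [conjHom_one] at h1
    rw [pow_card_pow_zero, hg, h1, pow_zero, pow_one] at h2
    exact smul_left_injective _ (charIdem_ne_zero (card_subgroup_ne_zero hq A) _) h2

/-- A nonzero vector in the image of one diagonal matrix unit on k[G] e_χ is moved by the units of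
its column to d independent vectors, and this left ideal has dimension at most [G:A]. -/
lemma le_index_of_isComponentMap [NeZero d] (hq : (Nat.card F).Coprime (Nat.card G))
    (h : IsInertial A D χ) (hj : IsComponentMap j (conjugateSum (epsilon A D χ))) :
    d ≤ A.index := by
  have he := charIdem_ne_zero (card_subgroup_ne_zero hq A) χ
  have hs := h.toClosure_mul_charIdem hq (self_mem_charOrbit χ)
  have hfd : FiniteDimensional (AlgebraicClosure F) (MonoidAlgebra (AlgebraicClosure F) G) :=
    Module.Finite.equiv (coeffLinearEquiv (S := AlgebraicClosure F) (M := G)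
      (AlgebraicClosure F)).symm
  set J : Matrix (Fin d) (Fin d) E → MonoidAlgebra (AlgebraicClosure F) G :=
    fun M => toClosure F G (j M) with hJ
  have hJmul : ∀ M N, J M * J N = J (M * N) := fun M N => by
    rw [hJ]; simp only [hj.map_mul, map_mul]
  obtain ⟨x, hx⟩ : ∃ x, J (Matrix.single 0 0 1) * (x * charIdem χ) ≠ 0 := by
    by_contra! hcon
    apply he
    -- The unit matrix lies in the two-sided ideal of E₀₀, so if E₀₀ killed k[G] e_χ, then s, which
    -- fixes e_χ, would kill it.
    have h1 : (1 : Matrix (Fin d) (Fin d) E) = ∑ i, Matrix.single i 0 1 *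
        (Matrix.single 0 0 1 * Matrix.single 0 i 1) := by
      rw [← Matrix.sum_single_one]
      exact Finset.sum_congr rfl fun i _ => by simp
    rw [← hs, ← hj.map_one, h1, map_sum, map_sum, Finset.sum_mul]
    refine Finset.sum_eq_zero fun i _ => ?_
    change J _ * _ = 0
    rw [← hJmul, ← hJmul, mul_assoc, mul_assoc, hcon, mul_zero]
  have hli : LinearIndependent (AlgebraicClosure F) fun i : Fin d =>
      J (Matrix.single i 0 1) * (x * charIdem χ) := by
    refine linearIndependent_of_dual (fun i => LinearMap.mulLeft _ (J (Matrix.single 0 i 1))) ?_ ?_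
    · intro i i' hne
      rw [LinearMap.mulLeft_apply, ← mul_assoc, hJmul, Matrix.single_mul_single_of_ne _ _ _ _ hne]
      simp [hJ]
    · intro i
      rw [LinearMap.mulLeft_apply, ← mul_assoc, hJmul, Matrix.single_mul_single_same, mul_one]
      exact hx
  have h1 := finrank_span_eq_card hli
  rw [Fintype.card_fin] at h1
  rw [← h1]
  refine (Submodule.finrank_mono (Submodule.span_le.2 ?_)).trans
    (finrank_range_mulRight_charIdem_le χ)
  rintro _ ⟨i, rfl⟩
  exact ⟨J (Matrix.single i 0 1) * x, mul_assoc ..⟩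

/-- The k-span of the component has dimension at most d²[E:F], and it contains the m[G:A]²
independent elements built from the χ^(q^i). -/
lemma index_mul_index_mul_le_of_isComponentMap [Module.Finite F E]
    (hq : (Nat.card F).Coprime (Nat.card G)) (h : IsInertial A D χ)
    (hj : IsComponentMap j (conjugateSum (epsilon A D χ))) {m : ℕ}
    (hm : ∀ i : ℕ, (∃ g, conjHom g χ = χ ^ (Nat.card F ^ i)) → m ∣ i) :
    A.index * (m * A.index) ≤ d * d * Module.finrank F E := by
  have : Fintype (G ⧸ A) := Fintype.ofFinite _
  have hfd : FiniteDimensional (AlgebraicClosure F) (MonoidAlgebra (AlgebraicClosure F) G) :=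
    Module.Finite.equiv (coeffLinearEquiv (S := AlgebraicClosure F) (M := G)
      (AlgebraicClosure F)).symm
  let b := Module.finBasis F (Matrix (Fin d) (Fin d) E)
  let f := fun i => toClosure F G (j (b i))
  have hJ : ∀ M, toClosure F G (j M) ∈ Submodule.span (AlgebraicClosure F) (Set.range f) := by
    intro M
    rw [← b.sum_repr M, map_sum, map_sum]
    refine Submodule.sum_mem _ fun i _ => ?_
    rw [map_smul, map_smul, ← algebraMap_smul (AlgebraicClosure F)]
    exact Submodule.smul_mem _ _ (Submodule.subset_span ⟨i, rfl⟩)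
  have hmem : ∀ y, toClosure F G (conjugateSum (epsilon A D χ)) * y ∈
      Submodule.span (AlgebraicClosure F) (Set.range f) := by
    intro y
    induction y using MonoidAlgebra.induction_linear with
    | zero => simp
    | add x y hx hy => rw [mul_add]; exact add_mem hx hy
    | single g r =>
      have h1 : (single g r : MonoidAlgebra (AlgebraicClosure F) G) =
          r • toClosure F G (single g 1) := by simp [toClosure_single]
      obtain ⟨M, hM⟩ := hj.exists_eq (single g 1)
      rw [h1, mul_smul_comm, ← map_mul, ← hM]
      exact Submodule.smul_mem _ _ (hJ M)
  have h1 := finrank_span_eq_card (h.linearIndependent_charIdem hq hm)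
  rw [Fintype.card_prod, Fintype.card_prod, Fintype.card_fin, ← Nat.card_eq_fintype_card,
    ← Subgroup.index_eq_card] at h1
  rw [← h1]
  refine (Submodule.finrank_mono (Submodule.span_le.2 ?_)).trans
    ((finrank_range_le_card f).trans_eq ?_)
  · rintro _ ⟨⟨x, i, y⟩, rfl⟩
    have h2 : χ ^ (Nat.card F ^ (i : ℕ)) ∈ charOrbit χ := by
      have := conjHom_pow_mem_charOrbit (self_mem_charOrbit χ) 1 (i : ℕ)
      rwa [conjHom_one] at this
    have h3 := h.toClosure_mul_charIdem hq h2
    have h4 := Subring.mem_center_iff.1 (toClosure_mem_center (h.mem_center hq))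
    have h5 := hmem (single (Quotient.out x) 1 * charIdem (χ ^ (Nat.card F ^ (i : ℕ))) *
      single (Quotient.out y)⁻¹ 1)
    rwa [← mul_assoc, ← mul_assoc, ← h4, mul_assoc (single _ _), h3] at h5
  · rw [Fintype.card_fin, Module.finrank_matrix, Fintype.card_fin]

/-- The simple component of `e_C(G,A,D)` is a matrix algebra of degree `[G : A]` over the field of
degree `o / [E_G(A/D) : A]`. -/
lemma structure_of_isComponentMap [Module.Finite F E] [NeZero d]
    (hq : (Nat.card F).Coprime (Nat.card G)) (h : IsInertial A D χ)
    (hj : IsComponentMap j (conjugateSum (epsilon A D χ))) {C : Set (LinChar F A)}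
    (hC : C ∈ cosetSet F A D) :
    d = A.index ∧ Nonempty (E ≃ₐ[F] fieldOfDegree F
      (ordMod F A D / A.relIndex (cosetStabilizer F A D C))) := by
  obtain ⟨hm, hdvd⟩ := h.exists_conjHom_eq_iff_dvd hq hC
  set m := ordMod F A D / A.relIndex (cosetStabilizer F A D C)
  obtain ⟨g, hg⟩ := (hdvd m).2 dvd_rfl
  obtain ⟨ω, hω⟩ := h.exists_algHom_of_isComponentMap hq hj hg
  -- With h2 this gives [E:F] ≤ m and d ≤ [G:A], while h3 bounds d²[E:F] below by m[G:A]²;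
  -- positivity makes every inequality an equality.
  have h1 := finrank_le_of_pow_eq_self ω hm hω
  have h2 := h.le_index_of_isComponentMap hq hj
  have h3 := h.index_mul_index_mul_le_of_isComponentMap hq hj fun i hi => (hdvd i).1 hi
  have hd : 0 < d := Nat.pos_of_ne_zero (NeZero.ne d)
  have h4 : d = A.index := by
    refine h2.antisymm (le_of_not_gt fun hlt => ?_)
    have h5 : d * d < A.index * A.index := Nat.mul_lt_mul'' hlt hlt
    have h6 : d * d * Module.finrank F E ≤ d * d * m := Nat.mul_le_mul_left _ h1
    have h7 : d * d * m < A.index * A.index * m := Nat.mul_lt_mul_of_pos_right h5 hm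
    have h8 : A.index * (m * A.index) = A.index * A.index * m := by ring
    omega
  refine ⟨h4, nonempty_algEquiv_fieldOfDegree ω hm hω (h1.antisymm ?_)⟩
  have h8 : A.index * (m * A.index) = A.index * A.index * m := by ring
  rw [h8, ← h4] at h3
  exact Nat.le_of_mul_le_mul_left h3 (Nat.mul_pos hd hd)

end IsInertial

end Structure

/-! ### The decomposition of `F[G]` -/

section Decomposition

variable {F : Type u} [Field F] [Finite F] {G : Type v} [Group G] [Finite G]
  {A : Subgroup G → Subgroup G} {T : Subgroup G → Set (Subgroup G)}

lemma IsInertial.kernel_unique {B D D' : Subgroup G} [B.Normal] {χ : LinChar F B}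
    (h : IsInertial B D χ) (h' : IsInertial B D' χ) : D = D' := by
  ext x
  constructor
  · intro hx
    exact (h'.ker ⟨x, h.le hx⟩).1 ((h.ker ⟨x, h.le hx⟩).2 hx)
  · intro hx
    exact (h.ker ⟨x, h'.le hx⟩).1 ((h'.ker ⟨x, h'.le hx⟩).2 hx)

lemma mem_normalizer_of_map_conj_inv_eq {D : Subgroup G} {g : G}
    (hg : D.map (MulAut.conj g⁻¹).toMonoidHom = D) : g ∈ Subgroup.normalizer (D : Set G) := by
  refine Subgroup.mem_normalizer_iff.2 fun x => ⟨fun hx => ?_, fun hx => ?_⟩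
  · rw [← hg] at hx
    obtain ⟨y, hy, rfl⟩ := hx
    simpa [mul_assoc] using hy
  · rw [← hg]
    exact ⟨_, hx, by simp [mul_assoc]⟩

lemma cosetOrbit_eq_of_mem {B D : Subgroup G} {C C' : Set (LinChar F B)}
    (h : C' ∈ cosetOrbit F B D C) : cosetOrbit F B D C' = cosetOrbit F B D C := by
  have hmul : ∀ (g x : Subgroup.normalizer (B : Set G)) (X : Set (LinChar F B)),
      conjChar x '' (conjChar g '' X) = conjChar (g * x) '' X := fun g x X => by
    rw [← Set.image_comp]
    exact Set.image_congr fun χ _ => (conjChar_mul F g x χ).symm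
  obtain ⟨g, hg, rfl⟩ := h
  ext X
  constructor
  · rintro ⟨x, hx, rfl⟩
    exact ⟨g * x, mul_mem hg hx, hmul _ _ _⟩
  · rintro ⟨x, hx, rfl⟩
    refine ⟨g⁻¹ * x, mul_mem (inv_mem hg) hx, ?_⟩
    rw [hmul, mul_inv_cancel_left]

/-- Characters with kernel `D` in the same orbit have cyclotomic cosets in the same orbit of
`N_G(D)`. -/
lemma IsInertial.cosetOrbit_eq (hq : (Nat.card F).Coprime (Nat.card G)) {B D : Subgroup G}
    [B.Normal] {χ χ' : LinChar F B} (h : IsInertial B D χ) (h' : IsInertial B D χ')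
    (hmem : χ' ∈ charOrbit χ) :
    cosetOrbit F B D (cyclotomicCoset F B D χ') = cosetOrbit F B D (cyclotomicCoset F B D χ) := by
  obtain ⟨g, i, rfl⟩ := hmem
  refine cosetOrbit_eq_of_mem ⟨⟨g, mem_normalizer_of_normal g⟩,
    mem_normalizer_of_map_conj_inv_eq (((h.conj g).pow i).kernel_unique h'), ?_⟩
  ext ψ
  rw [mem_cyclotomicCoset_iff hq h'.ker]
  constructor
  · rintro ⟨l, rfl⟩
    refine ⟨χ ^ (Nat.card F ^ (i + l)), (mem_cyclotomicCoset_iff hq h.ker).2 ⟨_, rfl⟩, ?_⟩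
    rw [conjChar_eq_conjHom, conjHom_pow, pow_card_pow_pow]
  · rintro ⟨_, hφ, rfl⟩
    obtain ⟨l, rfl⟩ := (mem_cyclotomicCoset_iff hq h.ker).1 hφ
    refine ⟨(ordMod F B D - 1) * i + l, ?_⟩
    have : i + ((ordMod F B D - 1) * i + l) = ordMod F B D * i + l := by
      obtain ⟨m, hm⟩ := Nat.exists_eq_succ_of_ne_zero (ordMod_pos hq B D).ne'
      rw [hm]; simp; ring
    rw [conjChar_eq_conjHom, pow_card_pow_pow, this, ← conjHom_pow, ← pow_card_pow_pow,
      pow_card_pow_ordMod_mul h.ker]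

/-- A pair together with an orbit is determined by its idempotent. -/
lemma eq_of_conjugateSum_eq (hq : (Nat.card F).Coprime (Nat.card G))
    (hAT : IsAdmissibleChoice A T) {x y : Σ P : pairSet A T, orbitSet F P.1.1 P.1.2}
    [x.1.1.1.Normal] [y.1.1.1.Normal] {χ : LinChar F x.1.1.1} {χ' : LinChar F y.1.1.1}
    (h : IsInertial x.1.1.1 x.1.1.2 χ) (h' : IsInertial y.1.1.1 y.1.1.2 χ')
    (hx : x.2.1 = cosetOrbit F _ x.1.1.2 (cyclotomicCoset F _ x.1.1.2 χ))
    (hy : y.2.1 = cosetOrbit F _ y.1.1.2 (cyclotomicCoset F _ y.1.1.2 χ'))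
    (heq : conjugateSum (epsilon x.1.1.1 x.1.1.2 χ) =
      conjugateSum (epsilon y.1.1.1 y.1.1.2 χ')) : x = y := by
  obtain ⟨⟨⟨B, D⟩, hP⟩, ⟨O, hO⟩⟩ := x
  obtain ⟨⟨⟨B', D'⟩, hP'⟩, ⟨O', hO'⟩⟩ := y
  dsimp only at *
  obtain ⟨N, hN, hB, hD⟩ := id hP
  obtain ⟨N', hN', hB', hD'⟩ := id hP'
  dsimp only at hB hB' hD hD'
  subst hB hB'
  -- The idempotent determines N as its stabilizer under left multiplication, and hence A_N.
  have hNN : N = N' := by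
    rw [← ((hAT N).2.2.1 hD).2.2.1, ← ((hAT N').2.2.1 hD').2.2.1]
    ext g
    rw [h.mem_normalCore_iff hq, h'.mem_normalCore_iff hq, heq]
  subst hNN
  have hmem := h.mem_charOrbit_of_eq hq h' heq
  -- The two characters lie in one orbit and Frobenius preserves kernels, so D and D' are conjugate
  -- members of 𝒯_N.
  have hDD : D = D' := by
    obtain ⟨D₀, -, huniq⟩ := (hAT N).2.2.2 D ((hAT N).2.2.1 hD)
    have h1 := huniq D ⟨hD, 1, by
      ext; simp⟩
    obtain ⟨g, i, rfl⟩ := hmem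
    exact h1.trans (huniq D' ⟨hD', g⁻¹, h'.kernel_unique ((h.conj g).pow i)⟩).symm
  subst hDD
  have hOO : O = O' := by rw [hx, hy, h.cosetOrbit_eq hq h' hmem]
  subst hOO
  rfl

lemma exists_isInertial_of_mem_orbitSet (hq : (Nat.card F).Coprime (Nat.card G))
    (hAT : IsAdmissibleChoice A T) (x : Σ P : pairSet A T, orbitSet F P.1.1 P.1.2) :
    ∃ (_ : x.1.1.1.Normal) (χ : LinChar F x.1.1.1), IsInertial x.1.1.1 x.1.1.2 χ ∧
      x.2.1 = cosetOrbit F _ x.1.1.2 (cyclotomicCoset F _ x.1.1.2 χ) := by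
  obtain ⟨⟨⟨B, D⟩, hP⟩, ⟨_, _, ⟨χ, hχ, rfl⟩, rfl⟩⟩ := x
  obtain ⟨N, hN, hB, hD⟩ := id hP
  dsimp only at hB hD hχ ⊢
  subst hB
  have hA := hAT.normal N
  exact ⟨hA, χ, isInertial_of_zpowers_eq hq hAT hD hχ, rfl⟩

lemma isComponentMap_single {ι : Type*} [DecidableEq ι] {E : ι → Type*} {d : ι → ℕ}
    [∀ i, DivisionRing (E i)] [∀ i, Algebra F (E i)]
    (φ : MonoidAlgebra F G ≃ₐ[F] Π i, Matrix (Fin (d i)) (Fin (d i)) (E i)) (i : ι) :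
    IsComponentMap (φ.symm.toLinearMap ∘ₗ
        LinearMap.single F (fun i => Matrix (Fin (d i)) (Fin (d i)) (E i)) i)
      (φ.symm (Pi.single i 1)) where
  map_mul M N := by
    change φ.symm (Pi.single i (M * N)) = φ.symm (Pi.single i M) * φ.symm (Pi.single i N)
    rw [Pi.single_mul, map_mul]
  map_one := rfl
  exists_eq x := by
    refine ⟨φ x i, ?_⟩
    change φ.symm (Pi.single i (φ x i)) = _
    rw [AlgEquiv.symm_apply_eq, map_mul, AlgEquiv.apply_symm_apply]
    ext1 l
    by_cases hl : l = i
    · subst hl; simp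
    · simp [hl]

lemma nonempty_algEquiv_pi_of_sigma {R : Type*} [CommRing R] {ι κ : Type*} {μ : κ → Type*}
    (X : ι → Type*) (Y : κ → Type*) [∀ i, Ring (X i)] [∀ i, Algebra R (X i)] [∀ k, Ring (Y k)]
    [∀ k, Algebra R (Y k)] (σ : (Σ k, μ k) ≃ ι)
    (h : ∀ p : Σ k, μ k, Nonempty (X (σ p) ≃ₐ[R] Y p.1)) :
    Nonempty ((Π i, X i) ≃ₐ[R] Π k, μ k → Y k) := by
  let ε := fun p => (h p).some
  exact ⟨(AlgEquiv.piCongrLeft R X σ).symm.trans <| (AlgEquiv.piCongrRight ε).trans <|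
    AlgEquiv.ofLinearEquiv (LinearEquiv.piCurry R fun (k : κ) (_ : μ k) => Y k) rfl
      fun _ _ => rfl⟩

/-- The primitive central idempotents of a normally monomial group are indexed by the pairs
together with the orbits. -/
lemma exists_bijective_of_isNormallyMonomial (hq : (Nat.card F).Coprime (Nat.card G))
    (hAT : IsAdmissibleChoice A T) (hNM : IsNormallyMonomial (AlgebraicClosure F) G)
    {ι : Type*} [DecidableEq ι] {S : ι → Type*} [∀ i, Ring (S i)] [∀ i, IsSimpleRing (S i)]
    (φ : MonoidAlgebra F G ≃+* ∀ i, S i) :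
    ∃ f : (Σ P : pairSet A T, orbitSet F P.1.1 P.1.2) → ι, Function.Bijective f ∧
      ∀ x : Σ P : pairSet A T, orbitSet F P.1.1 P.1.2, ∃ (_ : x.1.1.1.Normal)
        (χ : LinChar F x.1.1.1), IsInertial x.1.1.1 x.1.1.2 χ ∧
        conjugateSum (epsilon x.1.1.1 x.1.1.2 χ) = φ.symm (Pi.single (f x) 1) := by
  choose hn χ hχ hO using exists_isInertial_of_mem_orbitSet (F := F) hq hAT
  choose f hf using fun x => (isPrimitiveCentralIdempotent_iff_exists φ).1
    ((hχ x).isPrimitiveCentralIdempotent hq)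
  refine ⟨f, ⟨fun x y hxy => ?_, fun i => ?_⟩, fun x => ⟨hn x, χ x, hχ x, hf x⟩⟩
  · exact eq_of_conjugateSum_eq hq hAT (hχ x) (hχ y) (hO x) (hO y) (by rw [hf, hf, hxy])
  · have h1 : φ.symm (Pi.single i 1) ∈ idempotentSet F (pairSet A T) := by
      rw [(idempotentSet_eq_iff hq hAT).2 hNM]
      exact (isPrimitiveCentralIdempotent_iff_exists φ).2 ⟨i, rfl⟩
    obtain ⟨P, hP, O, hOP, C, hC, ψ, hψ, heq⟩ := h1
    let x : Σ P : pairSet A T, orbitSet F P.1.1 P.1.2 := ⟨⟨P, hP⟩, ⟨O, hOP⟩⟩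
    -- The character selected for x need not be ψ, but both belong to the same orbit of cosets, and
    -- this already gives the same idempotent.
    have h2 : C ∈ cosetOrbit F _ x.1.1.2 (cyclotomicCoset F _ x.1.1.2 (χ x)) := by
      rw [← hO x]; exact hC
    have h3 := mem_of_mem_coset_of_mem_orbit hq (hχ x) h2 hψ
    refine ⟨x, ?_⟩
    have h4 := (hχ x).conjugateSum_eq_of_mem hq h3.1 h3.2
    rw [hf] at h4
    have h5 := φ.symm.injective (h4.trans heq.symm)
    by_contra hne
    have h6 := congrFun h5 i
    rw [Pi.single_eq_same, Pi.single_eq_of_ne (Ne.symm hne)] at h6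
    exact zero_ne_one h6

theorem nonempty_algEquiv (hq : (Nat.card F).Coprime (Nat.card G))
    (hAT : IsAdmissibleChoice A T) (hNM : IsNormallyMonomial (AlgebraicClosure F) G)
    (C : ∀ P : pairSet A T, Set (LinChar F P.1.1))
    (hC : ∀ P, C P ∈ cosetSet F P.1.1 P.1.2) :
    Nonempty (MonoidAlgebra F G ≃ₐ[F] (∀ P : pairSet A T,
      Fin (Nat.card (orbitSet F P.1.1 P.1.2)) → Matrix (Fin P.1.1.index) (Fin P.1.1.index)
        (fieldOfDegree F (ordMod F P.1.1 P.1.2 /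
          P.1.1.relIndex (cosetStabilizer F P.1.1 P.1.2 (C P)))))) := by
  obtain ⟨n, E, d, _, _, _, hd, ⟨φ⟩⟩ := exists_algEquiv_pi_matrix (F := F) (G := G) hq
  obtain ⟨f, hbij, hf⟩ := exists_bijective_of_isNormallyMonomial hq hAT hNM φ.toRingEquiv
  have hcomp : ∀ x, Nonempty (Matrix (Fin (d (f x))) (Fin (d (f x))) (E (f x)) ≃ₐ[F]
      Matrix (Fin x.1.1.1.index) (Fin x.1.1.1.index) (fieldOfDegree F (ordMod F x.1.1.1 x.1.1.2 /
        x.1.1.1.relIndex (cosetStabilizer F x.1.1.1 x.1.1.2 (C x.1))))) := fun x => by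
    obtain ⟨_, χ, hχ, hs⟩ := hf x
    have hj := isComponentMap_single φ (f x)
    have hs' : φ.symm (Pi.single (f x) 1) = conjugateSum (epsilon x.1.1.1 x.1.1.2 χ) := hs.symm
    rw [hs'] at hj
    obtain ⟨h1, ⟨ε⟩⟩ := hχ.structure_of_isComponentMap hq hj (hC x.1)
    exact ⟨(Matrix.reindexAlgEquiv F _ (finCongr h1)).trans ε.mapMatrix⟩
  -- Injectivity into the finite set of components makes ℛ(A/D) finite; otherwise `Nat.card` would
  -- be 0 and the multiplicity wrong.
  have hfin : ∀ P : pairSet A T, Finite (orbitSet F P.1.1 P.1.2) := fun P =>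
    Finite.of_injective (fun O => f ⟨P, O⟩) fun O O' h =>
      eq_of_heq (Sigma.mk.inj (hbij.1 h)).2
  exact (nonempty_algEquiv_pi_of_sigma _ _
    ((Equiv.sigmaCongrRight fun P => (Finite.equivFin (orbitSet F P.1.1 P.1.2)).symm).trans
      (Equiv.ofBijective f hbij)) fun p => hcomp ⟨p.1, (Finite.equivFin _).symm p.2⟩).map φ.trans

end Decomposition

end NormMon

end

/-! ### The completeness criterion and the decomposition of F[G] -/

theorem theorem1 {F : Type u} [Field F] [Finite F] {G : Type v} [Group G] [Finite G]
    (hq : (Nat.card F).Coprime (Nat.card G))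
    (A : Subgroup G → Subgroup G) (T : Subgroup G → Set (Subgroup G))
    (hAT : NormMon.IsAdmissibleChoice A T) :
    (NormMon.idempotentSet F (NormMon.pairSet A T) =
        {e : MonoidAlgebra F G | NormMon.IsPrimitiveCentralIdempotent e} ↔
      NormMon.IsNormallyMonomial (AlgebraicClosure F) G) ∧
    (NormMon.IsNormallyMonomial (AlgebraicClosure F) G →
      ∀ C : ∀ P : NormMon.pairSet A T, Set (NormMon.LinChar F P.1.1),
        (∀ P, C P ∈ NormMon.cosetSet F P.1.1 P.1.2) →
        Nonempty (MonoidAlgebra F G ≃ₐ[F]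
          (∀ P : NormMon.pairSet A T,
            Fin (Nat.card (NormMon.orbitSet F P.1.1 P.1.2)) →
              Matrix (Fin P.1.1.index) (Fin P.1.1.index)
                (NormMon.fieldOfDegree F
                  (NormMon.ordMod F P.1.1 P.1.2 /
                    P.1.1.relIndex (NormMon.cosetStabilizer F P.1.1 P.1.2 (C P))))))) :=
  ⟨NormMon.idempotentSet_eq_iff hq hAT, fun hNM C hC => NormMon.nonempty_algEquiv hq hAT hNM C hC⟩
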